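/- In the \textsc{Set Partition} problem one is given a bipartite graph $G=(F\,\dot\cup\,U,E)$ with $|U|=n$ and $|F|=m$ and an integer $s$ (together an $(n,m,s)$-instance), and asks whether there is $S\subseteq F$ with $|S|=s$, $\bigcup_{f\in S}N(f)=U$ and $N(f)\cap N(f')=\emptyset$ for all distinct $f,f'\in S$. An algorithm has oracle access to the instance if it is given $n$ and $s$, with $U=\{0,\dots,n-1\}$, and can learn about $G$ only by querying subsets $X\subseteq U$; a query is answered by whether there exists $f\in F$ with $N(f)=X$, and it takes time $T\ge 1$ (an integer). Theorem. There exist a randomized algorithm $A$ (a single program of a random access machine with logarithmic cost, fair coin tosses and oracle calls) and constants $c>0$ and $C,d\in\mathbb{N}$ such that the following holds for all $n$, $m$, all $\sigma\le 1$ for which $s=\sigma n$ is a nonnegative integer, all $T \ge 1$, and every $(n,m,\sigma n)$-instance of \textsc{Set Partition} satisfying $0<|N(f)|\le\sigma^4n/8$ for every $f\in F$. Given oracle access to the instance, (i) for every outcome of the coin tosses, $A$ halts within $2^{(1-c\sigma^4)n}\cdot C(n+1)^d\cdot T$ steps; (ii) if there is no set partition of size $\sigma n$, then $A$ never outputs YES;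 (iii) if there is a set partition of size $\sigma n$, then $A$ outputs YES with probability at least $3/4$. In other words, there is a Monte Carlo algorithm for these instances running in $2^{(1-\Omega(\sigma^4))n}\,\mathrm{poly}(n)\,T$ time. -/

import Mathlib

/-! ### Set Partition -/

/-- A bipartite graph `(F ∪ U, E)` with `F = Fin m` (the family) and `U = Fin n` (the universe). -/
structure FamilyGraph (m n : ℕ) where
  edges : Finset (Fin m × Fin n)

namespace FamilyGraph

variable {m n : ℕ}

/-- The neighbourhood `N(f) ⊆ U` of `f ∈ F`. -/
def nbr (G : FamilyGraph m n) (f : Fin m) : Finset (Fin n) :=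
  Finset.univ.filter fun u => (f, u) ∈ G.edges

/-- `G` has a set partition of size `s`: some `S ⊆ F` with `|S| = s`, `N(S) = U`, and
`N(f) ∩ N(f') = ∅` for all distinct `f, f'` in `S`. -/
def HasSetPartition (G : FamilyGraph m n) (s : ℕ) : Prop :=
  ∃ S : Finset (Fin m), S.biUnion G.nbr = Finset.univ ∧ S.card = s ∧
    ∀ f ∈ S, ∀ g ∈ S, f ≠ g → G.nbr f ∩ G.nbr g = ∅

end FamilyGraph

/-- A subset of `{0, …, n - 1}` written as a number: bit `i` is set iff `i` belongs to it. -/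
def subsetCode {n : ℕ} (X : Finset (Fin n)) : ℕ :=
  ∑ i ∈ X, 2 ^ (i : ℕ)

open Classical in
/-- The oracle of `G`: on (the code of) `X ⊆ U` it decides whether some `f ∈ F` has `N(f) = X`.
A number that is not the code of a subset of `U` is answered negatively. -/
noncomputable def FamilyGraph.oracle {m n : ℕ} (G : FamilyGraph m n) (x : ℕ) : Bool :=
  decide (∃ f : Fin m, subsetCode (G.nbr f) = x)

/-! ### Randomized random access machines with an oracle, logarithmic cost

The memory is a sequence of cells that hold natural numbers. Every elementary operation is charged
for the lengths of all numbers (values and addresses) that it handles, multiplication and division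
are charged for the product of the lengths, and an oracle call is charged an additional `T`. -/

namespace RAM

/-- The memory: cell `a` holds the number `M a`. -/
abbrev Memory := ℕ → ℕ

/-- The cost of handling the number `a`: its binary length plus one. -/
def len (a : ℕ) : ℕ := Nat.size a + 1

inductive Expr where
  /-- a constant of the program -/
  | const (k : ℕ)
  /-- the content of the cell whose address is the value of the argument -/
  | read (e : Expr)
  | plus (e₁ e₂ : Expr)
  /-- truncated subtraction -/
  | monus (e₁ e₂ : Expr)
  | times (e₁ e₂ : Expr)
  /-- the integer part of the quotient (`0` if the divisor is `0`) -/
  | quot (e₁ e₂ : Expr)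

/-- The value of an expression. -/
def Expr.val (M : Memory) : Expr → ℕ
  | const k => k
  | read e => M (e.val M)
  | plus e₁ e₂ => e₁.val M + e₂.val M
  | monus e₁ e₂ => e₁.val M - e₂.val M
  | times e₁ e₂ => e₁.val M * e₂.val M
  | quot e₁ e₂ => e₁.val M / e₂.val M

/-- The number of steps that the evaluation of an expression takes. -/
def Expr.cost (M : Memory) : Expr → ℕ
  | const k => len k
  | read e => e.cost M + len (e.val M) + len (M (e.val M))
  | plus e₁ e₂ => e₁.cost M + e₂.cost M + len (e₁.val M) + len (e₂.val M)
  | monus e₁ e₂ => e₁.cost M + e₂.cost M + len (e₁.val M) + len (e₂.val M)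
  | times e₁ e₂ => e₁.cost M + e₂.cost M + len (e₁.val M) * len (e₂.val M)
  | quot e₁ e₂ => e₁.cost M + e₂.cost M + len (e₁.val M) * len (e₂.val M)

inductive Program where
  | skip
  /-- `store a e` writes the value of `e` into the cell with address `a` -/
  | store (a e : Expr)
  /-- `flip a` writes a fresh random bit into the cell with address `a` -/
  | flip (a : Expr)
  /-- `query a e` writes the answer (`1` or `0`) of the oracle on the value of `e` into the cell
  with address `a` -/
  | query (a e : Expr)
  | seq (p q : Program)
  /-- `branch e p q` runs `p` if the value of `e` is not `0`, and `q` otherwise -/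
  | branch (e : Expr) (p q : Program)
  /-- `loop e p` repeats `p` as long as the value of `e` is not `0` -/
  | loop (e : Expr) (p : Program)

/-- A snapshot of a run: the memory, the number of random bits used and the steps made so far. -/
structure Config where
  mem : Memory
  coins : ℕ
  time : ℕ

/-- `Exec O T ω p k k'`: the program `p`, started in `k`, halts in `k'`, when the oracle is `O`,
an oracle call takes time `T`, and the random bits are `ω 0, ω 1, …`, in this order. -/
inductive Exec (O : ℕ → Bool) (T : ℕ) (ω : ℕ → Bool) : Program → Config → Config → Prop where
  | skip (k : Config) :
      Exec O T ω .skip k ⟨k.mem, k.coins, k.time + 1⟩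
  | store (a e : Expr) (k : Config) :
      Exec O T ω (.store a e) k
        ⟨Function.update k.mem (a.val k.mem) (e.val k.mem), k.coins,
          k.time + (a.cost k.mem + e.cost k.mem + len (a.val k.mem) + len (e.val k.mem))⟩
  | flip (a : Expr) (k : Config) :
      Exec O T ω (.flip a) k
        ⟨Function.update k.mem (a.val k.mem) (ω k.coins).toNat, k.coins + 1,
          k.time + (a.cost k.mem + len (a.val k.mem) + 1)⟩
  | query (a e : Expr) (k : Config) :
      Exec O T ω (.query a e) k
        ⟨Function.update k.mem (a.val k.mem) (O (e.val k.mem)).toNat, k.coins,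
          k.time + (a.cost k.mem + e.cost k.mem + len (a.val k.mem) + len (e.val k.mem) + T)⟩
  | seq (p q : Program) (k k₁ k₂ : Config) :
      Exec O T ω p k k₁ → Exec O T ω q k₁ k₂ → Exec O T ω (.seq p q) k k₂
  | branch_true (e : Expr) (p q : Program) (k k' : Config) :
      e.val k.mem ≠ 0 → Exec O T ω p ⟨k.mem, k.coins, k.time + (e.cost k.mem + 1)⟩ k' →
      Exec O T ω (.branch e p q) k k'
  | branch_false (e : Expr) (p q : Program) (k k' : Config) :
      e.val k.mem = 0 → Exec O T ω q ⟨k.mem, k.coins, k.time + (e.cost k.mem + 1)⟩ k' →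
      Exec O T ω (.branch e p q) k k'
  | loop_done (e : Expr) (p : Program) (k : Config) :
      e.val k.mem = 0 →
      Exec O T ω (.loop e p) k ⟨k.mem, k.coins, k.time + (e.cost k.mem + 1)⟩
  | loop_step (e : Expr) (p : Program) (k k₁ k₂ : Config) :
      e.val k.mem ≠ 0 → Exec O T ω p ⟨k.mem, k.coins, k.time + (e.cost k.mem + 1)⟩ k₁ →
      Exec O T ω (.loop e p) k₁ k₂ → Exec O T ω (.loop e p) k k₂

/-- The start of a run on the input numbers `n`, `s`: they stand in the cells `0` and `1`, and all
other cells hold `0`. -/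
def start (n s : ℕ) : Config :=
  ⟨fun a => if a = 0 then n else if a = 1 then s else 0, 0, 0⟩

/-- On input `n`, `s` with random bits `ω`, the program `p` halts after `t` steps. -/
def HaltsIn (p : Program) (O : ℕ → Bool) (T : ℕ) (n s : ℕ) (ω : ℕ → Bool) (t : ℕ) : Prop :=
  ∃ k, Exec O T ω p (start n s) k ∧ k.time = t

/-- On input `n`, `s` with random bits `ω`, the program `p` halts and outputs YES, which means that
cell `0` holds `1` at the end. Halting with anything else in cell `0` means NO. -/
def SaysYes (p : Program) (O : ℕ → Bool) (T : ℕ) (n s : ℕ) (ω : ℕ → Bool) : Prop :=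
  ∃ k, Exec O T ω p (start n s) k ∧ k.mem 0 = 1

/-- The law of an infinite sequence of independent fair coin tosses. -/
noncomputable def fairCoins : MeasureTheory.Measure (ℕ → Bool) :=
  MeasureTheory.Measure.infinitePi fun _ : ℕ => (PMF.uniformOfFintype Bool).toMeasure

end RAM

/-! ### Cost bounds and a program logic -/

namespace RAM

/-! The algorithm is deterministic and its answer is always correct, so only the running time needs
an idea. Fix R ⊆ U. Call a set unbalanced if it has at most |R|/2 - s/64 elements in R, or at most
|U \ R|/2 - s/64 elements outside R. A Chernoff bound (`card_unbalanced`) leaves at most 2 · 2^n ·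
exp(-s²/(2048 n)) such sets. For s = σn this is at most 2 · 2^((1 - σ^4/2048) n)
(`card_unbalanced_le_rpow`). It remains to see that unbalanced sets suffice, and that work can be
confined to them.

They suffice if R runs over the at most 2n + 1 supports of Walsh functions. Since σ^4 ≤ σ, all
blocks of a set partition have size at most s/8. Sort them by size and pair neighbours. By
orthogonality the Walsh sums over the two blocks of a pair differ by at least 1 in absolute value,
on average over the functions, so for one function the differences add up to at least the number of
pairs (`exists_walsh_sum_abs`). Choosing from each pair the block that leans away from R gives a
half that is sparse in R, while the remaining blocks are sparse outside R. The sorted order keeps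
the sizes of the two halves close enough for the gain to survive (`exists_half_of_sum_abs`,
`exists_unbalanced_halves`).

Work can be confined to them because unbalanced sets form a downward closed family. They can be
enumerated element by element, and the zeta transform and its inverse never read a value outside the
family. The k-th power of the zeta transform of the weights B^|f| is the transform of the weighted
count of k-tuples with a given union (`partialZeta_coverWeight`). For a tuple with union X the total
size is at least |X|, with equality exactly for partitions, so one base-B digit counts the
partitions of X (`coverWeight_div_mod`). A solution is found by matching an unbalanced set with its
complement.

On the machine side all cells hold at most (n + 2)^4 bits, so an elementary statement costs T +
O(n^8). `Reach` counts statements and `Reach.setPartitionProgram` collects the correctness and the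
count. -/

/-- The size of an expression, a constant `k` counting as `k + 1`. -/
def Expr.sz : Expr → ℕ
  | const k => k + 1
  | read e => e.sz + 1
  | plus e₁ e₂ => e₁.sz + e₂.sz + 1
  | monus e₁ e₂ => e₁.sz + e₂.sz + 1
  | times e₁ e₂ => e₁.sz + e₂.sz + 1
  | quot e₁ e₂ => e₁.sz + e₂.sz + 1

/-- All cells hold numbers of at most `L` bits. -/
def Bounded (L : ℕ) (M : Memory) : Prop := ∀ a, M a < 2 ^ L

theorem Bounded.update {L : ℕ} {M : Memory} (hM : Bounded L M) (a : ℕ) {v : ℕ} (hv : v < 2 ^ L) :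
    Bounded L (Function.update M a v) := by
  intro b
  rw [Function.update_apply]
  split_ifs
  · exact hv
  · exact hM b

/-- A product adds the lengths of its factors and a sum exceeds the longer one by at most a bit, so
length grows linearly with the size of the expression. Constants are covered by k < 2^k. -/
theorem Expr.val_lt {L : ℕ} (hL : 1 ≤ L) {M : Memory} (hM : Bounded L M) (e : Expr) :
    e.val M < 2 ^ (L * e.sz) := by
  induction e with
  | const k =>
    refine (Nat.lt_two_pow_self (n := k)).trans_le (Nat.pow_le_pow_right two_pos ?_)
    exact (Nat.le_succ k).trans (Nat.le_mul_of_pos_left _ hL)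
  | read e ih =>
    refine (hM _).trans_le (Nat.pow_le_pow_right two_pos ?_)
    simp only [Expr.sz]
    nlinarith
  | plus e₁ e₂ h₁ h₂ =>
    simp only [Expr.sz, Expr.val]
    have a1 : 2 ^ (L * e₁.sz) * 2 ≤ 2 ^ (L * (e₁.sz + e₂.sz + 1)) := by
      rw [← pow_succ]; exact Nat.pow_le_pow_right two_pos (by nlinarith)
    have a2 : 2 ^ (L * e₂.sz) * 2 ≤ 2 ^ (L * (e₁.sz + e₂.sz + 1)) := by
      rw [← pow_succ]; exact Nat.pow_le_pow_right two_pos (by nlinarith)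
    omega
  | monus e₁ e₂ h₁ h₂ =>
    refine (Nat.sub_le _ _).trans_lt (h₁.trans_le (Nat.pow_le_pow_right two_pos ?_))
    simp only [Expr.sz]
    nlinarith
  | times e₁ e₂ h₁ h₂ =>
    refine (Nat.mul_lt_mul'' h₁ h₂).trans_le ?_
    rw [← pow_add]
    refine Nat.pow_le_pow_right two_pos ?_
    simp only [Expr.sz]
    nlinarith
  | quot e₁ e₂ h₁ h₂ =>
    refine (Nat.div_le_self _ _).trans_lt (h₁.trans_le (Nat.pow_le_pow_right two_pos ?_))
    simp only [Expr.sz]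
    nlinarith

theorem len_le_of_lt {a b : ℕ} (h : a < 2 ^ b) : len a ≤ b + 1 :=
  Nat.succ_le_succ (Nat.size_le.2 h)

/-- Lengths add up along the tree, and the product of two lengths charged at a node fits into the
cross terms of the square of the sum. -/
theorem Expr.cost_le {L : ℕ} (hL : 1 ≤ L) {M : Memory} (hM : Bounded L M) (e : Expr) :
    e.cost M ≤ 4 * (L * e.sz) ^ 2 := by
  have bin : ∀ x y X Y lx ly : ℕ, X ≤ 4 * x ^ 2 → Y ≤ 4 * y ^ 2 → lx ≤ x + 1 → ly ≤ y + 1 →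
      X + Y + lx + ly ≤ 4 * (x + y + L) ^ 2 ∧ X + Y + lx * ly ≤ 4 * (x + y + L) ^ 2 := by
    intro x y X Y lx ly h1 h2 h3 h4
    have h5 : lx * ly ≤ (x + 1) * (y + 1) := Nat.mul_le_mul h3 h4
    constructor <;> nlinarith [Nat.zero_le (x * y), Nat.zero_le (x * L), Nat.zero_le (y * L)]
  have ex : ∀ a b : ℕ, L * (a + b + 1) = L * a + L * b + L := fun a b => by ring
  induction e with
  | const k =>
    have h0 : len k ≤ k + 1 := len_le_of_lt Nat.lt_two_pow_self
    have h : k + 1 ≤ L * (k + 1) := Nat.le_mul_of_pos_left _ hL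
    simp only [Expr.sz, Expr.cost]
    nlinarith
  | read e ih =>
    have h1 := len_le_of_lt (e.val_lt hL hM)
    have h2 := len_le_of_lt (hM (e.val M))
    simp only [Expr.sz, Expr.cost]
    have : L * (e.sz + 1) = L * e.sz + L := by ring
    rw [this]
    nlinarith [Nat.zero_le (L * e.sz * L)]
  | plus e₁ e₂ h₁ h₂ =>
    simp only [Expr.sz, Expr.cost, ex]
    exact (bin _ _ _ _ _ _ h₁ h₂ (len_le_of_lt (e₁.val_lt hL hM))
      (len_le_of_lt (e₂.val_lt hL hM))).1
  | monus e₁ e₂ h₁ h₂ =>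
    simp only [Expr.sz, Expr.cost, ex]
    exact (bin _ _ _ _ _ _ h₁ h₂ (len_le_of_lt (e₁.val_lt hL hM))
      (len_le_of_lt (e₂.val_lt hL hM))).1
  | times e₁ e₂ h₁ h₂ =>
    simp only [Expr.sz, Expr.cost, ex]
    exact (bin _ _ _ _ _ _ h₁ h₂ (len_le_of_lt (e₁.val_lt hL hM))
      (len_le_of_lt (e₂.val_lt hL hM))).2
  | quot e₁ e₂ h₁ h₂ =>
    simp only [Expr.sz, Expr.cost, ex]
    exact (bin _ _ _ _ _ _ h₁ h₂ (len_le_of_lt (e₁.val_lt hL hM))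
      (len_le_of_lt (e₂.val_lt hL hM))).2

/-- An upper bound on the cost of an elementary statement whose expressions have total size at
most `2999`, on numbers of at most `L` bits. -/
def unitCost (T L : ℕ) : ℕ := T + 4 * (L * 3000) ^ 2

/-- `SaysYes` only asserts that some run answers YES. Uniqueness of the run is what allows one
constructed run to exclude false positives. -/
theorem Exec.det {O : ℕ → Bool} {T : ℕ} {ω : ℕ → Bool} {p : Program} {k k₁ k₂ : Config}
    (h₁ : Exec O T ω p k k₁) (h₂ : Exec O T ω p k k₂) : k₁ = k₂ := by
  induction h₁ generalizing k₂ with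
  | skip k => cases h₂; rfl
  | store a e k => cases h₂; rfl
  | flip a k => cases h₂; rfl
  | query a e k => cases h₂; rfl
  | seq p q k k' k'' _ _ ih₁ ih₂ =>
    cases h₂ with
    | seq _ _ _ l _ h h' => obtain rfl := ih₁ h; exact ih₂ h'
  | branch_true e p q k k' he _ ih =>
    cases h₂ with
    | branch_true _ _ _ _ _ _ h => exact ih h
    | branch_false _ _ _ _ _ he' _ => exact absurd he' he
  | branch_false e p q k k' he _ ih =>
    cases h₂ with
    | branch_true _ _ _ _ _ he' _ => exact absurd he he'
    | branch_false _ _ _ _ _ _ h => exact ih h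
  | loop_done e p k he =>
    cases h₂ with
    | loop_done => rfl
    | loop_step _ _ _ _ _ he' _ _ => exact absurd he he'
  | loop_step e p k k' k'' he _ _ ih₁ ih₂ =>
    cases h₂ with
    | loop_done _ _ _ he' => exact absurd he' he
    | loop_step _ _ _ l _ _ h h' => obtain rfl := ih₁ h; exact ih₂ h'

/-- `p` transforms the memory `M` into `M'` within `t` steps, without coin tosses. -/
def Runs (O : ℕ → Bool) (T : ℕ) (ω : ℕ → Bool) (p : Program) (M M' : Memory) (t : ℕ) : Prop :=
  ∀ c τ, ∃ τ', τ' ≤ τ + t ∧ Exec O T ω p ⟨M, c, τ⟩ ⟨M', c, τ'⟩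

/-- Started with memory `M`, `p` halts with a bounded memory that satisfies `Q`, after at most
`N` elementary statements. -/
def Reach (O : ℕ → Bool) (T : ℕ) (ω : ℕ → Bool) (L : ℕ) (p : Program) (M : Memory) (N : ℕ)
    (Q : Memory → Prop) : Prop :=
  ∃ M', Bounded L M' ∧ Q M' ∧ Runs O T ω p M M' (N * unitCost T L)

variable {O : ℕ → Bool} {T : ℕ} {ω : ℕ → Bool} {L : ℕ}

/-! ### Rules for composing runs and counting their statements. -/

theorem Reach.mono {p : Program} {M : Memory} {N N' : ℕ} {Q Q' : Memory → Prop}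
    (h : Reach O T ω L p M N Q) (hN : N ≤ N') (hQ : ∀ M', Bounded L M' → Q M' → Q' M') :
    Reach O T ω L p M N' Q' := by
  obtain ⟨M', hb, hq, hr⟩ := h
  refine ⟨M', hb, hQ M' hb hq, fun c τ => ?_⟩
  obtain ⟨τ', h1, h2⟩ := hr c τ
  exact ⟨τ', h1.trans (Nat.add_le_add_left (Nat.mul_le_mul_right _ hN) _), h2⟩

theorem stmt_cost_le (hL : 1 ≤ L) {M : Memory} (hM : Bounded L M) {a e : Expr}
    (hsz : a.sz + e.sz + 1 ≤ 3000) :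
    a.cost M + e.cost M + len (a.val M) + len (e.val M) ≤ 4 * (L * 3000) ^ 2 := by
  have h1 := a.cost_le hL hM
  have h2 := e.cost_le hL hM
  have h3 := len_le_of_lt (a.val_lt hL hM)
  have h4 := len_le_of_lt (e.val_lt hL hM)
  have h5 : L * a.sz + L * e.sz + L ≤ L * 3000 := by nlinarith
  have h6 : (L * a.sz + L * e.sz + L) ^ 2 ≤ (L * 3000) ^ 2 := Nat.pow_le_pow_left h5 2
  nlinarith [Nat.zero_le (L * a.sz * (L * e.sz)), Nat.zero_le (L * a.sz * L),
    Nat.zero_le (L * e.sz * L)]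

theorem Reach.store (hL : 1 ≤ L) {M : Memory} (hM : Bounded L M) {a e : Expr} {x v : ℕ}
    {Q : Memory → Prop} (hsz : a.sz + e.sz + 1 ≤ 3000) (hx : a.val M = x) (he : e.val M = v)
    (hv : v < 2 ^ L) (hQ : Q (Function.update M x v)) :
    Reach O T ω L (.store a e) M 1 Q := by
  subst hx he
  refine ⟨_, hM.update _ hv, hQ, fun c τ => ⟨_, ?_, Exec.store a e ⟨M, c, τ⟩⟩⟩
  have := stmt_cost_le hL hM hsz
  simp only [unitCost]
  omega

theorem Reach.query (hL : 1 ≤ L) {M : Memory} (hM : Bounded L M) {a e : Expr} {x v : ℕ}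
    {Q : Memory → Prop} (hsz : a.sz + e.sz + 1 ≤ 3000) (hx : a.val M = x)
    (he : (O (e.val M)).toNat = v) (hQ : Q (Function.update M x v)) :
    Reach O T ω L (.query a e) M 1 Q := by
  subst hx he
  refine ⟨_, hM.update _ ?_, hQ, fun c τ => ⟨_, ?_, Exec.query a e ⟨M, c, τ⟩⟩⟩
  · exact (Bool.toNat_le _).trans_lt (Nat.one_lt_two_pow (by omega))
  · have := stmt_cost_le hL hM hsz
    simp only [unitCost]
    omega

theorem Reach.seq {p q : Program} {M : Memory} {N₁ N₂ : ℕ} {P Q : Memory → Prop}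
    (hp : Reach O T ω L p M N₁ P)
    (hq : ∀ M', Bounded L M' → P M' → Reach O T ω L q M' N₂ Q) :
    Reach O T ω L (.seq p q) M (N₁ + N₂) Q := by
  obtain ⟨M₁, hb, hP, hr⟩ := hp
  obtain ⟨M₂, hb', hQ, hr'⟩ := hq M₁ hb hP
  refine ⟨M₂, hb', hQ, fun c τ => ?_⟩
  obtain ⟨τ₁, h1, h2⟩ := hr c τ
  obtain ⟨τ₂, h3, h4⟩ := hr' c τ₁
  refine ⟨τ₂, ?_, Exec.seq _ _ _ _ _ h2 h4⟩
  rw [Nat.add_mul]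
  omega

/-- The invariant is indexed by the number of completed rounds. Each round pays for the body and one
evaluation of the guard; the final `+ 1` is the guard that ends the loop. -/
theorem Reach.loop (hL : 1 ≤ L) {e : Expr} {p : Program} (hsz : e.sz ≤ 2998)
    (I : ℕ → Memory → Prop) (m t : ℕ)
    (hgo : ∀ i M, i < m → I i M → e.val M ≠ 0) (hend : ∀ M, I m M → e.val M = 0)
    (hstep : ∀ i M, i < m → Bounded L M → I i M → Reach O T ω L p M t (I (i + 1)))
    {M : Memory} (hM : Bounded L M) (h0 : I 0 M) :
    Reach O T ω L (.loop e p) M (m * (t + 1) + 1) (I m) := by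
  have hcost : ∀ M, Bounded L M → e.cost M + 1 ≤ unitCost T L := by
    intro M hM
    -- A guard is treated as a statement with dummy address 0, whose own cost absorbs the extra step
    -- of the test.
    have := stmt_cost_le hL hM (a := .const 0) (e := e) (by simp only [Expr.sz]; omega)
    simp only [unitCost]
    simp only [Expr.cost, Expr.val, len] at this
    omega
  have key : ∀ d i M, i + d = m → Bounded L M → I i M →
      Reach O T ω L (.loop e p) M (d * (t + 1) + 1) (I m) := by
    intro d
    induction d with
    | zero =>
      intro i M hi hM hI
      obtain rfl : i = m := by omega
      refine ⟨M, hM, hI, fun c τ => ⟨_, ?_, Exec.loop_done e p ⟨M, c, τ⟩ (hend M hI)⟩⟩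
      have := hcost M hM
      simp only
      omega
    | succ d ih =>
      intro i M hi hM hI
      obtain ⟨M₁, hb, hI₁, hr⟩ := hstep i M (by omega) hM hI
      obtain ⟨M₂, hb', hI₂, hr'⟩ := ih (i + 1) M₁ (by omega) hb hI₁
      refine ⟨M₂, hb', hI₂, fun c τ => ?_⟩
      obtain ⟨τ₁, h1, h2⟩ := hr c (τ + (e.cost M + 1))
      obtain ⟨τ₂, h3, h4⟩ := hr' c τ₁
      refine ⟨τ₂, ?_, Exec.loop_step _ _ _ _ _ (hgo i M (by omega) hI) h2 h4⟩
      have := hcost M hM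
      have e1 : ((d + 1) * (t + 1) + 1) * unitCost T L =
          (d * (t + 1) + 1) * unitCost T L + t * unitCost T L + unitCost T L := by ring
      omega
  exact key m 0 M (by omega) hM h0

end RAM

/-! ### Binary codes of finite sets -/

/-- The number whose binary digits are given by `X`. -/
def binCode (X : Finset ℕ) : ℕ := ∑ i ∈ X, 2 ^ i

theorem binCode_injective : Function.Injective binCode := fun X Y h => by
  rw [← Finset.toFinset_bitIndices_sum_two_pow X, ← Finset.toFinset_bitIndices_sum_two_pow Y]
  exact congrArg (fun k : ℕ => k.bitIndices.toFinset) h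

theorem binCode_range (n : ℕ) : binCode (Finset.range n) = 2 ^ n - 1 := by
  have := Nat.geomSum_eq (le_refl 2) n
  simpa [binCode] using this

theorem binCode_compl {n : ℕ} {X : Finset ℕ} (hX : X ⊆ Finset.range n) :
    binCode (Finset.range n \ X) = 2 ^ n - 1 - binCode X := by
  rw [← binCode_range, binCode, binCode, binCode, ← Finset.sum_sdiff hX]
  omega

theorem binCode_lt {n : ℕ} {X : Finset ℕ} (hX : X ⊆ Finset.range n) : binCode X < 2 ^ n := by
  have h : binCode X ≤ binCode (Finset.range n) := Finset.sum_le_sum_of_subset hX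
  rw [binCode_range] at h
  have := Nat.two_pow_pos n
  omega

theorem binCode_div_mod (X : Finset ℕ) (j : ℕ) :
    binCode X / 2 ^ j % 2 = if j ∈ X then 1 else 0 := by
  have h1 : j ∈ X ↔ (binCode X).testBit j := by
    conv_lhs => rw [← Finset.toFinset_bitIndices_sum_two_pow X]
    rw [List.mem_toFinset, Nat.mem_bitIndices, binCode]
  rw [Nat.testBit_eq_decide_div_mod_eq] at h1
  split_ifs with h
  · simpa using h1.1 h
  · have := mt h1.2 h
    simp at this
    omega

theorem binCode_erase {X : Finset ℕ} {j : ℕ} (h : j ∈ X) :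
    binCode (X.erase j) = binCode X - 2 ^ j := by
  rw [binCode, binCode, ← Finset.add_sum_erase X _ h]
  omega

theorem binCode_insert {X : Finset ℕ} {j : ℕ} (h : j ∉ X) :
    binCode (insert j X) = binCode X + 2 ^ j := by
  rw [binCode, binCode, Finset.sum_insert h, add_comm]

/-! ### A Walsh system -/

/-- The parity of the number of common binary digits of `a` and `u`. -/
def walshBit (a u : ℕ) : ℕ :=
  if a = 0 then 0 else (walshBit (a / 2) (u / 2) + (a % 2) * (u % 2)) % 2
termination_by a
decreasing_by omega

/-- The recursion holds at a = 0 as well, so a table of the bits can be filled by one uniform rule.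
-/
theorem walshBit_step (a u : ℕ) :
    walshBit a u = (walshBit (a / 2) (u / 2) + (a % 2) * (u % 2)) % 2 := by
  by_cases h : a = 0
  · subst h; simp [walshBit]
  · rw [walshBit, if_neg h]

theorem walshBit_le_one (a u : ℕ) : walshBit a u ≤ 1 := by
  rw [walshBit_step]; omega

theorem walshBit_zero_left (u : ℕ) : walshBit 0 u = 0 := by simp [walshBit]

/-- The Walsh function with values `1` and `-1`. -/
def walsh (a u : ℕ) : ℤ := 1 - 2 * walshBit a u

theorem walsh_sq (a u : ℕ) : walsh a u * walsh a u = 1 := by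
  have := walshBit_le_one a u
  unfold walsh
  interval_cases walshBit a u <;> norm_num

theorem abs_walsh (a u : ℕ) : |walsh a u| = 1 := by
  have := walshBit_le_one a u
  unfold walsh
  interval_cases walshBit a u <;> norm_num

theorem walsh_two_mul (a u : ℕ) : walsh (2 * a) u = walsh a (u / 2) := by
  have := walshBit_le_one a (u / 2)
  unfold walsh
  rw [walshBit_step]
  have h1 : 2 * a / 2 = a := by omega
  have h2 : 2 * a % 2 = 0 := by omega
  rw [h1, h2, zero_mul, add_zero, Nat.mod_eq_of_lt (by omega)]

theorem walsh_two_mul_add_one (a u : ℕ) :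
    walsh (2 * a + 1) u = walsh a (u / 2) * (1 - 2 * ((u % 2 : ℕ) : ℤ)) := by
  have := walshBit_le_one a (u / 2)
  unfold walsh
  rw [walshBit_step]
  have h1 : (2 * a + 1) / 2 = a := by omega
  have h2 : (2 * a + 1) % 2 = 1 := by omega
  rw [h1, h2, one_mul]
  rcases Nat.mod_two_eq_zero_or_one u with h | h <;> rw [h] <;>
    interval_cases walshBit a (u / 2) <;> norm_num

theorem sum_range_two_mul {R : Type*} [AddCommMonoid R] (f : ℕ → R) (m : ℕ) :
    ∑ a ∈ Finset.range (2 * m), f a = ∑ a ∈ Finset.range m, (f (2 * a) + f (2 * a + 1)) := by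
  induction m with
  | zero => simp
  | succ m ih =>
    rw [Finset.sum_range_succ, ← ih, show 2 * (m + 1) = 2 * m + 1 + 1 by ring,
      Finset.sum_range_succ, Finset.sum_range_succ, add_assoc]

/-- Grouping the indices 2a and 2a + 1 splits off the factor 1 ± 1 given by the lowest digits of u
and v. If only these digits differ, the factor is 0; otherwise the higher digits differ and
induction applies. -/
theorem sum_walsh_mul_walsh (K : ℕ) {u v : ℕ} (hu : u < 2 ^ K) (hv : v < 2 ^ K) (h : u ≠ v) :
    ∑ a ∈ Finset.range (2 ^ K), walsh a u * walsh a v = 0 := by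
  induction K generalizing u v with
  | zero => simp at hu hv; omega
  | succ K ih =>
    rw [pow_succ] at hu hv
    rw [pow_succ', sum_range_two_mul]
    have e : ∀ a, walsh (2 * a) u * walsh (2 * a) v + walsh (2 * a + 1) u * walsh (2 * a + 1) v =
        (walsh a (u / 2) * walsh a (v / 2)) *
          (1 + (1 - 2 * ((u % 2 : ℕ) : ℤ)) * (1 - 2 * ((v % 2 : ℕ) : ℤ))) := by
      intro a
      rw [walsh_two_mul, walsh_two_mul, walsh_two_mul_add_one, walsh_two_mul_add_one]
      ring
    simp only [e]
    rw [← Finset.sum_mul]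
    by_cases h2 : u / 2 = v / 2
    · have h3 : u % 2 ≠ v % 2 := by omega
      rcases Nat.mod_two_eq_zero_or_one u with h4 | h4 <;>
        rcases Nat.mod_two_eq_zero_or_one v with h5 | h5 <;> rw [h4, h5] <;> omega
    · rw [ih (by omega) (by omega) h2, zero_mul]

/-- The support of a Walsh bit function in `{0, …, n - 1}`. -/
def walshSet (n a : ℕ) : Finset ℕ := (Finset.range n).filter fun u => walshBit a u = 1

/-- For some Walsh function, the differences of its sums over the sets `f i` and `g i` are large on
average over `i`. -/
theorem exists_walsh_sum_abs (K k : ℕ) (f g : ℕ → Finset ℕ)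
    (hf : ∀ i < k, ∀ u ∈ f i, u < 2 ^ K) (hg : ∀ i < k, ∀ u ∈ g i, u < 2 ^ K)
    (hne : ∀ i < k, (f i).Nonempty) (hd : ∀ i < k, Disjoint (f i) (g i)) :
    ∃ a < 2 ^ K, (k : ℤ) ≤
      ∑ i ∈ Finset.range k, |∑ u ∈ f i, walsh a u - ∑ u ∈ g i, walsh a u| := by
  have key : ∀ i < k, (2 ^ K : ℤ) ≤
      ∑ a ∈ Finset.range (2 ^ K), |∑ u ∈ f i, walsh a u - ∑ u ∈ g i, walsh a u| := by
    intro i hi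
    obtain ⟨u, hu⟩ := hne i hi
    -- Testing against the character of one fixed u in `f i` leaves only the diagonal term. Hence
    -- the signed average is exactly 1, and the average absolute value is at least 1.
    have h1 : ∑ a ∈ Finset.range (2 ^ K),
        walsh a u * (∑ v ∈ f i, walsh a v - ∑ v ∈ g i, walsh a v) = 2 ^ K := by
      simp only [mul_sub, Finset.sum_sub_distrib, Finset.mul_sum]
      rw [Finset.sum_comm, Finset.sum_comm (t := g i), Finset.sum_eq_single_of_mem u hu,
        Finset.sum_eq_zero (s := g i)]
      · simp [walsh_sq]
      · intro v hv
        refine sum_walsh_mul_walsh K (hf i hi u hu) (hg i hi v hv) ?_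
        rintro rfl
        exact Finset.disjoint_left.1 (hd i hi) hu hv
      · intro v hv hvu
        exact sum_walsh_mul_walsh K (hf i hi u hu) (hf i hi v hv) hvu.symm
    rw [← h1]
    refine Finset.sum_le_sum fun a _ => (le_abs_self _).trans ?_
    rw [abs_mul, abs_walsh, one_mul]
  have h2 : ∑ a ∈ Finset.range (2 ^ K), (k : ℤ) ≤ ∑ a ∈ Finset.range (2 ^ K),
      ∑ i ∈ Finset.range k, |∑ u ∈ f i, walsh a u - ∑ u ∈ g i, walsh a u| := by
    rw [Finset.sum_comm]
    have := Finset.sum_le_sum fun i hi => key i (Finset.mem_range.1 hi)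
    refine le_trans (le_of_eq ?_) this
    simp [mul_comm]
  obtain ⟨a, ha, h⟩ := Finset.exists_le_of_sum_le (by simp) h2
  exact ⟨a, Finset.mem_range.1 ha, h⟩

/-! ### Splitting a partition into two unbalanced halves -/

/-- Here x and y count the elements of a block inside and outside the Walsh set. From each pair 2i,
2i + 1 the block with larger y - x is chosen. Up to the difference of the two sizes, this shifts the
x-sum down and the y-sum up by half of the absolute difference, relative to an even split. -/
theorem exists_half_of_sum_abs (s : ℕ) (x y : ℕ → ℕ) (b : ℕ) (hs : 8 ≤ s) (hb : 8 * b ≤ s)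
    (hmono : ∀ i j, i ≤ j → j < s → x i + y i ≤ x j + y j) (hxy : ∀ i < s, x i + y i ≤ b)
    (hsum : ((s / 2 : ℕ) : ℤ) ≤ ∑ i ∈ Finset.range (s / 2),
      |((y (2 * i + 1) : ℤ) - x (2 * i + 1)) - (y (2 * i) - x (2 * i))|) :
    ∃ I ⊆ Finset.range s, I.card = s / 2 ∧
      64 * ∑ i ∈ I, x i + s ≤ 32 * ∑ i ∈ Finset.range s, x i ∧
      64 * ∑ i ∈ Finset.range s \ I, y i + s ≤ 32 * ∑ i ∈ Finset.range s, y i := by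
  classical
  set k := s / 2 with hk
  let c : ℕ → ℕ := fun i => 2 * i +
    if (y (2 * i) : ℤ) - x (2 * i) ≤ y (2 * i + 1) - x (2 * i + 1) then 1 else 0
  have hc : ∀ i, c i = 2 * i ∨ c i = 2 * i + 1 := by
    intro i; simp only [c]; split_ifs <;> simp
  have hinj : Function.Injective c := by
    intro i j h
    have := hc i
    have := hc j
    omega
  have hI : (Finset.range k).image c ⊆ Finset.range s := by
    intro m hm
    obtain ⟨i, hi, rfl⟩ := Finset.mem_image.1 hm
    have := hc i
    rw [Finset.mem_range] at *
    omega
  have hsumI : ∀ w : ℕ → ℕ, ∑ i ∈ (Finset.range k).image c, w i = ∑ i ∈ Finset.range k, w (c i) :=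
    fun w => Finset.sum_image hinj.injOn
  have hsplit : ∀ w : ℕ → ℕ, ∃ r,
      ∑ i ∈ Finset.range s, w i = ∑ i ∈ Finset.range k, (w (2 * i) + w (2 * i + 1)) + r ∧
      ((s % 2 = 0 → r = 0) ∧ (s % 2 = 1 → r = w (s - 1))) := by
    intro w
    rcases Nat.mod_two_eq_zero_or_one s with h | h
    · refine ⟨0, ?_, fun _ => rfl, fun h' => by omega⟩
      conv_lhs => rw [show s = 2 * k by omega]
      rw [sum_range_two_mul, add_zero]
    · refine ⟨w (s - 1), ?_, fun h' => by omega, fun _ => rfl⟩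
      conv_lhs => rw [show s = 2 * k + 1 by omega]
      rw [Finset.sum_range_succ, sum_range_two_mul, show 2 * k = s - 1 by omega]
  -- In sorted order the gaps between consecutive pairs are nonnegative, so the gaps inside the
  -- pairs add up to at most the largest size.
  have htel : ∑ i ∈ Finset.range k,
      (((x (2 * i + 1) : ℤ) + y (2 * i + 1)) - (x (2 * i) + y (2 * i))) ≤ b := by
    have : ∀ m, m ≤ k → m = 0 ∨ ∑ i ∈ Finset.range m,
        (((x (2 * i + 1) : ℤ) + y (2 * i + 1)) - (x (2 * i) + y (2 * i))) ≤
          x (2 * m - 1) + y (2 * m - 1) := by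
      intro m
      induction m with
      | zero => simp
      | succ m ih =>
        intro hm
        right
        rw [Finset.sum_range_succ, show 2 * (m + 1) - 1 = 2 * m + 1 by omega]
        rcases ih (by omega) with h | h
        · subst h; simp; positivity
        · have h1 := hmono (2 * m - 1) (2 * m) (by omega) (by omega)
          zify at h1
          linarith
    rcases this k le_rfl with h | h
    · omega
    · have h1 := hxy (2 * k - 1) (by omega)
      zify at h1
      linarith
  -- With size gap S ≥ 0 and lean difference D inside a pair, the summand is S - |D| if the larger
  -- block is chosen and -S - |D| otherwise; both are at most S - |D|.
  have hx : ∑ i ∈ Finset.range k, (2 * (2 * (x (c i) : ℤ) - x (2 * i) - x (2 * i + 1))) ≤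
      (b : ℤ) - k := by
    refine le_trans ?_ (sub_le_sub htel hsum)
    rw [← Finset.sum_sub_distrib]
    refine Finset.sum_le_sum fun i hi => ?_
    have h1 := hmono (2 * i) (2 * i + 1) (by omega) (by rw [Finset.mem_range] at hi; omega)
    zify at h1
    simp only [c]
    split_ifs with h
    · rw [abs_of_nonneg (by linarith)]; linarith
    · rw [abs_of_nonpos (by linarith), add_zero]; linarith
  have hy : ∑ i ∈ Finset.range k, (2 * ((y (2 * i) : ℤ) + y (2 * i + 1) - 2 * y (c i))) ≤
      (b : ℤ) - k := by
    refine le_trans ?_ (sub_le_sub htel hsum)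
    rw [← Finset.sum_sub_distrib]
    refine Finset.sum_le_sum fun i hi => ?_
    have h1 := hmono (2 * i) (2 * i + 1) (by omega) (by rw [Finset.mem_range] at hi; omega)
    zify at h1
    simp only [c]
    split_ifs with h
    · rw [abs_of_nonneg (by linarith)]; linarith
    · rw [abs_of_nonpos (by linarith), add_zero]; linarith
  refine ⟨(Finset.range k).image c, hI, ?_, ?_, ?_⟩
  · rw [Finset.card_image_of_injective _ hinj, Finset.card_range]
  · obtain ⟨r, h1, -⟩ := hsplit x
    rw [hsumI, h1]
    rw [← Finset.mul_sum] at hx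
    simp only [Finset.sum_sub_distrib, ← Finset.mul_sum] at hx
    rw [Finset.sum_add_distrib]
    zify
    have : (16 : ℤ) * k ≥ 8 * s - 8 := by omega
    zify at hb hs
    have hr : (0 : ℤ) ≤ r := by positivity
    linarith
  · obtain ⟨r, h1, h2⟩ := hsplit y
    -- For odd s the last block goes to the complement and costs up to 32b ≤ 4s. Together with 16(b
    -- - k) ≤ 8 - 6s this gives 8 - 2s, which is at most -s because s ≥ 8.
    have hr : r ≤ b := by
      rcases Nat.mod_two_eq_zero_or_one s with h | h
      · rw [h2.1 h]; omega
      · rw [h2.2 h]; have := hxy (s - 1) (by omega); omega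
    have h3 := Finset.sum_sdiff hI (f := y)
    rw [hsumI] at h3
    rw [← Finset.mul_sum] at hy
    simp only [Finset.sum_sub_distrib, Finset.sum_add_distrib, ← Finset.mul_sum] at hy
    rw [Finset.sum_add_distrib] at h1
    have h4 : (16 : ℤ) * k ≥ 8 * s - 8 := by omega
    zify at hb hs h1 h3 hr ⊢
    linarith

/-! ### The number of unbalanced sets -/

/-- The exponential moment method for the difference between |R \ X| and |X ∩ R|, which is at least
s/32 on the counted sets. Expanding a product over the elements gives the moment, and cosh l ≤
exp(l²/2) bounds each factor from R. -/
theorem card_unbalanced_le (n s : ℕ) (hn : 0 < n) (R : Finset ℕ) (hR : R ⊆ Finset.range n) :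
    ((((Finset.range n).powerset.filter fun X => 64 * (X ∩ R).card + s ≤ 32 * R.card).card : ℕ) : ℝ)
      ≤ 2 ^ n * Real.exp (-((s : ℝ) ^ 2 / (2048 * n))) := by
  classical
  set A := (Finset.range n).powerset.filter fun X => 64 * (X ∩ R).card + s ≤ 32 * R.card
  have hn' : (0 : ℝ) < n := by exact_mod_cast hn
  -- The minimizer of n l²/2 - l s/32; the minimum is -s²/(2048 n).
  set l : ℝ := s / (32 * n) with hl
  have hl0 : 0 ≤ l := by positivity
  let f : ℕ → ℝ := fun u => if u ∈ R then Real.exp (-l) else 1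
  let g : ℕ → ℝ := fun u => if u ∈ R then Real.exp l else 1
  have h1 : ∏ u ∈ Finset.range n, (f u + g u) ≤ (2 * Real.exp (l ^ 2 / 2)) ^ n := by
    refine (Finset.prod_le_prod (fun u _ => ?_) (fun u _ => ?_)).trans
      (by rw [Finset.prod_const, Finset.card_range])
    · simp only [f, g]; split_ifs <;> positivity
    · simp only [f, g]
      split_ifs
      · have := Real.cosh_le_exp_half_sq l
        rw [Real.cosh_eq] at this
        linarith
      · have : 1 ≤ Real.exp (l ^ 2 / 2) := Real.one_le_exp (by positivity)
        linarith
  rw [Finset.prod_add] at h1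
  have h2 : ∀ X ∈ A, Real.exp (l * (s / 32)) ≤
      (∏ u ∈ X, f u) * ∏ u ∈ Finset.range n \ X, g u := by
    intro X hX
    obtain ⟨hX, hc⟩ := Finset.mem_filter.1 hX
    have e1 : ∏ u ∈ X, f u = Real.exp (-l * (X ∩ R).card) := by
      simp only [f]
      rw [Finset.prod_ite, Finset.prod_const_one, mul_one, Finset.prod_const,
        Finset.filter_mem_eq_inter, ← Real.exp_nat_mul]
      congr 1; ring
    have e2 : ∏ u ∈ Finset.range n \ X, g u = Real.exp (l * (R \ X).card) := by
      simp only [g]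
      rw [Finset.prod_ite, Finset.prod_const_one, mul_one, Finset.prod_const,
        Finset.filter_mem_eq_inter, ← Real.exp_nat_mul]
      have : (Finset.range n \ X) ∩ R = R \ X := by
        ext u
        have := @hR u
        simp only [Finset.mem_inter, Finset.mem_sdiff]
        tauto
      rw [this]
      congr 1; ring
    rw [e1, e2, ← Real.exp_add]
    refine Real.exp_le_exp.2 ?_
    have e3 : (R \ X).card + (X ∩ R).card = R.card := by
      rw [Finset.inter_comm]; exact Finset.card_sdiff_add_card_inter R X
    have e3' : ((R \ X).card : ℝ) + (X ∩ R).card = R.card := by exact_mod_cast e3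
    have hc' : 64 * ((X ∩ R).card : ℝ) + s ≤ 32 * R.card := by exact_mod_cast hc
    have : (s : ℝ) / 32 ≤ (R \ X).card - (X ∩ R).card := by linarith
    have := mul_le_mul_of_nonneg_left this hl0
    linarith
  have h3 : (A.card : ℝ) * Real.exp (l * (s / 32)) ≤ (2 * Real.exp (l ^ 2 / 2)) ^ n := by
    refine le_trans ?_ h1
    refine le_trans ?_ (Finset.sum_le_sum_of_subset_of_nonneg
      (show A ⊆ (Finset.range n).powerset from Finset.filter_subset _ _) ?_)
    · rw [← nsmul_eq_mul]
      exact Finset.card_nsmul_le_sum _ _ _ h2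
    · intro X _ _
      refine mul_nonneg (Finset.prod_nonneg fun u _ => ?_) (Finset.prod_nonneg fun u _ => ?_)
      · simp only [f]; split_ifs <;> positivity
      · simp only [g]; split_ifs <;> positivity
  rw [mul_pow, ← Real.exp_nat_mul] at h3
  have h4 : (A.card : ℝ) ≤ 2 ^ n * Real.exp (n * (l ^ 2 / 2)) * Real.exp (-(l * (s / 32))) := by
    rw [Real.exp_neg, ← div_eq_mul_inv, le_div_iff₀ (Real.exp_pos _)]
    exact h3
  refine h4.trans (le_of_eq ?_)
  rw [mul_assoc, ← Real.exp_add]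
  congr 2
  rw [hl]
  field_simp
  ring

/-! ### Partitions into members of a family -/

/-- Equality in the union bound leaves no room for an overlap. This is why partitions can be
recognized from total sizes alone. -/
theorem disjoint_of_sum_card {ι α : Type*} [DecidableEq ι] [DecidableEq α] {s : Finset ι}
    {t : ι → Finset α} (h : ∑ i ∈ s, (t i).card = (s.biUnion t).card) {i j : ι} (hi : i ∈ s)
    (hj : j ∈ s) (hij : i ≠ j) : Disjoint (t i) (t j) := by
  have h1 : s.biUnion t = t i ∪ (s.erase i).biUnion t := by
    conv_lhs => rw [← Finset.insert_erase hi]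
    rw [Finset.biUnion_insert]
  have h2 := Finset.card_union_add_card_inter (t i) ((s.erase i).biUnion t)
  have h3 : ((s.erase i).biUnion t).card ≤ ∑ j ∈ s.erase i, (t j).card := Finset.card_biUnion_le
  have h4 := Finset.add_sum_erase s (fun i => (t i).card) hi
  rw [← h1] at h2
  have h5 : (t i ∩ (s.erase i).biUnion t).card = 0 := by omega
  rw [Finset.card_eq_zero, ← Finset.disjoint_iff_inter_eq_empty] at h5
  exact h5.mono_right (Finset.subset_biUnion_of_mem t (Finset.mem_erase.2 ⟨hij.symm, hj⟩))

/-- `X` is the disjoint union of `k` members of `F`. -/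
def IsPartition (F : Finset (Finset ℕ)) (k : ℕ) (X : Finset ℕ) : Prop :=
  ∃ t : Fin k → Finset ℕ, (∀ i, t i ∈ F) ∧ Finset.univ.biUnion t = X ∧ ∑ i, (t i).card = X.card

theorem IsPartition.of_fintype {F : Finset (Finset ℕ)} {k : ℕ} {X : Finset ℕ} {ι : Type*}
    [Fintype ι] (t : ι → Finset ℕ) (hk : Fintype.card ι = k) (hF : ∀ i, t i ∈ F)
    (hX : Finset.univ.biUnion t = X) (hc : ∑ i, (t i).card = X.card) : IsPartition F k X := by
  have e : Fin k ≃ ι := (Fintype.equivFinOfCardEq hk).symm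
  refine ⟨fun i => t (e i), fun i => hF _, ?_, ?_⟩
  · rw [← hX]
    ext u
    simp only [Finset.mem_biUnion, Finset.mem_univ, true_and]
    exact e.exists_congr_left.trans (by simp)
  · rw [← hc]
    exact e.sum_comp fun i => (t i).card

theorem IsPartition.of_finset {F : Finset (Finset ℕ)} {ι : Type*} [DecidableEq ι] (I : Finset ι)
    (t : ι → Finset ℕ) (hF : ∀ i ∈ I, t i ∈ F)
    (hd : ∀ i ∈ I, ∀ j ∈ I, i ≠ j → Disjoint (t i) (t j)) :
    IsPartition F I.card (I.biUnion t) := by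
  refine IsPartition.of_fintype (ι := I) (fun i => t i) (by simp) (fun i => hF i i.2) ?_ ?_
  · ext u; simp
  · rw [Finset.card_biUnion hd]
    exact Finset.sum_coe_sort I fun i => (t i).card

theorem IsPartition.union {F : Finset (Finset ℕ)} {k l : ℕ} {X Y : Finset ℕ}
    (hX : IsPartition F k X) (hY : IsPartition F l Y) (h : Disjoint X Y) :
    IsPartition F (k + l) (X ∪ Y) := by
  obtain ⟨t, h1, h2, h3⟩ := hX
  obtain ⟨r, h4, h5, h6⟩ := hY
  refine IsPartition.of_fintype (ι := Fin k ⊕ Fin l) (Sum.elim t r) (by simp) ?_ ?_ ?_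
  · rintro (i | i)
    · exact h1 i
    · exact h4 i
  · rw [← h2, ← h5]
    ext u
    simp
  · rw [Fintype.sum_sum_type, Finset.card_union_of_disjoint h, ← h3, ← h6]
    rfl

/-! ### Unbalanced sets -/

/-- The subsets of `{0, …, n - 1}` that contain far less than half of the `a`-th Walsh set or far
less than half of its complement. -/
def unbalanced (n s a : ℕ) : Finset (Finset ℕ) :=
  (Finset.range n).powerset.filter fun X =>
    64 * (X ∩ walshSet n a).card + s ≤ 32 * (walshSet n a).card ∨
    64 * (X \ walshSet n a).card + s ≤ 32 * (n - (walshSet n a).card)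

theorem walshSet_subset (n a : ℕ) : walshSet n a ⊆ Finset.range n := Finset.filter_subset _ _

theorem mem_unbalanced {n s a : ℕ} {X : Finset ℕ} : X ∈ unbalanced n s a ↔ X ⊆ Finset.range n ∧
    (64 * (X ∩ walshSet n a).card + s ≤ 32 * (walshSet n a).card ∨
    64 * (X \ walshSet n a).card + s ≤ 32 * (n - (walshSet n a).card)) := by
  rw [unbalanced, Finset.mem_filter, Finset.mem_powerset]

/-- Both alternatives are upper bounds on cardinalities that shrink with the set. This closure is
what confines the enumeration and the transforms to the family. -/
theorem unbalanced_mono {n s a : ℕ} {X Y : Finset ℕ} (hX : X ∈ unbalanced n s a) (h : Y ⊆ X) :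
    Y ∈ unbalanced n s a := by
  rw [mem_unbalanced] at *
  have h1 := Finset.card_le_card (Finset.inter_subset_inter_right (u := walshSet n a) h)
  have h2 := Finset.card_le_card (Finset.sdiff_subset_sdiff h (subset_refl (walshSet n a)))
  exact ⟨h.trans hX.1, hX.2.imp (by omega) (by omega)⟩

/-- The Walsh set or its complement has at least n/2 ≥ s/2 elements, far more than the s/32
required. -/
theorem empty_mem_unbalanced {n s a : ℕ} (h : s ≤ n) : ∅ ∈ unbalanced n s a := by
  rw [mem_unbalanced]
  refine ⟨Finset.empty_subset _, ?_⟩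
  simp only [Finset.empty_inter, Finset.empty_sdiff, Finset.card_empty]
  omega

theorem card_unbalanced (n s a : ℕ) (hn : 0 < n) :
    ((unbalanced n s a).card : ℝ) ≤ 2 * (2 ^ n * Real.exp (-((s : ℝ) ^ 2 / (2048 * n)))) := by
  classical
  have h1 := card_unbalanced_le n s hn _ (walshSet_subset n a)
  have h2 := card_unbalanced_le n s hn (Finset.range n \ walshSet n a) Finset.sdiff_subset
  have h3 : unbalanced n s a ⊆ ((Finset.range n).powerset.filter fun X =>
      64 * (X ∩ walshSet n a).card + s ≤ 32 * (walshSet n a).card) ∪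
      ((Finset.range n).powerset.filter fun X => 64 * (X ∩ (Finset.range n \ walshSet n a)).card + s
        ≤ 32 * (Finset.range n \ walshSet n a).card) := by
    intro X hX
    rw [mem_unbalanced] at hX
    have e : X ∩ (Finset.range n \ walshSet n a) = X \ walshSet n a := by
      rw [← Finset.inter_sdiff_assoc, Finset.inter_eq_left.2 hX.1]
    rw [Finset.mem_union, Finset.mem_filter, Finset.mem_filter, Finset.mem_powerset, e,
      Finset.card_sdiff_of_subset (walshSet_subset n a), Finset.card_range]
    exact hX.2.imp (fun h => ⟨hX.1, h⟩) fun h => ⟨hX.1, h⟩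
  have h4 := (Finset.card_le_card h3).trans (Finset.card_union_le _ _)
  have h5 : ((unbalanced n s a).card : ℝ) ≤ _ := Nat.cast_le.2 h4
  rw [Nat.cast_add] at h5
  linarith

/-! ### Cutting a set partition along a Walsh function. -/

theorem sum_walsh_eq (n a : ℕ) {X : Finset ℕ} (hX : X ⊆ Finset.range n) :
    ∑ u ∈ X, walsh a u = ((X \ walshSet n a).card : ℤ) - (X ∩ walshSet n a).card := by
  rw [← Finset.sum_inter_add_sum_sdiff X (walshSet n a)]
  have h1 : ∀ u ∈ X ∩ walshSet n a, walsh a u = -1 := by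
    intro u hu
    have := (Finset.mem_filter.1 (Finset.mem_inter.1 hu).2).2
    simp [walsh, this]
  have h2 : ∀ u ∈ X \ walshSet n a, walsh a u = 1 := by
    intro u hu
    obtain ⟨h3, h4⟩ := Finset.mem_sdiff.1 hu
    have h5 := walshBit_le_one a u
    have h6 : walshBit a u ≠ 1 := fun h => h4 (Finset.mem_filter.2 ⟨hX h3, h⟩)
    have : walshBit a u = 0 := by omega
    simp [walsh, this]
  rw [Finset.sum_congr rfl h1, Finset.sum_congr rfl h2]
  simp
  ring

/-- Neighbours in the order of sizes form the pairs fed to `exists_walsh_sum_abs`. The two halves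
are unbalanced for opposite reasons, one inside and one outside the Walsh set, which is why
`unbalanced` admits both alternatives. -/
theorem exists_unbalanced_halves {F : Finset (Finset ℕ)} {n s : ℕ} (hn : 0 < n)
    (hF : ∀ f ∈ F, f ⊆ Finset.range n ∧ 0 < f.card ∧ 8 * f.card ≤ s)
    (h : IsPartition F s (Finset.range n)) :
    ∃ a < 2 ^ Nat.clog 2 n, ∃ W ∈ unbalanced n s a, Finset.range n \ W ∈ unbalanced n s a ∧
      IsPartition F (s / 2) W ∧ IsPartition F (s - s / 2) (Finset.range n \ W) := by
  obtain ⟨t, h1, h2, h3⟩ := h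
  have hs : 0 < s := by
    rcases Nat.eq_zero_or_pos s with rfl | h
    · have := congrArg Finset.card h2
      simp at this
      omega
    · exact h
  -- A nonempty block of size at most s/8 exists.
  have hs8 : 8 ≤ s := by have := hF _ (h1 ⟨0, hs⟩); omega
  let w : ℕ → Finset ℕ := fun i =>
    if h : i < s then t (Tuple.sort (fun i => (t i).card) ⟨i, h⟩) else ∅
  have hw : ∀ i (h : i < s), w i = t (Tuple.sort (fun i => (t i).card) ⟨i, h⟩) :=
    fun i h => dif_pos h
  have hwF : ∀ i < s, w i ∈ F := fun i h => by rw [hw i h]; exact h1 _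
  have hmono : ∀ i j, i ≤ j → j < s → (w i).card ≤ (w j).card := by
    intro i j hij hj
    rw [hw i (hij.trans_lt hj), hw j hj]
    exact Tuple.monotone_sort (fun i => (t i).card) (a := ⟨i, hij.trans_lt hj⟩) (b := ⟨j, hj⟩) hij
  have hdisj : ∀ i < s, ∀ j < s, i ≠ j → Disjoint (w i) (w j) := by
    intro i hi j hj hij
    rw [hw i hi, hw j hj]
    refine disjoint_of_sum_card (s := Finset.univ) (h3.trans (congrArg _ h2.symm))
      (Finset.mem_univ _) (Finset.mem_univ _) ?_
    intro h
    have := (Tuple.sort (fun i => (t i).card)).injective h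
    simp at this
    exact hij this
  have hunion : (Finset.range s).biUnion w = Finset.range n := by
    rw [← h2]
    ext u
    simp only [Finset.mem_biUnion, Finset.mem_range, Finset.mem_univ, true_and]
    constructor
    · rintro ⟨i, hi, hu⟩
      rw [hw i hi] at hu
      exact ⟨_, hu⟩
    · rintro ⟨i, hu⟩
      refine ⟨((Tuple.sort fun i => (t i).card).symm i : ℕ), Fin.is_lt _, ?_⟩
      rw [hw _ (Fin.is_lt _)]
      simpa using hu
  have hsub : ∀ i < s, w i ⊆ Finset.range n := fun i hi => (hF _ (hwF i hi)).1
  have hpow : n ≤ 2 ^ Nat.clog 2 n := Nat.le_pow_clog one_lt_two n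
  have hlt : ∀ i < s, ∀ u ∈ w i, u < 2 ^ Nat.clog 2 n := fun i hi u hu =>
    (Finset.mem_range.1 (hsub i hi hu)).trans_le hpow
  obtain ⟨a, ha, hsum⟩ := exists_walsh_sum_abs (Nat.clog 2 n) (s / 2) (fun i => w (2 * i + 1))
    (fun i => w (2 * i)) (fun i hi => hlt _ (by omega)) (fun i hi => hlt _ (by omega))
    (fun i hi => Finset.card_pos.1 (hF _ (hwF _ (by omega))).2.1)
    (fun i hi => hdisj _ (by omega) _ (by omega) (by omega))
  have hxy : ∀ i, (w i ∩ walshSet n a).card + (w i \ walshSet n a).card = (w i).card :=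
    fun i => by rw [add_comm]; exact Finset.card_sdiff_add_card_inter _ _
  obtain ⟨I, hI, hIc, hI1, hI2⟩ := exists_half_of_sum_abs s (fun i => (w i ∩ walshSet n a).card)
    (fun i => (w i \ walshSet n a).card) (s / 8) hs8 (by omega)
    (fun i j hij hj => by simp only [hxy]; exact hmono i j hij hj)
    (fun i hi => by simp only [hxy]; have := (hF _ (hwF i hi)).2.2; omega)
    (by
      refine hsum.trans (le_of_eq (Finset.sum_congr rfl fun i hi => ?_))
      rw [Finset.mem_range] at hi
      rw [sum_walsh_eq n a (hsub _ (by omega)), sum_walsh_eq n a (hsub _ (by omega))])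
  have hIs : ∀ i ∈ I, i < s := fun i hi => Finset.mem_range.1 (hI hi)
  have hJs : ∀ i ∈ Finset.range s \ I, i < s :=
    fun i hi => Finset.mem_range.1 (Finset.mem_sdiff.1 hi).1
  have hcompl : Finset.range n \ I.biUnion w = (Finset.range s \ I).biUnion w := by
    rw [← hunion]
    ext u
    simp only [Finset.mem_sdiff, Finset.mem_biUnion, Finset.mem_range, not_exists, not_and]
    constructor
    · rintro ⟨⟨i, hi, hu⟩, h⟩
      exact ⟨i, ⟨hi, fun h' => h i h' hu⟩, hu⟩
    · rintro ⟨i, ⟨hi, hiI⟩, hu⟩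
      refine ⟨⟨i, hi, hu⟩, fun j hj hu' => ?_⟩
      refine Finset.disjoint_left.1 (hdisj i hi j (hIs j hj) ?_) hu hu'
      rintro rfl
      exact hiI hj
  have hcard : ∀ J : Finset ℕ, (∀ i ∈ J, i < s) → ∀ g : Finset ℕ → Finset ℕ, (∀ X, g X ⊆ X) →
      (∀ J : Finset ℕ, g (J.biUnion w) = J.biUnion fun i => g (w i)) →
      (g (J.biUnion w)).card = ∑ i ∈ J, (g (w i)).card := by
    intro J hJ g hg hg'
    rw [hg', Finset.card_biUnion]
    intro i hi j hj hij
    exact (hdisj i (hJ i hi) j (hJ j hj) hij).mono (hg _) (hg _)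
  have hcx := fun J hJ => hcard J hJ (fun X => X ∩ walshSet n a)
    (fun X => Finset.inter_subset_left) (fun J => Finset.biUnion_inter _ _ _)
  have hcy := fun J hJ => hcard J hJ (fun X => X \ walshSet n a)
    (fun X => Finset.sdiff_subset) (fun J => by ext u; simp; tauto)
  have hR := hcx (Finset.range s) fun i hi => Finset.mem_range.1 hi
  have hR' := hcy (Finset.range s) fun i hi => Finset.mem_range.1 hi
  simp only [hunion] at hR hR'
  rw [Finset.inter_eq_right.2 (walshSet_subset n a)] at hR
  rw [Finset.card_sdiff_of_subset (walshSet_subset n a), Finset.card_range] at hR'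
  refine ⟨a, ha, I.biUnion w, ?_, ?_, ?_, ?_⟩
  · rw [mem_unbalanced]
    refine ⟨Finset.biUnion_subset.2 fun i hi => hsub i (hIs i hi), Or.inl ?_⟩
    have := hcx I hIs
    rw [this, hR]
    exact hI1
  · rw [mem_unbalanced]
    refine ⟨Finset.sdiff_subset, Or.inr ?_⟩
    have := hcy (Finset.range s \ I) hJs
    rw [hcompl, this, hR']
    exact hI2
  · rw [← hIc]
    exact IsPartition.of_finset I w (fun i hi => hwF i (hIs i hi))
      fun i hi j hj => hdisj i (hIs i hi) j (hIs j hj)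
  · rw [hcompl]
    have : s - s / 2 = (Finset.range s \ I).card := by
      rw [Finset.card_sdiff_of_subset hI, Finset.card_range, hIc]
    rw [this]
    exact IsPartition.of_finset _ w (fun i hi => hwF i (hJs i hi))
      fun i hi j hj => hdisj i (hJs i hi) j (hJs j hj)

/-! ### Zeta transforms -/

/-- The zeta transform with respect to the elements below `j`. -/
def partialZeta (j : ℕ) (φ : Finset ℕ → ℕ) (X : Finset ℕ) : ℕ :=
  ∑ Y ∈ X.powerset with X \ Y ⊆ Finset.range j, φ Y

theorem partialZeta_zero (φ : Finset ℕ → ℕ) (X : Finset ℕ) : partialZeta 0 φ X = φ X := by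
  rw [partialZeta, Finset.sum_eq_single_of_mem X]
  · simp
  · intro Y hY hne
    simp only [Finset.range_zero, Finset.subset_empty, Finset.mem_filter, Finset.mem_powerset,
      Finset.sdiff_eq_empty_iff_subset] at hY
    exact absurd (hY.1.antisymm hY.2) hne

theorem partialZeta_of_subset {n : ℕ} (φ : Finset ℕ → ℕ) {X : Finset ℕ}
    (hX : X ⊆ Finset.range n) : partialZeta n φ X = ∑ Y ∈ X.powerset, φ Y := by
  rw [partialZeta, Finset.filter_true_of_mem]
  exact fun Y _ => Finset.sdiff_subset.trans hX

/-- Split by whether j ∈ Y: a summand that omits j is a subset of `X.erase j` and misses, apart from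
j, only elements below j. One step reads only X and a subset of X, so it makes sense within any
downward closed family. -/
theorem partialZeta_succ (j : ℕ) (φ : Finset ℕ → ℕ) (X : Finset ℕ) :
    partialZeta (j + 1) φ X =
      partialZeta j φ X + if j ∈ X then partialZeta j φ (X.erase j) else 0 := by
  have hr : ∀ Z : Finset ℕ, j ∉ Z → (Z ⊆ Finset.range (j + 1) ↔ Z ⊆ Finset.range j) := by
    intro Z hZ
    rw [Finset.range_add_one, Finset.subset_insert_iff_of_notMem hZ]
  split_ifs with hj
  · rw [partialZeta, ← Finset.sum_filter_add_sum_filter_not _ (fun Y => j ∈ Y), partialZeta,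
      partialZeta]
    congr 1
    · refine Finset.sum_congr ?_ fun _ _ => rfl
      ext Y
      simp only [Finset.mem_filter, Finset.mem_powerset]
      constructor
      · rintro ⟨⟨h1, h2⟩, h3⟩
        exact ⟨h1, (hr _ (by simp [h3])).1 h2⟩
      · rintro ⟨h1, h2⟩
        have h3 : j ∈ Y := by
          by_contra h
          simpa using h2 (Finset.mem_sdiff.2 ⟨hj, h⟩)
        exact ⟨⟨h1, (hr _ (by simp [h3])).2 h2⟩, h3⟩
    · refine Finset.sum_congr ?_ fun _ _ => rfl
      ext Y
      simp only [Finset.mem_filter, Finset.mem_powerset]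
      have e : X.erase j \ Y = (X \ Y).erase j := Finset.erase_sdiff_comm X Y j
      rw [e, Finset.range_add_one, Finset.subset_insert_iff, Finset.subset_erase]
      tauto
  · rw [add_zero, partialZeta, partialZeta]
    refine Finset.sum_congr ?_ fun _ _ => rfl
    ext Y
    simp only [Finset.mem_filter, hr (X \ Y) fun h => hj (Finset.mem_sdiff.1 h).1]

theorem partialZeta_le {n j : ℕ} (φ : Finset ℕ → ℕ) {X : Finset ℕ} (hX : X ⊆ Finset.range n) :
    partialZeta j φ X ≤ partialZeta n φ X := by
  rw [partialZeta_of_subset φ hX, partialZeta]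
  exact Finset.sum_le_sum_of_subset (Finset.filter_subset _ _)

/-- The weight `B ^ |X|` on the members `X` of `F`. -/
def familyWeight (F : Finset (Finset ℕ)) (B : ℕ) (X : Finset ℕ) : ℕ :=
  if X ∈ F then B ^ X.card else 0

/-- The total weight of the `k`-tuples of members of `F` that have union `X`. -/
def coverWeight (F : Finset (Finset ℕ)) (B k : ℕ) (X : Finset ℕ) : ℕ :=
  ∑ t ∈ Fintype.piFinset (fun _ : Fin k => F) with Finset.univ.biUnion t = X,
    ∏ i, B ^ (t i).card

/-! ### Weighted counting of covers and partitions. -/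

theorem partialZeta_familyWeight {n : ℕ} (F : Finset (Finset ℕ)) (B : ℕ) {X : Finset ℕ}
    (hX : X ⊆ Finset.range n) :
    partialZeta n (familyWeight F B) X = ∑ f ∈ F with f ⊆ X, B ^ f.card := by
  rw [partialZeta_of_subset _ hX]
  simp only [familyWeight]
  rw [← Finset.sum_filter]
  refine Finset.sum_congr ?_ fun _ _ => rfl
  ext Y
  simp only [Finset.mem_filter, Finset.mem_powerset]
  tauto

/-- The union of a tuple lies in X iff all its members do, so the sum over tuples factors into a
power. -/
theorem partialZeta_coverWeight {n : ℕ} (F : Finset (Finset ℕ)) (B k : ℕ) {X : Finset ℕ}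
    (hX : X ⊆ Finset.range n) :
    partialZeta n (coverWeight F B k) X = partialZeta n (familyWeight F B) X ^ k := by
  rw [partialZeta_familyWeight F B hX, partialZeta_of_subset _ hX]
  have h : (∑ f ∈ F with f ⊆ X, B ^ f.card) ^ k =
      ∏ _i : Fin k, ∑ f ∈ F with f ⊆ X, B ^ f.card := by simp
  rw [h, Finset.prod_univ_sum]
  simp only [coverWeight]
  rw [← Finset.sum_fiberwise_of_maps_to (t := X.powerset) (g := fun t => Finset.univ.biUnion t)]
  · refine Finset.sum_congr rfl fun Y hY => Finset.sum_congr ?_ fun _ _ => rfl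
    ext t
    simp only [Finset.mem_filter, Fintype.mem_piFinset]
    constructor
    · rintro ⟨h1, rfl⟩
      exact ⟨fun i => ⟨h1 i, (Finset.subset_biUnion_of_mem t (Finset.mem_univ i)).trans
        (Finset.mem_powerset.1 hY)⟩, rfl⟩
    · rintro ⟨h1, h2⟩
      exact ⟨fun i => (h1 i).1, h2⟩
  · intro t ht
    rw [Finset.mem_powerset, Finset.biUnion_subset]
    intro i _
    exact (Finset.mem_filter.1 (Fintype.mem_piFinset.1 ht i)).2

theorem partialZeta_familyWeight_le {n j : ℕ} {F : Finset (Finset ℕ)} {B : ℕ} (hB : 1 ≤ B)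
    (hF : F ⊆ (Finset.range n).powerset) {X : Finset ℕ} (hX : X ⊆ Finset.range n) :
    partialZeta j (familyWeight F B) X ≤ 2 ^ n * B ^ n := by
  refine (partialZeta_le _ hX).trans ?_
  rw [partialZeta_familyWeight F B hX]
  refine (Finset.sum_le_card_nsmul _ _ (B ^ n) fun f hf => ?_).trans ?_
  · have := Finset.card_le_card (Finset.mem_powerset.1 (hF (Finset.mem_filter.1 hf).1))
    rw [Finset.card_range] at this
    exact Nat.pow_le_pow_right hB this
  · rw [smul_eq_mul]
    refine Nat.mul_le_mul_right _ ?_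
    have := Finset.card_le_card ((Finset.filter_subset (fun f => f ⊆ X) F).trans hF)
    simpa using this

theorem partialZeta_coverWeight_le {n j : ℕ} {F : Finset (Finset ℕ)} {B k : ℕ} (hB : 1 ≤ B)
    (hF : F ⊆ (Finset.range n).powerset) (hk : k ≤ n) {X : Finset ℕ} (hX : X ⊆ Finset.range n) :
    partialZeta j (coverWeight F B k) X ≤ (2 ^ n * B ^ n) ^ n := by
  refine (partialZeta_le _ hX).trans ?_
  rw [partialZeta_coverWeight F B k hX]
  refine (Nat.pow_le_pow_left (partialZeta_familyWeight_le hB hF hX) k).trans ?_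
  exact Nat.pow_le_pow_right (by positivity) hk

/-- The total size of a tuple with union X exceeds |X| by the amount of overlap. After division by
B^|X| every overlapping tuple contributes a multiple of B, while partitions contribute 1 each. There
are at most |F|^k < B of them, so the remainder is their exact number. -/
theorem coverWeight_div_mod {F : Finset (Finset ℕ)} {B k : ℕ} (hB : F.card ^ k < B)
    (X : Finset ℕ) :
    coverWeight F B k X / B ^ X.card % B ≠ 0 ↔ IsPartition F k X := by
  set P := (Fintype.piFinset (fun _ : Fin k => F)).filter fun t => Finset.univ.biUnion t = X
  have hB0 : 0 < B := by omega
  have hge : ∀ t ∈ P, X.card ≤ ∑ i, (t i).card := by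
    intro t ht
    rw [← (Finset.mem_filter.1 ht).2]
    exact Finset.card_biUnion_le
  have h1 : coverWeight F B k X = B ^ X.card * ∑ t ∈ P, B ^ ((∑ i, (t i).card) - X.card) := by
    rw [coverWeight, Finset.mul_sum]
    refine Finset.sum_congr rfl fun t ht => ?_
    rw [Finset.prod_pow_eq_pow_sum, ← pow_add, Nat.add_sub_cancel' (hge t ht)]
  rw [h1, Nat.mul_div_cancel_left _ (by positivity)]
  have h2 : (∑ t ∈ P, B ^ ((∑ i, (t i).card) - X.card)) % B =
      (P.filter fun t => ∑ i, (t i).card = X.card).card := by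
    rw [← Finset.sum_filter_add_sum_filter_not P (fun t => ∑ i, (t i).card = X.card)]
    have e1 : ∑ t ∈ P with ∑ i, (t i).card = X.card, B ^ ((∑ i, (t i).card) - X.card) =
        (P.filter fun t => ∑ i, (t i).card = X.card).card := by
      refine (Finset.sum_congr rfl fun t ht => ?_).trans (Finset.card_eq_sum_ones _).symm
      rw [(Finset.mem_filter.1 ht).2, Nat.sub_self, pow_zero]
    have e2 : B ∣ ∑ t ∈ P with ¬ ∑ i, (t i).card = X.card, B ^ ((∑ i, (t i).card) - X.card) := by
      refine Finset.dvd_sum fun t ht => ?_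
      obtain ⟨h3, h4⟩ := Finset.mem_filter.1 ht
      have := hge t h3
      exact dvd_pow_self B (by omega)
    obtain ⟨q, hq⟩ := e2
    rw [e1, hq, Nat.add_mul_mod_self_left, Nat.mod_eq_of_lt]
    refine lt_of_le_of_lt ?_ hB
    refine (Finset.card_le_card ((Finset.filter_subset _ _).trans
      (show P ⊆ _ from Finset.filter_subset _ _))).trans ?_
    simp
  rw [h2, Finset.card_ne_zero]
  constructor
  · rintro ⟨t, ht⟩
    obtain ⟨h3, h4⟩ := Finset.mem_filter.1 ht
    obtain ⟨h5, h6⟩ := Finset.mem_filter.1 h3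
    exact ⟨t, Fintype.mem_piFinset.1 h5, h6, h4⟩
  · rintro ⟨t, h3, h4, h5⟩
    exact ⟨t, Finset.mem_filter.2 ⟨Finset.mem_filter.2 ⟨Fintype.mem_piFinset.2 h3, h4⟩, h5⟩⟩

namespace RAM

/-! ### Arrays and bounded loops

Cell `32 * i + c` serves as the `i`-th entry of the `c`-th array; the cell `c` itself may also serve
as a variable. -/

/-- The address of an array entry. -/
def arr (c : ℕ) (e : Expr) : Expr := .plus (.times (.const 32) e) (.const c)

/-- The content of an array entry. -/
def get (c : ℕ) (e : Expr) : Expr := .read (arr c e)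

/-- The content of a variable. -/
def var (c : ℕ) : Expr := .read (.const c)

/-- The remainder of a division. -/
def rem (e₁ e₂ : Expr) : Expr := .monus e₁ (.times e₂ (.quot e₁ e₂))

/-- `1` if the argument is not `0`, and `0` otherwise. -/
def sign (e : Expr) : Expr := .monus (.const 1) (.monus (.const 1) e)

@[simp] theorem arr_val (c : ℕ) (e : Expr) (M : Memory) : (arr c e).val M = 32 * e.val M + c := rfl

@[simp] theorem get_val (c : ℕ) (e : Expr) (M : Memory) :
    (get c e).val M = M (32 * e.val M + c) := rfl

@[simp] theorem var_val (c : ℕ) (M : Memory) : (var c).val M = M c := rfl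

@[simp] theorem rem_val (e₁ e₂ : Expr) (M : Memory) :
    (rem e₁ e₂).val M = e₁.val M % e₂.val M := by
  have := Nat.div_add_mod (e₁.val M) (e₂.val M)
  simp only [rem, Expr.val]
  omega

@[simp] theorem sign_val (e : Expr) (M : Memory) :
    (sign e).val M = if e.val M = 0 then 0 else 1 := by
  simp only [sign, Expr.val]
  split_ifs <;> omega

/-- The body is repeated with `0, 1, …` in the variable `c`, below the bound `lim`. -/
def forTo (c : ℕ) (lim : Expr) (body : Program) : Program :=
  .seq (.store (.const c) (.const 0)) (.loop (.monus lim (var c))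
    (.seq body (.store (.const c) (.plus (var c) (.const 1)))))

/-- `M'` differs from `M` only in cells with residues in `S`. -/
def Same (S : Finset ℕ) (M M' : Memory) : Prop := ∀ a, a % 32 ∉ S → M' a = M a

theorem Same.refl (S : Finset ℕ) (M : Memory) : Same S M M := fun _ _ => rfl

theorem Same.trans {S : Finset ℕ} {M M' M'' : Memory} (h : Same S M M') (h' : Same S M' M'') :
    Same S M M'' := fun a ha => (h' a ha).trans (h a ha)

theorem Same.mono {S S' : Finset ℕ} {M M' : Memory} (h : Same S M M') (hS : S ⊆ S') :
    Same S' M M' := fun a ha => h a fun h' => ha (hS h')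

theorem Same.update {S : Finset ℕ} {M M' : Memory} (h : Same S M M') {a : ℕ} (ha : a % 32 ∈ S)
    (v : ℕ) : Same S M (Function.update M' a v) := fun b hb => by
  rw [Function.update_of_ne (by rintro rfl; exact hb ha)]
  exact h b hb

theorem Same.arr {S : Finset ℕ} {M M' : Memory} (h : Same S M M') (i : ℕ) {c : ℕ} (hc : c < 32)
    (hS : c ∉ S) : M' (32 * i + c) = M (32 * i + c) :=
  h _ (by rwa [Nat.mul_add_mod, Nat.mod_eq_of_lt hc])

theorem Same.var {S : Finset ℕ} {M M' : Memory} (h : Same S M M') {c : ℕ} (hc : c < 32)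
    (hS : c ∉ S) : M' c = M c := h _ (by rwa [Nat.mod_eq_of_lt hc])

variable {O : ℕ → Bool} {T : ℕ} {ω : ℕ → Bool} {L : ℕ}

theorem Reach.forTo (hL : 1 ≤ L) {c : ℕ} (hc : c < 32) {lim : Expr} (hsz : lim.sz ≤ 2000)
    {body : Program} (I : ℕ → Memory → Prop) (m t : ℕ) (hm : m < 2 ^ L)
    (hlim : ∀ i M, i ≤ m → I i M → M c = i → lim.val M = m)
    (hstep : ∀ i M, i < m → Bounded L M → I i M → M c = i →
      Reach O T ω L body M t fun M' => M' c = i ∧ I (i + 1) (Function.update M' c (i + 1)))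
    {M : Memory} (hM : Bounded L M) (h0 : I 0 (Function.update M c 0)) :
    Reach O T ω L (forTo c lim body) M (m * (t + 2) + 2) fun M' => I m M' ∧ M' c = m := by
  have e : m * (t + 2) + 2 = 1 + (m * ((t + 1) + 1) + 1) := by ring
  rw [e]
  refine Reach.seq (P := fun M' => M' = Function.update M c 0)
    (Reach.store hL hM (by simp only [Expr.sz]; omega) rfl rfl (by simp [Expr.val]) rfl) ?_
  rintro M' hM' rfl
  refine Reach.loop hL (by simp only [Expr.sz, RAM.var]; omega) (fun i M => I i M ∧ M c = i)
    m (t + 1) ?_ ?_ ?_ hM' ⟨h0, by simp⟩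
  · rintro i M hi ⟨h1, h2⟩
    simp only [Expr.val, hlim i M hi.le h1 h2, var_val, h2]
    omega
  · rintro M ⟨h1, h2⟩
    simp only [Expr.val, hlim m M le_rfl h1 h2, var_val, h2]
    omega
  · rintro i M hi hM ⟨h1, h2⟩
    refine Reach.seq (hstep i M hi hM h1 h2) ?_
    rintro M' hM' ⟨h3, h4⟩
    refine Reach.store (v := i + 1) hL hM' (by simp only [Expr.sz, RAM.var]; omega) rfl
      (by simp [Expr.val, h3]) (by omega) ⟨h4, by simp [Expr.val]⟩

/-! ### Loops over a list of sets -/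

/-- The list of sets `X 0, …, X (m - 1)`, a repetition-free enumeration of `D`, stands in the
array `20`, and its length in the variable `9`. -/
structure Listing (D : Finset (Finset ℕ)) (m : ℕ) (X : ℕ → Finset ℕ) (M : Memory) : Prop where
  inj : ∀ p < m, ∀ q < m, X p = X q → p = q
  mem : ∀ Y, Y ∈ D ↔ ∃ p < m, X p = Y
  len : M 9 = m
  code : ∀ p < m, M (32 * p + 20) = binCode (X p)

theorem Listing.of_same {D : Finset (Finset ℕ)} {m : ℕ} {X : ℕ → Finset ℕ} {M M' : Memory}
    (h : Listing D m X M) {S : Finset ℕ} (hs : Same S M M') (h9 : 9 ∉ S) (h20 : 20 ∉ S) :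
    Listing D m X M' where
  inj := h.inj
  mem := h.mem
  len := by rw [hs.var (by norm_num) h9, h.len]
  code p hp := by rw [hs.arr p (by norm_num) h20, h.code p hp]

theorem Listing.card_eq {D : Finset (Finset ℕ)} {m : ℕ} {X : ℕ → Finset ℕ} {M : Memory}
    (h : Listing D m X M) : D.card = m := by
  have : D = (Finset.range m).image X := by
    ext Y
    simp [h.mem Y]
  rw [this, Finset.card_image_of_injOn, Finset.card_range]
  intro p hp q hq hpq
  simp only [Finset.coe_range, Set.mem_Iio] at hp hq
  exact h.inj p hp q hq hpq

/-- The current set of a loop over the list. -/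
def curSet : Expr := get 20 (var 8)

/-- The body is executed for every member of the list. -/
def forList (body : Program) : Program := forTo 8 (var 9) body

/-- The array is updated in place and in list order. When a set is processed, its own entry is still
old because the list has no repetitions, and an entry whose new and old values agree can be read at
any moment. Entries off the list survive, which later preserves results of earlier rounds. -/
theorem Reach.forList (hL : 1 ≤ L) {D : Finset (Finset ℕ)} {m : ℕ} {X : ℕ → Finset ℕ} {c : ℕ}
    (hc : c < 32) (h8 : c ≠ 8) (h9 : c ≠ 9) (h20 : c ≠ 20) {M₀ : Memory} (hM₀ : Bounded L M₀)
    (hlist : Listing D m X M₀) (new : Finset ℕ → ℕ) {body : Program} (t : ℕ)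
    (hbody : ∀ p < m, ∀ M, Bounded L M → Same {8, c} M₀ M → M 8 = p →
      M (32 * binCode (X p) + c) = M₀ (32 * binCode (X p) + c) →
      (∀ Y ∈ D, new Y = M₀ (32 * binCode Y + c) →
        M (32 * binCode Y + c) = M₀ (32 * binCode Y + c)) →
      Reach O T ω L body M t fun M' =>
        M' = Function.update M (32 * binCode (X p) + c) (new (X p))) :
    Reach O T ω L (forList body) M₀ (m * (t + 2) + 2) fun M' => Same {8, c} M₀ M' ∧
      (∀ Y ∈ D, M' (32 * binCode Y + c) = new Y) ∧
      ∀ y, (∀ Y ∈ D, y ≠ binCode Y) → M' (32 * y + c) = M₀ (32 * y + c) := by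
  have hne : ∀ y, 32 * y + c ≠ 8 := by intro y; omega
  have hm : m < 2 ^ L := by rw [← hlist.len]; exact hM₀ 9
  refine (Reach.forTo (t := t) hL (by norm_num) (by simp [Expr.sz, var])
    (fun i M => Same {8, c} M₀ M ∧
    (∀ q < m, M (32 * binCode (X q) + c) =
      if q < i then new (X q) else M₀ (32 * binCode (X q) + c)) ∧
    ∀ y, (∀ Y ∈ D, y ≠ binCode Y) → M (32 * y + c) = M₀ (32 * y + c)) m hm ?_ ?_ hM₀ ?_).mono
    le_rfl ?_
  · rintro i M hi ⟨h1, -, -⟩ -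
    rw [var_val, h1.var (by norm_num) (by simp; omega), hlist.len]
  · rintro i M hi hM ⟨h1, h2, h3⟩ h4
    refine (hbody i hi M hM h1 h4 (by rw [h2 i hi, if_neg (lt_irrefl i)]) ?_).mono le_rfl ?_
    · intro Y hY hnew
      obtain ⟨q, hq, rfl⟩ := (hlist.mem Y).1 hY
      rw [h2 q hq]
      split_ifs
      · exact hnew
      · rfl
    · rintro M' hM' rfl
      refine ⟨?_, ?_, ?_, ?_⟩
      · rw [Function.update_of_ne (hne _).symm, h4]
      · refine (h1.update ?_ _).update (by simp) _
        rw [Nat.mul_add_mod, Nat.mod_eq_of_lt hc]; simp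
      · intro q hq
        rw [Function.update_of_ne (hne _), Function.update_apply]
        by_cases hqi : q = i
        · subst hqi; simp
        · have : 32 * binCode (X q) + c ≠ 32 * binCode (X i) + c := by
            intro h
            exact hqi (hlist.inj q hq i hi (binCode_injective (by omega)))
          rw [if_neg this, h2 q hq]
          have : q < i ↔ q < i + 1 := by omega
          simp only [this]
      · intro y hy
        have := hy (X i) ((hlist.mem _).2 ⟨i, hi, rfl⟩)
        rw [Function.update_of_ne (hne _), Function.update_of_ne (by omega), h3 y hy]
  · refine ⟨(Same.refl _ _).update (by simp) _, ?_, ?_⟩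
    · intro q _
      rw [Function.update_of_ne (hne _)]; simp
    · intro y _
      rw [Function.update_of_ne (hne _)]
  · rintro M' - ⟨⟨h1, h2, h3⟩, -⟩
    refine ⟨h1, ?_, h3⟩
    intro Y hY
    obtain ⟨q, hq, rfl⟩ := (hlist.mem Y).1 hY
    rw [h2 q hq, if_pos hq]

theorem curSet_val {D : Finset (Finset ℕ)} {m : ℕ} {X : ℕ → Finset ℕ} {M : Memory}
    (h : Listing D m X M) {p : ℕ} (hp : p < m) (h8 : M 8 = p) : curSet.val M = binCode (X p) := by
  rw [curSet, get_val, var_val, h8, h.code p hp]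

/-- Array `c` is overwritten by the values of `e`, at all members of the list. -/
def assignList (c : ℕ) (e : Expr) : Program := forList (.store (arr c curSet) e)

theorem Reach.assignList (hL : 1 ≤ L) {D : Finset (Finset ℕ)} {m : ℕ} {X : ℕ → Finset ℕ} {c : ℕ}
    (hc : c < 32) (h8 : c ≠ 8) (h9 : c ≠ 9) (h20 : c ≠ 20) {M₀ : Memory} (hM₀ : Bounded L M₀)
    (hlist : Listing D m X M₀) (new : Finset ℕ → ℕ) {e : Expr} (hsz : e.sz ≤ 2000)
    (hnew : ∀ Y ∈ D, new Y < 2 ^ L)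
    (he : ∀ p < m, ∀ M, Same {8, c} M₀ M → M 8 = p → curSet.val M = binCode (X p) →
      M (32 * binCode (X p) + c) = M₀ (32 * binCode (X p) + c) →
      (∀ Y ∈ D, new Y = M₀ (32 * binCode Y + c) →
        M (32 * binCode Y + c) = M₀ (32 * binCode Y + c)) → e.val M = new (X p)) :
    Reach O T ω L (assignList c e) M₀ (m * 3 + 2) fun M' => Same {8, c} M₀ M' ∧
      (∀ Y ∈ D, M' (32 * binCode Y + c) = new Y) ∧
      ∀ y, (∀ Y ∈ D, y ≠ binCode Y) → M' (32 * y + c) = M₀ (32 * y + c) := by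
  refine Reach.forList hL hc h8 h9 h20 hM₀ hlist new 1 fun p hp M hM h1 h2 h3 h4 => ?_
  have h5 := curSet_val (hlist.of_same h1 (by simp; omega) (by simp; omega)) hp h2
  refine Reach.store hL hM ?_ (by rw [arr_val, h5]) (he p hp M h1 h2 h5 h3 h4)
    (hnew _ ((hlist.mem _).2 ⟨p, hp, rfl⟩)) rfl
  simp only [arr, curSet, get, RAM.var, Expr.sz]
  omega

theorem Reach.iterateAssignList (hL : 1 ≤ L) {D : Finset (Finset ℕ)} {m : ℕ} {X : ℕ → Finset ℕ}
    {c : ℕ} (hc : c < 32) (h7 : c ≠ 7) (h8 : c ≠ 8) (h9 : c ≠ 9) (h20 : c ≠ 20) {M₀ : Memory}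
    (hM₀ : Bounded L M₀) (hlist : Listing D m X M₀) (w : ℕ → Finset ℕ → ℕ) {lim e : Expr} (r : ℕ)
    (hr : r < 2 ^ L) (hsz' : lim.sz ≤ 2000) (hsz : e.sz ≤ 2000)
    (hlim : ∀ M, Same {7, 8, c} M₀ M → lim.val M = r)
    (hw : ∀ i < r, ∀ Y ∈ D, w (i + 1) Y < 2 ^ L)
    (h0 : ∀ Y ∈ D, M₀ (32 * binCode Y + c) = w 0 Y)
    (he : ∀ i < r, ∀ p < m, ∀ M, Same {7, 8, c} M₀ M → M 7 = i → M 8 = p →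
      curSet.val M = binCode (X p) → M (32 * binCode (X p) + c) = w i (X p) →
      (∀ Y ∈ D, w (i + 1) Y = w i Y → M (32 * binCode Y + c) = w i Y) →
      e.val M = w (i + 1) (X p)) :
    Reach O T ω L (RAM.forTo 7 lim (RAM.assignList c e)) M₀ (r * (m * 3 + 4) + 2) fun M' =>
      Same {7, 8, c} M₀ M' ∧ ∀ Y ∈ D, M' (32 * binCode Y + c) = w r Y := by
  have hne : ∀ y, 32 * y + c ≠ 7 := by intro y; omega
  refine (Reach.forTo (t := m * 3 + 2) hL (by norm_num) hsz' (fun i M => Same {7, 8, c} M₀ M ∧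
    ∀ Y ∈ D, M (32 * binCode Y + c) = w i Y) r hr ?_ ?_ hM₀ ?_).mono le_rfl ?_
  · rintro i M hi ⟨h1, -⟩ -
    exact hlim M h1
  · rintro i M hi hM ⟨h1, h2⟩ h3
    have hsub : ({8, c} : Finset ℕ) ⊆ {7, 8, c} := by simp
    refine (Reach.assignList hL hc h8 h9 h20 hM
      (hlist.of_same h1 (by simp; omega) (by simp; omega)) (w (i + 1)) hsz (hw i hi) ?_).mono
      le_rfl ?_
    · intro p hp M' h4 h5 h6 h7' h9'
      have hp' : X p ∈ D := (hlist.mem _).2 ⟨p, hp, rfl⟩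
      refine he i hi p hp M' (h1.trans (h4.mono hsub)) ?_ h5 h6 (by rw [h7', h2 _ hp']) ?_
      · rw [h4.var (by norm_num) (by simp; omega), h3]
      · intro Y hY hY'
        rw [h9' Y hY (by rw [hY', h2 Y hY]), h2 Y hY]
    · rintro M' - ⟨h4, h5, -⟩
      refine ⟨by rw [h4.var (by norm_num) (by simp; omega), h3],
        (h1.trans (h4.mono hsub)).update (by simp) _, fun Y hY => ?_⟩
      rw [Function.update_of_ne (hne _), h5 Y hY]
  · refine ⟨(Same.refl _ _).update (by simp) _, fun Y hY => ?_⟩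
    rw [Function.update_of_ne (hne _), h0 Y hY]
  · rintro M' - ⟨h, -⟩
    exact h

end RAM

/-! ### Parameters -/

/-- The base in which the weight enumerators are written. -/
def weightBase (n : ℕ) : ℕ := 2 * (2 ^ n) ^ n

/-- A bound on the lengths of all numbers that occur. -/
def wordLength (n : ℕ) : ℕ := (n + 2) ^ 4

theorem weightBase_eq (n : ℕ) : weightBase n = 2 ^ (n * n + 1) := by
  rw [weightBase, ← pow_mul, pow_succ']

theorem one_le_weightBase (n : ℕ) : 1 ≤ weightBase n := by
  rw [weightBase_eq]; exact Nat.one_le_two_pow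

theorem one_le_wordLength (n : ℕ) : 1 ≤ wordLength n := Nat.one_le_pow _ _ (by omega)

/-- The exponent on the left is n^4 + 2n². This bounds the powers of zeta values, the largest
numbers in the computation, and dictates `wordLength`. -/
theorem total_weight_lt (n : ℕ) : (2 ^ n * weightBase n ^ n) ^ n < 2 ^ wordLength n := by
  rw [weightBase_eq, ← pow_mul, ← pow_add, ← pow_mul]
  refine Nat.pow_lt_pow_right one_lt_two ?_
  rw [wordLength]
  ring_nf
  nlinarith [Nat.zero_le n, Nat.zero_le (n ^ 2), Nat.zero_le (n ^ 3)]

theorem weightBase_pow_lt (n : ℕ) : weightBase n ^ n < 2 ^ wordLength n := by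
  rw [weightBase_eq, ← pow_mul]
  refine Nat.pow_lt_pow_right one_lt_two ?_
  rw [wordLength]
  ring_nf
  nlinarith [Nat.zero_le n, Nat.zero_le (n ^ 2), Nat.zero_le (n ^ 3), Nat.zero_le (n ^ 4)]

theorem weight_lt (n : ℕ) : 2 ^ n * weightBase n ^ n < 2 ^ wordLength n := by
  rw [weightBase_eq, ← pow_mul, ← pow_add]
  refine Nat.pow_lt_pow_right one_lt_two ?_
  rw [wordLength]
  ring_nf
  nlinarith [Nat.zero_le n, Nat.zero_le (n ^ 2), Nat.zero_le (n ^ 3), Nat.zero_le (n ^ 4)]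

theorem weightBase_lt (n : ℕ) : weightBase n < 2 ^ wordLength n := by
  rw [weightBase_eq]
  refine Nat.pow_lt_pow_right one_lt_two ?_
  rw [wordLength]
  ring_nf
  nlinarith [Nat.zero_le n, Nat.zero_le (n ^ 2), Nat.zero_le (n ^ 3), Nat.zero_le (n ^ 4)]

theorem small_lt (n : ℕ) : 8 * (n + 1) ^ 2 + 2 ^ n < 2 ^ wordLength n := by
  have h1 : (n + 1) ^ 2 ≤ 2 ^ n * 2 ^ n * 4 := by
    have : n + 1 ≤ 2 ^ n * 2 := by have := Nat.lt_two_pow_self (n := n); omega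
    nlinarith
  have h2 : 2 ^ (n + n + 6) ≤ 2 ^ wordLength n := by
    refine Nat.pow_le_pow_right two_pos ?_
    rw [wordLength]
    ring_nf
    nlinarith [Nat.zero_le n, Nat.zero_le (n ^ 2), Nat.zero_le (n ^ 3), Nat.zero_le (n ^ 4)]
  have h3 : 1 ≤ 2 ^ n := Nat.one_le_two_pow
  rw [pow_add, pow_add] at h2
  nlinarith

theorem linear_lt (n : ℕ) : 8 * (n + 1) < 2 ^ wordLength n ∧ 2 ^ n + 2 < 2 ^ wordLength n := by
  have h1 := small_lt n
  have h2 : n + 1 ≤ (n + 1) ^ 2 := Nat.le_self_pow two_ne_zero _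
  have h3 := Nat.two_pow_pos n
  constructor <;> omega

theorem two_pow_clog_le (n : ℕ) : 2 ^ Nat.clog 2 n ≤ 2 * n + 1 := by
  rcases Nat.lt_or_ge 1 n with h | h
  · have h1 := Nat.pow_pred_clog_lt_self one_lt_two h
    have h2 : 0 < Nat.clog 2 n := Nat.clog_pos one_lt_two h
    have h3 : 2 ^ Nat.clog 2 n = 2 * 2 ^ (Nat.clog 2 n).pred := by
      rw [← pow_succ', ← Nat.succ_eq_add_one, Nat.succ_pred h2.ne']
    omega
  · rw [Nat.clog_of_right_le_one h]; omega

namespace RAM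

/-! ### Initialization -/

/-- Tables that do not change after the initialization. -/
structure Env (n s : ℕ) (M : Memory) : Prop where
  n_eq : M 0 = n
  s_eq : M 1 = s
  base : M 3 = weightBase n
  count : M 4 = 2 ^ Nat.clog 2 n
  pow : ∀ j ≤ n, M (32 * j + 29) = 2 ^ j
  bit : ∀ a < 2 ^ Nat.clog 2 n, ∀ u < 2 ^ Nat.clog 2 n,
    M (32 * (a * 2 ^ Nat.clog 2 n + u) + 28) = walshBit a u

theorem Env.of_same {n s : ℕ} {M M' : Memory} (h : Env n s M) {S : Finset ℕ} (hs : Same S M M')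
    (hS : Disjoint S {0, 1, 3, 4, 28, 29}) : Env n s M' := by
  have hn : ∀ c ∈ ({0, 1, 3, 4, 28, 29} : Finset ℕ), c ∉ S :=
    fun c hc hc' => Finset.disjoint_left.1 hS hc' hc
  exact
  { n_eq := by rw [hs.var (by norm_num) (hn 0 (by simp)), h.n_eq]
    s_eq := by rw [hs.var (by norm_num) (hn 1 (by simp)), h.s_eq]
    base := by rw [hs.var (by norm_num) (hn 3 (by simp)), h.base]
    count := by rw [hs.var (by norm_num) (hn 4 (by simp)), h.count]
    pow := fun j hj => by rw [hs.arr j (by norm_num) (hn 29 (by simp)), h.pow j hj]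
    bit := fun a ha u hu => by rw [hs.arr _ (by norm_num) (hn 28 (by simp)), h.bit a ha u hu] }

/-- Array `29` receives the powers of two. -/
def initPow : Program :=
  .seq (.store (arr 29 (.const 0)) (.const 1))
    (forTo 7 (var 0)
      (.store (arr 29 (.plus (var 7) (.const 1))) (.times (.const 2) (get 29 (var 7)))))

/-- Variable `3` receives the base of the weights. -/
def initBase : Program :=
  .seq (.store (.const 3) (.const 2))
    (forTo 7 (var 0) (.store (.const 3) (.times (var 3) (get 29 (var 0)))))

/-- Variable `4` receives the number of Walsh functions. -/
def initCount : Program :=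
  .seq (.store (.const 4) (.const 1))
    (.loop (.monus (var 0) (var 4)) (.store (.const 4) (.plus (var 4) (var 4))))

/-- Array `28` receives the values of the Walsh functions. -/
def initBit : Program :=
  forTo 7 (.times (var 4) (var 4)) (.store (arr 28 (var 7))
    (rem (.plus (get 28 (.plus (.times (.quot (.quot (var 7) (var 4)) (.const 2)) (var 4))
        (.quot (rem (var 7) (var 4)) (.const 2))))
      (.times (rem (.quot (var 7) (var 4)) (.const 2)) (rem (rem (var 7) (var 4)) (.const 2))))
      (.const 2)))

variable {O : ℕ → Bool} {T : ℕ} {ω : ℕ → Bool} {n s : ℕ}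

theorem Reach.initPow {M : Memory} (hM : Bounded (wordLength n) M) (hn : M 0 = n) :
    Reach O T ω (wordLength n) initPow M (1 + (n * (1 + 2) + 2)) fun M' =>
      Same {7, 29} M M' ∧ ∀ j ≤ n, M' (32 * j + 29) = 2 ^ j := by
  have hL := one_le_wordLength n
  obtain ⟨hsm, hsm'⟩ := linear_lt n
  refine Reach.seq (P := fun M' => M' = Function.update M 29 1)
    (Reach.store hL hM (by decide) rfl rfl (Nat.one_lt_two_pow (by omega)) rfl) ?_
  rintro M₁ hM₁ rfl
  refine (Reach.forTo (t := 1) hL (by norm_num) (by decide) (fun i M' => Same {7, 29} M M' ∧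
    ∀ j ≤ i, M' (32 * j + 29) = 2 ^ j) n (by omega) ?_ ?_ hM₁ ?_).mono le_rfl ?_
  · rintro i M' - ⟨h1, -⟩ -
    rw [var_val, h1.var (by norm_num) (by decide), hn]
  · rintro i M' hi hM' ⟨h1, h2⟩ h3
    refine Reach.store (x := 32 * (i + 1) + 29) (v := 2 ^ (i + 1)) hL hM' (by decide)
      (by simp [Expr.val, h3]) (by simp [Expr.val, h3, h2 i le_rfl, pow_succ']) ?_ ⟨?_, ?_, ?_⟩
    · have := Nat.pow_le_pow_right two_pos (show i + 1 ≤ n from hi)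
      omega
    · rw [Function.update_of_ne (by omega), h3]
    · exact (h1.update (by simp) _).update (by simp) _
    · intro j hj
      rw [Function.update_of_ne (by omega), Function.update_apply]
      split_ifs with h
      · congr 1; omega
      · exact h2 j (by omega)
  · refine ⟨((Same.refl _ _).update (by simp) _).update (by simp) _, fun j hj => ?_⟩
    obtain rfl : j = 0 := by omega
    simp
  · rintro M' - ⟨h, -⟩
    exact h

theorem Reach.initBase {M : Memory} (hM : Bounded (wordLength n) M) (hn : M 0 = n)
    (hp : ∀ j ≤ n, M (32 * j + 29) = 2 ^ j) :
    Reach O T ω (wordLength n) initBase M (1 + (n * (1 + 2) + 2)) fun M' =>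
      Same {3, 7} M M' ∧ M' 3 = weightBase n := by
  have hL := one_le_wordLength n
  obtain ⟨hsm, hsm'⟩ := linear_lt n
  refine Reach.seq (P := fun M' => M' = Function.update M 3 2)
    (Reach.store hL hM (by decide) rfl rfl (by simp only [Expr.val]; omega) rfl) ?_
  rintro M₁ hM₁ rfl
  refine (Reach.forTo (t := 1) hL (by norm_num) (by decide) (fun i M' => Same {3, 7} M M' ∧
    M' 3 = 2 * (2 ^ n) ^ i) n (by omega) ?_ ?_ hM₁ ?_).mono le_rfl ?_
  · rintro i M' - ⟨h1, -⟩ -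
    rw [var_val, h1.var (by norm_num) (by decide), hn]
  · rintro i M' hi hM' ⟨h1, h2⟩ h3
    have h4 : M' 0 = n := by rw [h1.var (by norm_num) (by decide), hn]
    have h5 : M' (32 * n + 29) = 2 ^ n := by
      rw [h1.arr n (by norm_num) (by decide), hp n le_rfl]
    refine Reach.store (x := 3) (v := 2 * (2 ^ n) ^ (i + 1)) hL hM' (by decide) rfl
      (by simp [Expr.val, h2, h4, h5, pow_succ, mul_assoc]) ?_ ⟨?_, ?_, ?_⟩
    · refine lt_of_le_of_lt ?_ (weightBase_lt n)
      exact Nat.mul_le_mul_left _ (Nat.pow_le_pow_right (by positivity) hi)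
    · rw [Function.update_of_ne (by omega), h3]
    · exact (h1.update (by simp) _).update (by simp) _
    · rw [Function.update_of_ne (by omega), Function.update_self]
  · exact ⟨((Same.refl _ _).update (by simp) _).update (by simp) _, by simp⟩
  · rintro M' - ⟨h, -⟩
    exact h

theorem Reach.initCount {M : Memory} (hM : Bounded (wordLength n) M) (hn : M 0 = n) :
    Reach O T ω (wordLength n) initCount M (1 + (Nat.clog 2 n * (1 + 1) + 1)) fun M' =>
      Same {4} M M' ∧ M' 4 = 2 ^ Nat.clog 2 n := by
  have hL := one_le_wordLength n
  obtain ⟨hsm, hsm'⟩ := linear_lt n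
  refine Reach.seq (P := fun M' => M' = Function.update M 4 1)
    (Reach.store hL hM (by decide) rfl rfl (by simp only [Expr.val]; omega) rfl) ?_
  rintro M₁ hM₁ rfl
  refine Reach.loop hL (by decide) (fun i M' => Same {4} M M' ∧ M' 4 = 2 ^ i) _ 1 ?_ ?_ ?_ hM₁ ?_
  · rintro i M' hi ⟨h1, h2⟩
    have := (Nat.lt_clog_iff_pow_lt one_lt_two).1 hi
    simp only [Expr.val, var_val, h2, h1.var (c := 0) (by norm_num) (by decide), hn]
    omega
  · rintro M' ⟨h1, h2⟩
    have := Nat.le_pow_clog one_lt_two n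
    simp only [Expr.val, var_val, h2, h1.var (c := 0) (by norm_num) (by decide), hn]
    omega
  · rintro i M' hi hM' ⟨h1, h2⟩
    have := (Nat.lt_clog_iff_pow_lt one_lt_two).1 hi
    refine Reach.store (x := 4) (v := 2 ^ (i + 1)) hL hM' (by decide) rfl
      (by simp [Expr.val, h2, pow_succ]; omega) ?_ ⟨h1.update (by simp) _, by simp⟩
    rw [pow_succ]
    omega
  · exact ⟨(Same.refl _ _).update (by simp) _, by simp⟩

/-- In row-major order the entry for (a, u) depends on that for (a/2, u/2), which comes earlier
except at position 0. That position refers to itself, so its cell has to start with the correct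
value 0. -/
theorem Reach.initBit {M : Memory} (hM : Bounded (wordLength n) M)
    (h4 : M 4 = 2 ^ Nat.clog 2 n) (h28 : M 28 = 0) :
    Reach O T ω (wordLength n) initBit M
      (2 ^ Nat.clog 2 n * 2 ^ Nat.clog 2 n * (1 + 2) + 2) fun M' => Same {7, 28} M M' ∧
        ∀ a < 2 ^ Nat.clog 2 n, ∀ u < 2 ^ Nat.clog 2 n,
          M' (32 * (a * 2 ^ Nat.clog 2 n + u) + 28) = walshBit a u := by
  have hL := one_le_wordLength n
  obtain ⟨hsm, hsm'⟩ := linear_lt n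
  have hN := two_pow_clog_le n
  have hN0 : 0 < 2 ^ Nat.clog 2 n := by positivity
  set N := 2 ^ Nat.clog 2 n
  have hNN : N * N < 2 ^ wordLength n := by
    have h1 := small_lt n
    have h2 : (2 * n + 1) * (2 * n + 1) ≤ 8 * (n + 1) ^ 2 := by nlinarith
    have h3 := Nat.mul_le_mul hN hN
    have h4 := Nat.two_pow_pos n
    omega
  refine (Reach.forTo (t := 1) hL (by norm_num) (by decide) (fun i M' => Same {7, 28} M M' ∧
    (i = 0 → M' 28 = 0) ∧ ∀ q < i, M' (32 * q + 28) = walshBit (q / N) (q % N)) (N * N)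
    hNN ?_ ?_ hM ?_).mono le_rfl ?_
  · rintro i M' - ⟨h1, -⟩ -
    simp only [Expr.val, var_val]
    rw [h1.var (by norm_num) (by decide), h4]
  · rintro i M' hi hM' ⟨h1, h2, h3⟩ h5
    have h6 : M' 4 = N := by rw [h1.var (by norm_num) (by decide), h4]
    have h7 : M' (32 * (i / N / 2 * N + i % N / 2) + 28) =
        walshBit (i / N / 2) (i % N / 2) := by
      have e1 : i % N / 2 < N := (Nat.div_le_self _ _).trans_lt (Nat.mod_lt _ hN0)
      rcases Nat.eq_zero_or_pos i with rfl | hi0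
      · simp [h2 rfl, walshBit_zero_left]
      · have e2 := Nat.div_add_mod i N
        have e3 : i / N / 2 * N + i % N / 2 < i := by
          have e4 : i / N / 2 * N * 2 ≤ i / N * N := by
            have := Nat.div_mul_le_self (i / N) 2
            nlinarith
          have e5 : i / N * N = N * (i / N) := mul_comm _ _
          by_cases e6 : i % N = 0
          · rw [e6] at e2 ⊢
            omega
          · omega
        rw [h3 _ e3, add_comm, Nat.add_mul_div_right _ _ hN0, Nat.add_mul_mod_self_right,
          Nat.mod_eq_of_lt e1, Nat.div_eq_of_lt e1, zero_add]
    refine Reach.store (x := 32 * i + 28) (v := walshBit (i / N) (i % N)) hL hM' (by decide)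
      (by simp [h5]) ?_ ?_ ⟨?_, ?_, ?_, ?_⟩
    · rw [walshBit_step]
      simp [Expr.val, h5, h6, h7]
    · have := walshBit_le_one (i / N) (i % N)
      omega
    · rw [Function.update_of_ne (by omega), h5]
    · exact (h1.update (by simp) _).update (by simp) _
    · intro h; omega
    · intro q hq
      rw [Function.update_of_ne (by omega), Function.update_apply]
      split_ifs with h
      · rw [show q = i by omega]
      · exact h3 q (by omega)
  · refine ⟨(Same.refl _ _).update (by simp) _, ?_, ?_⟩
    · intro _; simp [h28]
    · intro q hq; omega
  · rintro M' - ⟨⟨h1, -, h2⟩, -⟩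
    refine ⟨h1, fun a ha u hu => ?_⟩
    rw [h2 _ (by nlinarith), add_comm, Nat.add_mul_div_right _ _ hN0, Nat.add_mul_mod_self_right,
      Nat.mod_eq_of_lt hu, Nat.div_eq_of_lt hu, zero_add]

/-- The initialization. -/
def initAll : Program := .seq initPow (.seq initBase (.seq initCount initBit))

theorem Reach.initAll {M : Memory} (hM : Bounded (wordLength n) M) (h0 : M 0 = n) (h1 : M 1 = s)
    (h28 : M 28 = 0) :
    Reach O T ω (wordLength n) initAll M (30 * (n + 1) ^ 2) fun M' =>
      Same {3, 4, 7, 28, 29} M M' ∧ Env n s M' := by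
  have hN := two_pow_clog_le n
  have hc : Nat.clog 2 n ≤ 2 * n := by
    have := Nat.lt_two_pow_self (n := Nat.clog 2 n); omega
  have hNN : 2 ^ Nat.clog 2 n * 2 ^ Nat.clog 2 n ≤ (2 * n + 1) * (2 * n + 1) :=
    Nat.mul_le_mul hN hN
  refine Reach.mono (N := (1 + (n * (1 + 2) + 2)) + ((1 + (n * (1 + 2) + 2)) +
      ((1 + (Nat.clog 2 n * (1 + 1) + 1)) +
        (2 ^ Nat.clog 2 n * 2 ^ Nat.clog 2 n * (1 + 2) + 2))))
    (Q := fun M' => Same {3, 4, 7, 28, 29} M M' ∧ Env n s M') ?_ (by nlinarith) fun _ _ h => h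
  refine Reach.seq (Reach.initPow hM h0) fun M₁ hM₁ ⟨a1, a2⟩ => ?_
  refine Reach.seq (Reach.initBase hM₁ (by rw [a1.var (by norm_num) (by decide), h0]) a2)
    fun M₂ hM₂ ⟨b1, b2⟩ => ?_
  refine Reach.seq (Reach.initCount hM₂ (by
    rw [b1.var (by norm_num) (by decide), a1.var (by norm_num) (by decide), h0])) ?_
  · rintro M₃ hM₃ ⟨c1, c2⟩
    refine (Reach.initBit hM₃ c2 ?_).mono le_rfl ?_
    · rw [c1.var (by norm_num) (by decide), b1.var (by norm_num) (by decide),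
        a1.var (by norm_num) (by decide), h28]
    · rintro M₄ hM₄ ⟨d1, d2⟩
      have a1' : Same {3, 4, 7, 28, 29} M M₁ := a1.mono (by decide)
      have b1' : Same {3, 4, 7, 28, 29} M₁ M₂ := b1.mono (by decide)
      have c1' : Same {3, 4, 7, 28, 29} M₂ M₃ := c1.mono (by decide)
      have d1' : Same {3, 4, 7, 28, 29} M₃ M₄ := d1.mono (by decide)
      have e := a1'.trans (b1'.trans (c1'.trans d1'))
      refine ⟨e, ?_, ?_, ?_, ?_, ?_, d2⟩
      · rw [e.var (by norm_num) (by decide), h0]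
      · rw [e.var (by norm_num) (by decide), h1]
      · rw [d1.var (by norm_num) (by decide), c1.var (by norm_num) (by decide), b2]
      · rw [d1.var (by norm_num) (by decide), c2]
      · intro j hj
        rw [d1.arr j (by norm_num) (by decide), c1.arr j (by norm_num) (by decide),
          b1.arr j (by norm_num) (by decide), a2 j hj]

end RAM

namespace RAM

variable {O : ℕ → Bool} {T : ℕ} {ω : ℕ → Bool} {n s : ℕ}

/-! ### Enumeration of the unbalanced sets -/

/-- The Walsh bit of the current function (variable `6`) at the current element (variable `7`). -/
def curBit : Expr := get 28 (.plus (.times (var 6) (var 4)) (var 7))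

theorem curBit_val {M : Memory} (h : Env n s M) {a j : ℕ} (ha : a < 2 ^ Nat.clog 2 n)
    (hj : j < n) (h6 : M 6 = a) (h7 : M 7 = j) : curBit.val M = walshBit a j := by
  have := Nat.le_pow_clog one_lt_two n
  rw [← h.bit a ha j (by omega)]
  simp [curBit, Expr.val, h.count, h6, h7]

/-- Variable `11` receives the size of the current Walsh set. -/
def countWalsh : Program :=
  .seq (.store (.const 11) (.const 0))
    (forTo 7 (var 0) (.store (.const 11) (.plus (var 11) curBit)))

theorem card_walshSet_succ (i a : ℕ) :
    (walshSet (i + 1) a).card = (walshSet i a).card + walshBit a i := by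
  rw [walshSet, Finset.range_add_one, Finset.filter_insert]
  have := walshBit_le_one a i
  split_ifs with h
  · rw [Finset.card_insert_of_notMem (by simp), h]; rfl
  · rw [show walshBit a i = 0 by omega]; rfl

theorem card_walshSet_le (n a : ℕ) : (walshSet n a).card ≤ n := by
  simpa using Finset.card_le_card (walshSet_subset n a)

theorem Reach.countWalsh {M : Memory} (hM : Bounded (wordLength n) M) (h : Env n s M) {a : ℕ}
    (ha : a < 2 ^ Nat.clog 2 n) (h6 : M 6 = a) :
    Reach O T ω (wordLength n) countWalsh M (1 + (n * (1 + 2) + 2)) fun M' =>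
      Same {7, 11} M M' ∧ M' 11 = (walshSet n a).card := by
  have hL := one_le_wordLength n
  obtain ⟨hsm, hsm'⟩ := linear_lt n
  refine Reach.seq (P := fun M' => M' = Function.update M 11 0)
    (Reach.store hL hM (by decide) rfl rfl (by simp only [Expr.val]; omega) rfl) ?_
  rintro M₁ hM₁ rfl
  refine (Reach.forTo (t := 1) hL (by norm_num) (by decide) (fun i M' => Same {7, 11} M M' ∧
    M' 11 = (walshSet i a).card) n (by omega) ?_ ?_ hM₁ ?_).mono le_rfl ?_
  · rintro i M' - ⟨h1, -⟩ -
    rw [var_val, h1.var (by norm_num) (by decide), h.n_eq]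
  · rintro i M' hi hM' ⟨h1, h2⟩ h3
    have h4 := curBit_val (h.of_same h1 (by decide)) ha hi
      (by rw [h1.var (by norm_num) (by decide), h6]) h3
    refine Reach.store (x := 11) (v := (walshSet (i + 1) a).card) hL hM' (by decide) rfl
      (by simp [Expr.val, h2, h4, card_walshSet_succ]) ?_ ⟨?_, ?_, ?_⟩
    · have := card_walshSet_le (i + 1) a
      omega
    · rw [Function.update_of_ne (by omega), h3]
    · exact (h1.update (by simp) _).update (by simp) _
    · rw [Function.update_of_ne (by omega), Function.update_self]
  · exact ⟨((Same.refl _ _).update (by simp) _).update (by simp) _, by simp [walshSet]⟩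
  · rintro M' - ⟨h, -⟩
    exact h

/-- The list of the sets `X 0, …, X (m - 1)` stands in the arrays `20`, …, `23`, together with
weights and numbers of elements inside and outside of the current Walsh set. -/
structure Records (n a m : ℕ) (X : ℕ → Finset ℕ) (M : Memory) : Prop where
  inj : ∀ p < m, ∀ q < m, X p = X q → p = q
  len : M 9 = m
  code : ∀ p < m, M (32 * p + 20) = binCode (X p)
  weight : ∀ p < m, M (32 * p + 21) = weightBase n ^ (X p).card
  inside : ∀ p < m, M (32 * p + 22) = (X p ∩ walshSet n a).card
  outside : ∀ p < m, M (32 * p + 23) = (X p \ walshSet n a).card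

theorem Records.of_same {a m : ℕ} {X : ℕ → Finset ℕ} {M M' : Memory} (h : Records n a m X M)
    {S : Finset ℕ} (hs : Same S M M') (hS : Disjoint S {9, 20, 21, 22, 23}) :
    Records n a m X M' := by
  have hn : ∀ c ∈ ({9, 20, 21, 22, 23} : Finset ℕ), c ∉ S :=
    fun c hc hc' => Finset.disjoint_left.1 hS hc' hc
  exact
  { inj := h.inj
    len := by rw [hs.var (by norm_num) (hn 9 (by simp)), h.len]
    code := fun p hp => by rw [hs.arr p (by norm_num) (hn 20 (by simp)), h.code p hp]
    weight := fun p hp => by rw [hs.arr p (by norm_num) (hn 21 (by simp)), h.weight p hp]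
    inside := fun p hp => by rw [hs.arr p (by norm_num) (hn 22 (by simp)), h.inside p hp]
    outside := fun p hp => by rw [hs.arr p (by norm_num) (hn 23 (by simp)), h.outside p hp] }

/-- The record at position `9` describes an unbalanced set. -/
def unbalancedTest : Expr :=
  sign (.plus
    (.monus (.plus (.times (.const 32) (var 11)) (.const 1))
      (.plus (.times (.const 64) (get 22 (var 9))) (var 1)))
    (.monus (.plus (.times (.const 32) (.monus (var 0) (var 11))) (.const 1))
      (.plus (.times (.const 64) (get 23 (var 9))) (var 1))))

/-- The current set, extended by the current element, is appended to the list if it is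
unbalanced. -/
def appendSet : Program :=
  .seq (.store (arr 20 (var 9)) (.plus curSet (get 29 (var 7))))
  (.seq (.store (arr 21 (var 9)) (.times (get 21 (var 8)) (var 3)))
  (.seq (.store (arr 22 (var 9)) (.plus (get 22 (var 8)) curBit))
  (.seq (.store (arr 23 (var 9)) (.monus (.plus (get 23 (var 8)) (.const 1)) curBit))
    (.store (.const 9) (.plus (var 9) unbalancedTest)))))

theorem walshSet_inter_insert {a j : ℕ} {X : Finset ℕ} (hj : j < n) (hjX : j ∉ X) :
    (insert j X ∩ walshSet n a).card = (X ∩ walshSet n a).card + walshBit a j ∧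
    (insert j X \ walshSet n a).card = (X \ walshSet n a).card + 1 - walshBit a j := by
  have h1 := walshBit_le_one a j
  have h2 : j ∈ walshSet n a ↔ walshBit a j = 1 := by simp [walshSet, hj]
  by_cases h : walshBit a j = 1
  · rw [Finset.insert_inter_of_mem (h2.2 h), Finset.insert_sdiff_of_mem _ (h2.2 h),
      Finset.card_insert_of_notMem (by simp [hjX]), h]
    exact ⟨rfl, rfl⟩
  · rw [Finset.insert_inter_of_notMem (mt h2.1 h), Finset.insert_sdiff_of_notMem _ (mt h2.1 h),
      Finset.card_insert_of_notMem (by simp [hjX]), show walshBit a j = 0 by omega]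
    exact ⟨rfl, rfl⟩

/-- The record is always written behind the list, and only the length depends on the test, so no
branching is needed; a rejected record is simply overwritten later. -/
theorem Reach.appendSet {M : Memory} (hM : Bounded (wordLength n) M) (h : Env n s M) {a j p m : ℕ}
    {X : ℕ → Finset ℕ} (ha : a < 2 ^ Nat.clog 2 n) (h6 : M 6 = a) (hj : j < n) (h7 : M 7 = j)
    (h11 : M 11 = (walshSet n a).card) (hr : Records n a m X M) (hm : m ≤ 2 ^ n) (hp : p < m)
    (h8 : M 8 = p) (hX : X p ⊆ Finset.range j) (hnew : ∀ q < m, X q ≠ insert j (X p)) :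
    Reach O T ω (wordLength n) appendSet M 5 fun M' => Same {9, 20, 21, 22, 23} M M' ∧
      Records n a (if insert j (X p) ∈ unbalanced n s a then m + 1 else m)
        (Function.update X m (insert j (X p))) M' := by
  have hL := one_le_wordLength n
  obtain ⟨hsm, hsm'⟩ := linear_lt n
  have hjX : j ∉ X p := fun h' => by simpa using hX h'
  have hXn : insert j (X p) ⊆ Finset.range n := by
    intro u hu
    rcases Finset.mem_insert.1 hu with rfl | hu
    · exact Finset.mem_range.2 hj
    · exact Finset.mem_range.2 ((Finset.mem_range.1 (hX hu)).trans hj)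
  have hcard : (insert j (X p)).card ≤ n := by simpa using Finset.card_le_card hXn
  obtain ⟨hin, hout⟩ := walshSet_inter_insert (n := n) (a := a) hj hjX
  set Y := insert j (X p) with hY
  have hin' : (Y ∩ walshSet n a).card ≤ n :=
    (Finset.card_le_card Finset.inter_subset_left).trans hcard
  have hout' : (Y \ walshSet n a).card ≤ n :=
    (Finset.card_le_card Finset.sdiff_subset).trans hcard
  have h9 := hr.len
  let M₁ := Function.update M (32 * m + 20) (binCode Y)
  let M₂ := Function.update M₁ (32 * m + 21) (weightBase n ^ Y.card)
  let M₃ := Function.update M₂ (32 * m + 22) (Y ∩ walshSet n a).card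
  let M₄ := Function.update M₃ (32 * m + 23) (Y \ walshSet n a).card
  have s1 : Same {9, 20, 21, 22, 23} M M₁ := (Same.refl _ _).update (by simp) _
  have s2 : Same {9, 20, 21, 22, 23} M M₂ := s1.update (by simp) _
  have s3 : Same {9, 20, 21, 22, 23} M M₃ := s2.update (by simp) _
  have s4 : Same {9, 20, 21, 22, 23} M M₄ := s3.update (by simp) _
  have e9 : M₁ 9 = m ∧ M₂ 9 = m ∧ M₃ 9 = m ∧ M₄ 9 = m := by
    refine ⟨?_, ?_, ?_, ?_⟩ <;> simp (disch := omega) only [M₁, M₂, M₃, M₄,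
      Function.update_of_ne, h9]
  have e8 : M₁ 8 = p ∧ M₂ 8 = p ∧ M₃ 8 = p := by
    refine ⟨?_, ?_, ?_⟩ <;> simp (disch := omega) only [M₁, M₂, M₃, Function.update_of_ne, h8]
  have b2 := curBit_val (h.of_same s2 (by decide)) ha hj
    (by rw [s2.var (by norm_num) (by decide), h6]) (by rw [s2.var (by norm_num) (by decide), h7])
  have b3 := curBit_val (h.of_same s3 (by decide)) ha hj
    (by rw [s3.var (by norm_num) (by decide), h6]) (by rw [s3.var (by norm_num) (by decide), h7])
  refine Reach.seq (N₁ := 1) (N₂ := 4) (P := fun M' => M' = M₁) ?_ ?_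
  · refine Reach.store hL hM (by decide) (by simp [h9]) ?_
      ((binCode_lt hXn).trans (by omega)) rfl
    rw [hY, binCode_insert hjX]
    simp [Expr.val, curSet, h8, h7, hr.code p hp, h.pow j hj.le]
  rintro _ hM₁ rfl
  refine Reach.seq (N₁ := 1) (N₂ := 3) (P := fun M' => M' = M₂) ?_ ?_
  · refine Reach.store hL hM₁ (by decide) (by simp [e9]) ?_
      (lt_of_le_of_lt (Nat.pow_le_pow_right (one_le_weightBase n) hcard) (weightBase_pow_lt n)) rfl
    have : M₁ (32 * p + 21) = weightBase n ^ (X p).card := by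
      simp (disch := omega) only [M₁, Function.update_of_ne, hr.weight p hp]
    rw [hY, Finset.card_insert_of_notMem hjX, pow_succ]
    simp [Expr.val, e8, this, s1.var (c := 3) (by norm_num) (by decide), h.base]
  rintro _ hM₂ rfl
  refine Reach.seq (N₁ := 1) (N₂ := 2) (P := fun M' => M' = M₃) ?_ ?_
  · refine Reach.store hL hM₂ (by decide) (by simp [e9]) ?_ (by omega) rfl
    have : M₂ (32 * p + 22) = (X p ∩ walshSet n a).card := by
      simp (disch := omega) only [M₁, M₂, Function.update_of_ne, hr.inside p hp]
    rw [hin]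
    simp [Expr.val, e8, this, b2]
  rintro _ hM₃ rfl
  refine Reach.seq (N₁ := 1) (N₂ := 1) (P := fun M' => M' = M₄) ?_ ?_
  · refine Reach.store hL hM₃ (by decide) (by simp [e9]) ?_ (by omega) rfl
    have : M₃ (32 * p + 23) = (X p \ walshSet n a).card := by
      simp (disch := omega) only [M₁, M₂, M₃, Function.update_of_ne, hr.outside p hp]
    rw [hout]
    simp [Expr.val, e8, this, b3]
  rintro _ hM₄ rfl
  -- The added 1 makes a truncated difference positive exactly when the non-strict inequality holds;
  -- the sum of the two differences expresses the disjunction.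
  have ht : unbalancedTest.val M₄ = if Y ∈ unbalanced n s a then 1 else 0 := by
    have e22 : M₄ (32 * m + 22) = (Y ∩ walshSet n a).card := by
      simp (disch := omega) only [M₃, M₄, Function.update_of_ne, Function.update_self]
    have e23 : M₄ (32 * m + 23) = (Y \ walshSet n a).card := by
      simp only [M₄, Function.update_self]
    have e0 : M₄ 0 = n := by rw [s4.var (by norm_num) (by decide), h.n_eq]
    have e1 : M₄ 1 = s := by rw [s4.var (by norm_num) (by decide), h.s_eq]
    have e11 : M₄ 11 = (walshSet n a).card := by rw [s4.var (by norm_num) (by decide), h11]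
    simp only [unbalancedTest, sign_val, Expr.val, var_val, get_val, e9, e22, e23, e0, e1, e11,
      mem_unbalanced, hXn, true_and]
    split_ifs <;> omega
  refine Reach.store hL hM₄ (x := 9) (v := if Y ∈ unbalanced n s a then m + 1 else m) (by decide)
    rfl ?_ ?_ ⟨s4.update (by simp) _, ?_⟩
  · simp only [Expr.val, var_val, e9, ht]
    split_ifs <;> rfl
  · split_ifs <;> omega
  have hlt : ∀ q, q < (if Y ∈ unbalanced n s a then m + 1 else m) → q < m ∨ q = m := by
    intro q hq
    split_ifs at hq <;> omega
  refine ⟨?_, by simp, ?_, ?_, ?_, ?_⟩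
  · intro q hq q' hq'
    rcases hlt q hq with h1 | rfl <;> rcases hlt q' hq' with h2 | rfl
    · rw [Function.update_of_ne h1.ne, Function.update_of_ne h2.ne]
      exact hr.inj q h1 q' h2
    · rw [Function.update_of_ne h1.ne, Function.update_self]
      exact fun h' => absurd h' (hnew q h1)
    · rw [Function.update_of_ne h2.ne, Function.update_self]
      exact fun h' => absurd h'.symm (hnew q' h2)
    · exact fun _ => rfl
  · intro q hq
    rcases hlt q hq with h1 | rfl
    · rw [Function.update_of_ne h1.ne, ← hr.code q h1]
      simp (disch := omega) only [M₁, M₂, M₃, M₄, Function.update_of_ne]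
    · simp (disch := omega) only [M₁, M₂, M₃, M₄, Function.update_of_ne, Function.update_self]
  · intro q hq
    rcases hlt q hq with h1 | rfl
    · rw [Function.update_of_ne h1.ne, ← hr.weight q h1]
      simp (disch := omega) only [M₁, M₂, M₃, M₄, Function.update_of_ne]
    · simp (disch := omega) only [M₁, M₂, M₃, M₄, Function.update_of_ne, Function.update_self]
  · intro q hq
    rcases hlt q hq with h1 | rfl
    · rw [Function.update_of_ne h1.ne, ← hr.inside q h1]
      simp (disch := omega) only [M₁, M₂, M₃, M₄, Function.update_of_ne]
    · simp (disch := omega) only [M₁, M₂, M₃, M₄, Function.update_of_ne, Function.update_self]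
  · intro q hq
    rcases hlt q hq with h1 | rfl
    · rw [Function.update_of_ne h1.ne, ← hr.outside q h1]
      simp (disch := omega) only [M₁, M₂, M₃, M₄, Function.update_of_ne]
    · simp (disch := omega) only [M₁, M₂, M₃, M₄, Function.update_of_ne, Function.update_self]

/-- All sets of the list are extended by the current element. -/
def extendList : Program :=
  .seq (.store (.const 10) (var 9)) (forTo 8 (var 10) appendSet)

theorem card_unbalanced_le_two_pow (n s a : ℕ) : (unbalanced n s a).card ≤ 2 ^ n := by
  simpa using Finset.card_le_card
    (show unbalanced n s a ⊆ (Finset.range n).powerset from Finset.filter_subset _ _)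

theorem Records.len_le {a m : ℕ} {X : ℕ → Finset ℕ} {M : Memory} (h : Records n a m X M)
    (hX : ∀ p < m, X p ∈ unbalanced n s a) : m ≤ (unbalanced n s a).card := by
  have h1 := Finset.card_le_card_of_injOn (s := Finset.range m) X
    (fun p hp => hX p (Finset.mem_range.1 hp)) (fun p hp q hq hpq =>
      h.inj p (by simpa using hp) q (by simpa using hq) hpq)
  simpa using h1

/-- By downward closure, an unbalanced set containing the new element j arises from an unbalanced
set without j, already on the list. The old length is frozen in cell `10` because the list grows
during the loop. -/
theorem Reach.extendList {M : Memory} (hM : Bounded (wordLength n) M) (h : Env n s M) {a j m : ℕ}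
    {X : ℕ → Finset ℕ} (ha : a < 2 ^ Nat.clog 2 n) (h6 : M 6 = a) (hj : j < n) (h7 : M 7 = j)
    (h11 : M 11 = (walshSet n a).card) (hr : Records n a m X M)
    (hX : ∀ Y, (∃ p < m, X p = Y) ↔ Y ∈ unbalanced n s a ∧ Y ⊆ Finset.range j) :
    Reach O T ω (wordLength n) extendList M (1 + ((unbalanced n s a).card * (5 + 2) + 2)) fun M' =>
      Same {8, 9, 10, 20, 21, 22, 23} M M' ∧ ∃ m' X', Records n a m' X' M' ∧
        ∀ Y, (∃ p < m', X' p = Y) ↔ Y ∈ unbalanced n s a ∧ Y ⊆ Finset.range (j + 1) := by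
  have hL := one_le_wordLength n
  obtain ⟨hsm, hsm'⟩ := linear_lt n
  have hmU := hr.len_le fun p hp => ((hX _).1 ⟨p, hp, rfl⟩).1
  have hU := card_unbalanced_le_two_pow n s a
  have hXj : ∀ p < m, X p ⊆ Finset.range j := fun p hp => ((hX _).1 ⟨p, hp, rfl⟩).2
  have hjX : ∀ p < m, j ∉ X p := fun p hp h' => by simpa using hXj p hp h'
  refine Reach.mono (N := 1 + (m * (5 + 2) + 2)) ?_ (by omega) fun _ _ h => h
  refine Reach.seq (P := fun M' => M' = Function.update M 10 m)
    (Reach.store hL hM (by decide) rfl hr.len (by omega) rfl) ?_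
  rintro M₁ hM₁ rfl
  refine (Reach.forTo (t := 5) hL (by norm_num) (by decide) (fun i M' =>
    Same {8, 9, 10, 20, 21, 22, 23} M M' ∧ M' 10 = m ∧ ∃ m' X', m ≤ m' ∧
      (∀ q < m, X' q = X q) ∧ Records n a m' X' M' ∧ ∀ Y, (∃ p < m', X' p = Y) ↔
        (∃ q < m, X q = Y) ∨ (Y ∈ unbalanced n s a ∧ ∃ q < i, insert j (X q) = Y))
    m (by omega) ?_ ?_ hM₁ ?_).mono le_rfl ?_
  · rintro i M' - ⟨-, h1, -⟩ -
    rw [var_val, h1]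
  · rintro i M' hi hM' ⟨h1, h2, m', X', h3, h4, h5, h6'⟩ h8
    have hX'U : ∀ p < m', X' p ∈ unbalanced n s a := by
      intro p hp
      rcases (h6' _).1 ⟨p, hp, rfl⟩ with h' | ⟨h', -⟩
      · exact ((hX _).1 h').1
      · exact h'
    have hm' := h5.len_le hX'U
    -- Old sets do not contain j; for the sets added in this loop, erasing j would give a repetition
    -- in the old list.
    have hnew : ∀ q < m', X' q ≠ insert j (X' i) := by
      intro q hq hne
      rw [h4 i hi] at hne
      rcases (h6' _).1 ⟨q, hq, rfl⟩ with ⟨r, hr1, hr2⟩ | ⟨-, r, hr1, hr2⟩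
      · refine hjX r hr1 ?_
        rw [hr2, hne]
        exact Finset.mem_insert_self _ _
      · rw [hne] at hr2
        have := congrArg (fun Z => Z.erase j) hr2
        simp only [Finset.erase_insert (hjX r (hr1.trans hi)), Finset.erase_insert (hjX i hi)]
          at this
        have := hr.inj r (hr1.trans hi) i hi this
        omega
    refine (Reach.appendSet hM' (h.of_same h1 (by decide)) ha
      (by rw [h1.var (by norm_num) (by decide), h6]) hj
      (by rw [h1.var (by norm_num) (by decide), h7])
      (by rw [h1.var (by norm_num) (by decide), h11]) h5 (hm'.trans hU) (hi.trans_le h3) h8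
      (by rw [h4 i hi]; exact hXj i hi) hnew).mono le_rfl ?_
    rintro M'' - ⟨k1, k2⟩
    refine ⟨by rw [k1.var (by norm_num) (by decide), h8],
      (h1.trans (k1.mono (by decide))).update (by simp) _, ?_, _, _, ?_, ?_,
      k2.of_same (S := {8}) ((Same.refl _ _).update (by simp) _) (by decide), ?_⟩
    · rw [Function.update_of_ne (by omega), k1.var (by norm_num) (by decide), h2]
    · split_ifs <;> omega
    · intro q hq
      rw [Function.update_of_ne (by omega), h4 q hq]
    · intro Y
      rw [h4 i hi]
      have e1 : (∃ q < i + 1, insert j (X q) = Y) ↔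
          (∃ q < i, insert j (X q) = Y) ∨ insert j (X i) = Y := by
        constructor
        · rintro ⟨q, hq, e⟩
          rcases Nat.lt_succ_iff_lt_or_eq.1 hq with h' | rfl
          · exact Or.inl ⟨q, h', e⟩
          · exact Or.inr e
        · rintro (⟨q, hq, e⟩ | e)
          · exact ⟨q, by omega, e⟩
          · exact ⟨i, by omega, e⟩
      have e2 : ∀ Z, (∃ p < m', Function.update X' m' Z p = Y) ↔ ∃ p < m', X' p = Y := by
        intro Z
        constructor <;> rintro ⟨p, hp, e⟩ <;> refine ⟨p, hp, ?_⟩ <;>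
          rw [Function.update_of_ne hp.ne] at * <;> exact e
      rw [e1]
      split_ifs with hYU
      · have e3 : (∃ p < m' + 1, Function.update X' m' (insert j (X i)) p = Y) ↔
            (∃ p < m', X' p = Y) ∨ insert j (X i) = Y := by
          rw [← e2 (insert j (X i))]
          constructor
          · rintro ⟨p, hp, e⟩
            rcases Nat.lt_succ_iff_lt_or_eq.1 hp with h' | rfl
            · exact Or.inl ⟨p, h', e⟩
            · rw [Function.update_self] at e
              exact Or.inr e
          · rintro (⟨p, hp, e⟩ | e)
            · exact ⟨p, by omega, e⟩
            · exact ⟨m', by omega, by rw [Function.update_self, e]⟩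
        rw [e3, h6']
        constructor
        · rintro ((h' | ⟨h', h''⟩) | rfl)
          · exact Or.inl h'
          · exact Or.inr ⟨h', Or.inl h''⟩
          · exact Or.inr ⟨hYU, Or.inr rfl⟩
        · rintro (h' | ⟨h', h'' | h''⟩)
          · exact Or.inl (Or.inl h')
          · exact Or.inl (Or.inr ⟨h', h''⟩)
          · exact Or.inr h''
      · rw [e2, h6']
        constructor
        · rintro (h' | ⟨h', h''⟩)
          · exact Or.inl h'
          · exact Or.inr ⟨h', Or.inl h''⟩
        · rintro (h' | ⟨h', h'' | rfl⟩)
          · exact Or.inl h'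
          · exact Or.inr ⟨h', h''⟩
          · exact absurd h' hYU
  · refine ⟨((Same.refl _ _).update (by simp) _).update (by simp) _, by simp, m, X, le_rfl,
      fun _ _ => rfl, hr.of_same (S := {8, 10}) (((Same.refl _ _).update (by simp) _).update
        (by simp) _) (by decide), fun Y => ?_⟩
    simp
  · rintro M' - ⟨⟨h1, -, m', X', -, -, h2, h3⟩, -⟩
    refine ⟨h1, m', X', h2, fun Y => ?_⟩
    rw [h3, hX]
    have hins : ∀ Z : Finset ℕ, Z ⊆ Finset.range j → insert j Z ⊆ Finset.range (j + 1) := by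
      intro Z hZ
      rw [Finset.range_add_one]
      exact Finset.insert_subset_insert _ hZ
    constructor
    · rintro (⟨k1, k2⟩ | ⟨k1, q, hq, rfl⟩)
      · exact ⟨k1, k2.trans (Finset.range_subset_range.2 (by omega))⟩
      · exact ⟨k1, hins _ (hXj q hq)⟩
    · rintro ⟨k1, k2⟩
      by_cases hjY : j ∈ Y
      · have k3 : Y.erase j ⊆ Finset.range j := by
          rw [Finset.range_add_one] at k2
          exact Finset.subset_insert_iff.1 k2
        obtain ⟨q, hq, e⟩ := (hX _).2 ⟨unbalanced_mono k1 (Finset.erase_subset _ _), k3⟩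
        exact Or.inr ⟨k1, q, hq, by rw [e, Finset.insert_erase hjY]⟩
      · rw [Finset.range_add_one, Finset.subset_insert_iff_of_notMem hjY] at k2
        exact Or.inl ⟨k1, k2⟩

/-- The list of all unbalanced sets is built. -/
def buildList : Program :=
  .seq (.store (arr 20 (.const 0)) (.const 0))
  (.seq (.store (arr 21 (.const 0)) (.const 1))
  (.seq (.store (arr 22 (.const 0)) (.const 0))
  (.seq (.store (arr 23 (.const 0)) (.const 0))
  (.seq (.store (.const 9) (.const 1)) (forTo 7 (var 0) extendList)))))

theorem Reach.buildList {M : Memory} (hM : Bounded (wordLength n) M) (h : Env n s M) {a : ℕ}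
    (hs : s ≤ n) (ha : a < 2 ^ Nat.clog 2 n) (h6 : M 6 = a)
    (h11 : M 11 = (walshSet n a).card) :
    Reach O T ω (wordLength n) buildList M
      (5 + (n * ((1 + ((unbalanced n s a).card * (5 + 2) + 2)) + 2) + 2)) fun M' =>
      Same {7, 8, 9, 10, 20, 21, 22, 23} M M' ∧ ∃ m X, Records n a m X M' ∧
        ∀ Y, Y ∈ unbalanced n s a ↔ ∃ p < m, X p = Y := by
  have hL := one_le_wordLength n
  obtain ⟨hsm, hsm'⟩ := linear_lt n
  have hst : ∀ M x v, Bounded (wordLength n) M → x ≤ 60 → v ≤ 1 →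
      Reach O T ω (wordLength n) (.store (.const x) (.const v)) M 1
        fun M' => M' = Function.update M x v := by
    intro M x v hM hx hv
    exact Reach.store hL hM (by simp only [Expr.sz]; omega) rfl rfl
      (by simp only [Expr.val]; omega) rfl
  have hst' : ∀ M c v, Bounded (wordLength n) M → c < 32 → v ≤ 1 →
      Reach O T ω (wordLength n) (.store (arr c (.const 0)) (.const v)) M 1
        fun M' => M' = Function.update M c v := by
    intro M c v hM hc hv
    exact Reach.store hL hM (by simp only [arr, Expr.sz]; omega) (by simp [Expr.val]) rfl
      (by simp only [Expr.val]; omega) rfl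
  refine Reach.mono (N := 1 + (1 + (1 + (1 + (1 +
    (n * ((1 + ((unbalanced n s a).card * (5 + 2) + 2)) + 2) + 2)))))) ?_ (by omega)
    fun _ _ h => h
  refine Reach.seq (hst' M 20 0 hM (by norm_num) (by norm_num)) ?_
  rintro _ hM₁ rfl
  refine Reach.seq (hst' _ 21 1 hM₁ (by norm_num) (by norm_num)) ?_
  rintro _ hM₂ rfl
  refine Reach.seq (hst' _ 22 0 hM₂ (by norm_num) (by norm_num)) ?_
  rintro _ hM₃ rfl
  refine Reach.seq (hst' _ 23 0 hM₃ (by norm_num) (by norm_num)) ?_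
  rintro _ hM₄ rfl
  refine Reach.seq (hst _ 9 1 hM₄ (by norm_num) (by norm_num)) ?_
  rintro _ hM₅ rfl
  refine (Reach.forTo hL (by norm_num) (by decide) (fun i M' =>
    Same {7, 8, 9, 10, 20, 21, 22, 23} M M' ∧ ∃ m X, Records n a m X M' ∧
      ∀ Y, (∃ p < m, X p = Y) ↔ Y ∈ unbalanced n s a ∧ Y ⊆ Finset.range i)
    n _ (by omega) ?_ ?_ hM₅ ?_).mono le_rfl ?_
  · rintro i M' - ⟨h1, -⟩ -
    rw [var_val, h1.var (by norm_num) (by decide), h.n_eq]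
  · rintro i M' hi hM' ⟨h1, m, X, h2, h3⟩ h7
    refine (Reach.extendList hM' (h.of_same h1 (by decide)) ha
      (by rw [h1.var (by norm_num) (by decide), h6]) hi h7
      (by rw [h1.var (by norm_num) (by decide), h11]) h2 h3).mono le_rfl ?_
    rintro M'' - ⟨k1, m', X', k2, k3⟩
    exact ⟨by rw [k1.var (by norm_num) (by decide), h7],
      (h1.trans (k1.mono (by decide))).update (by simp) _, m', X',
      k2.of_same (S := {7}) ((Same.refl _ _).update (by simp) _) (by decide), k3⟩
  · refine ⟨?_, 1, fun _ => ∅, ⟨?_, ?_, ?_, ?_, ?_, ?_⟩, ?_⟩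
    · refine Same.update (Same.update (Same.update (Same.update (Same.update (Same.update
        (Same.refl _ _) ?_ _) ?_ _) ?_ _) ?_ _) ?_ _) ?_ _ <;> decide
    · intro p hp q hq _; omega
    · simp
    · intro p hp
      obtain rfl : p = 0 := by omega
      simp [binCode]
    · intro p hp
      obtain rfl : p = 0 := by omega
      simp
    · intro p hp
      obtain rfl : p = 0 := by omega
      simp
    · intro p hp
      obtain rfl : p = 0 := by omega
      simp
    · intro Y
      constructor
      · rintro ⟨p, -, rfl⟩
        exact ⟨empty_mem_unbalanced hs, Finset.empty_subset _⟩
      · rintro ⟨-, h'⟩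
        exact ⟨0, by omega, (Finset.subset_empty.1 (by simpa using h')).symm⟩
  · rintro M' - ⟨⟨h1, m, X, h2, h3⟩, -⟩
    refine ⟨h1, m, X, h2, fun Y => ?_⟩
    rw [h3]
    exact ⟨fun h' => ⟨h', (mem_unbalanced.1 h').1⟩, fun h' => h'.1⟩

end RAM

namespace RAM

variable {O : ℕ → Bool} {T : ℕ} {ω : ℕ → Bool} {n s : ℕ}

/-! ### Transforms over the list -/

/-- Array `24` receives the weights of the members of the family. -/
def queryList : Program :=
  forList (.seq (.query (arr 24 curSet) curSet)
    (.store (arr 24 curSet) (.times (get 24 curSet) (get 21 (var 8)))))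

/-- The oracle is called once per listed set, never on the whole power set, so the factor T
multiplies only the number of unbalanced sets. -/
theorem Reach.queryList {F D : Finset (Finset ℕ)} {m : ℕ} {X : ℕ → Finset ℕ} {M : Memory}
    (hM : Bounded (wordLength n) M) (hl : Listing D m X M)
    (hw : ∀ p < m, M (32 * p + 21) = weightBase n ^ (X p).card)
    (hD : ∀ Y ∈ D, Y ⊆ Finset.range n)
    (hO : ∀ Y ⊆ Finset.range n, (O (binCode Y)).toNat = if Y ∈ F then 1 else 0) :
    Reach O T ω (wordLength n) queryList M (m * (2 + 2) + 2) fun M' => Same {8, 24} M M' ∧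
      ∀ Y ∈ D, M' (32 * binCode Y + 24) = familyWeight F (weightBase n) Y := by
  have hL := one_le_wordLength n
  refine (Reach.forList hL (by norm_num) (by norm_num) (by norm_num) (by norm_num) hM hl
    (familyWeight F (weightBase n)) 2 ?_).mono le_rfl fun M' _ h => ⟨h.1, h.2.1⟩
  intro p hp M₁ hM₁ h1 h2 _ _
  have hpD : X p ∈ D := (hl.mem _).2 ⟨p, hp, rfl⟩
  have hc := curSet_val (hl.of_same h1 (by decide) (by decide)) hp h2
  refine Reach.seq (N₁ := 1) (N₂ := 1) (P := fun M' => M' =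
    Function.update M₁ (32 * binCode (X p) + 24) (if X p ∈ F then 1 else 0)) ?_ ?_
  · refine Reach.query hL hM₁ (by decide) (by rw [arr_val, hc]) ?_ rfl
    rw [hc, hO _ (hD _ hpD)]
  rintro _ hM₂ rfl
  have s1 : Same {8, 24} M (Function.update M₁ (32 * binCode (X p) + 24)
    (if X p ∈ F then 1 else 0)) := h1.update (by simp) _
  have e8 : Function.update M₁ (32 * binCode (X p) + 24) (if X p ∈ F then 1 else 0) 8 = p := by
    rw [Function.update_of_ne (by omega), h2]
  have hc' := curSet_val (hl.of_same s1 (by decide) (by decide)) hp e8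
  refine Reach.store hL hM₂ (v := familyWeight F (weightBase n) (X p)) (by decide)
    (by rw [arr_val, hc']) ?_ ?_ (Function.update_idem _ _ _)
  · simp only [Expr.val, get_val, hc', var_val, e8, Function.update_self,
      s1.arr p (c := 21) (by norm_num) (by decide), hw p hp, familyWeight]
    split_ifs <;> simp
  · refine lt_of_le_of_lt ?_ (weightBase_pow_lt n)
    have h3 : (X p).card ≤ n := by simpa using Finset.card_le_card (hD _ hpD)
    rw [familyWeight]
    split_ifs
    · exact Nat.pow_le_pow_right (one_le_weightBase n) h3
    · exact Nat.zero_le _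

/-- The entry of array `c` at the current set without the element `e`; `0` if the current set does
not contain `e`. -/
def eraseEntry (c : ℕ) (e : Expr) : Expr :=
  .times (rem (.quot curSet (get 29 e)) (.const 2)) (get c (.monus curSet (get 29 e)))

/-- If j ∉ Y the truncated difference addresses an irrelevant cell, but the binary digit j of the
code, which is 0, cancels its content. -/
theorem eraseEntry_val {c : ℕ} {e : Expr} {M : Memory} {Y : Finset ℕ} {j : ℕ}
    (hY : curSet.val M = binCode Y) (hj : M (32 * e.val M + 29) = 2 ^ j) :
    (eraseEntry c e).val M = if j ∈ Y then M (32 * binCode (Y.erase j) + c) else 0 := by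
  simp only [eraseEntry, Expr.val, rem_val, get_val, hY, hj, binCode_div_mod]
  split_ifs with h
  · rw [binCode_erase h, one_mul]
  · rw [zero_mul]

/-- The zeta transform of array `24`. -/
def zetaTransform : Program :=
  forTo 7 (var 0) (assignList 24 (.plus (get 24 curSet) (eraseEntry 24 (var 7))))

theorem Reach.zetaTransform {D : Finset (Finset ℕ)} {m : ℕ} {X : ℕ → Finset ℕ} {M : Memory}
    (hM : Bounded (wordLength n) M) (h : Env n s M) (hl : Listing D m X M)
    (hD' : ∀ Y ∈ D, ∀ Z ⊆ Y, Z ∈ D) (φ : Finset ℕ → ℕ)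
    (hφ : ∀ j, ∀ Y ∈ D, partialZeta j φ Y < 2 ^ wordLength n)
    (h0 : ∀ Y ∈ D, M (32 * binCode Y + 24) = φ Y) :
    Reach O T ω (wordLength n) zetaTransform M (n * (m * 3 + 4) + 2) fun M' =>
      Same {7, 8, 24} M M' ∧ ∀ Y ∈ D, M' (32 * binCode Y + 24) = partialZeta n φ Y := by
  have hL := one_le_wordLength n
  obtain ⟨hsm, hsm'⟩ := linear_lt n
  refine Reach.iterateAssignList hL (by norm_num) (by norm_num) (by norm_num) (by norm_num)
    (by norm_num) hM hl (fun j => partialZeta j φ) n (by omega) (by decide) (by decide) ?_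
    (fun j _ Y hY => hφ _ Y hY) (fun Y hY => by rw [h0 Y hY, partialZeta_zero]) ?_
  · intro M' h1
    rw [var_val, h1.var (by norm_num) (by decide), h.n_eq]
  · intro j hj p hp M' h1 h7 h8 hc h2 h3
    have hpD : X p ∈ D := (hl.mem _).2 ⟨p, hp, rfl⟩
    have h4 : M' (32 * (var 7).val M' + 29) = 2 ^ j := by
      rw [var_val, h7, h1.arr j (by norm_num) (by decide), h.pow j hj.le]
    simp only [Expr.val, get_val, hc, h2, eraseEntry_val hc h4, partialZeta_succ]
    split_ifs with hjX
    · rw [h3 _ (hD' _ hpD _ (Finset.erase_subset _ _))]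
      rw [partialZeta_succ, if_neg (by simp), add_zero]
    · rfl

/-- The inverse zeta transform of array `25`. -/
def moebiusTransform : Program :=
  forTo 7 (var 0) (assignList 25 (.monus (get 25 curSet)
    (eraseEntry 25 (.monus (.monus (var 0) (.const 1)) (var 7)))))

/-- The zeta steps are undone from j = n - 1 downwards. Truncation never occurs, since by
`partialZeta_succ` the minuend is a sum containing the subtrahend. -/
theorem Reach.moebiusTransform {D : Finset (Finset ℕ)} {m : ℕ} {X : ℕ → Finset ℕ} {M : Memory}
    (hM : Bounded (wordLength n) M) (h : Env n s M) (hl : Listing D m X M)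
    (hD' : ∀ Y ∈ D, ∀ Z ⊆ Y, Z ∈ D) (φ : Finset ℕ → ℕ)
    (hφ : ∀ j, ∀ Y ∈ D, partialZeta j φ Y < 2 ^ wordLength n)
    (h0 : ∀ Y ∈ D, M (32 * binCode Y + 25) = partialZeta n φ Y) :
    Reach O T ω (wordLength n) moebiusTransform M (n * (m * 3 + 4) + 2) fun M' =>
      Same {7, 8, 25} M M' ∧ ∀ Y ∈ D, M' (32 * binCode Y + 25) = φ Y := by
  have hL := one_le_wordLength n
  obtain ⟨hsm, hsm'⟩ := linear_lt n
  refine (Reach.iterateAssignList hL (by norm_num) (by norm_num) (by norm_num) (by norm_num)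
    (by norm_num) hM hl (fun j => partialZeta (n - j) φ) n (by omega) (by decide) (by decide) ?_
    (fun j _ Y hY => hφ _ Y hY) (fun Y hY => by rw [h0 Y hY, Nat.sub_zero]) ?_).mono le_rfl ?_
  · intro M' h1
    rw [var_val, h1.var (by norm_num) (by decide), h.n_eq]
  · intro j hj p hp M' h1 h7 h8 hc h2 h3
    have hpD : X p ∈ D := (hl.mem _).2 ⟨p, hp, rfl⟩
    have e1 : n - j = (n - 1 - j) + 1 := by omega
    have e2 : n - (j + 1) = n - 1 - j := by omega
    have h4 : M' (32 * (Expr.monus (.monus (var 0) (.const 1)) (var 7)).val M' + 29) =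
        2 ^ (n - 1 - j) := by
      simp only [Expr.val, var_val, h7, h1.var (c := 0) (by norm_num) (by decide), h.n_eq]
      rw [h1.arr _ (by norm_num) (by decide), h.pow _ (by omega)]
    have h5 : (Expr.monus (get 25 curSet)
        (eraseEntry 25 (.monus (.monus (var 0) (.const 1)) (var 7)))).val M' =
        M' (32 * curSet.val M' + 25) -
          (eraseEntry 25 (.monus (.monus (var 0) (.const 1)) (var 7))).val M' := rfl
    rw [h5, hc, h2, eraseEntry_val hc h4]
    simp only [e1, e2, partialZeta_succ] at h3 ⊢
    split_ifs with hjX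
    · rw [h3 _ (hD' _ hpD _ (Finset.erase_subset _ _)) (by simp), if_neg (by simp)]
      omega
    · omega
  · rintro M' - ⟨h1, h2⟩
    refine ⟨h1, fun Y hY => ?_⟩
    rw [h2 Y hY, Nat.sub_self, partialZeta_zero]

/-- Array `25` receives the powers of the entries of array `24`. -/
def powerList (e : Expr) : Program :=
  .seq (assignList 25 (.const 1))
    (forTo 7 e (assignList 25 (.times (get 25 curSet) (get 24 curSet))))

theorem Reach.powerList {D : Finset (Finset ℕ)} {m : ℕ} {X : ℕ → Finset ℕ} {M : Memory}
    (hM : Bounded (wordLength n) M) (hl : Listing D m X M) (g : Finset ℕ → ℕ)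
    (hg : ∀ Y ∈ D, g Y ≤ 2 ^ n * weightBase n ^ n) {k : ℕ} (hk : k ≤ n) {e : Expr}
    (hsz : e.sz ≤ 2000) (he : ∀ M', Same {7, 8, 25} M M' → e.val M' = k)
    (h0 : ∀ Y ∈ D, M (32 * binCode Y + 24) = g Y) :
    Reach O T ω (wordLength n) (powerList e) M ((m * 3 + 2) + (k * (m * 3 + 4) + 2)) fun M' =>
      Same {7, 8, 25} M M' ∧ ∀ Y ∈ D, M' (32 * binCode Y + 25) = g Y ^ k := by
  have hL := one_le_wordLength n
  obtain ⟨hsm, hsm'⟩ := linear_lt n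
  have hpos : 0 < 2 ^ n * weightBase n ^ n :=
    Nat.mul_pos (by positivity) (Nat.pow_pos (one_le_weightBase n))
  have hgk : ∀ i ≤ k, ∀ Y ∈ D, g Y ^ i < 2 ^ wordLength n := fun i hi Y hY =>
    ((Nat.pow_le_pow_left (hg Y hY) i).trans (Nat.pow_le_pow_right hpos (hi.trans hk))).trans_lt
      (total_weight_lt n)
  refine Reach.seq (Reach.assignList hL (by norm_num) (by norm_num) (by norm_num) (by norm_num)
    hM hl (fun _ => 1) (by decide) (fun Y hY => by omega) ?_) ?_
  · intros; rfl
  rintro M₁ hM₁ ⟨h1, h2, -⟩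
  have s1 : Same {7, 8, 25} M M₁ := h1.mono (by decide)
  refine (Reach.iterateAssignList hL (by norm_num) (by norm_num) (by norm_num) (by norm_num)
    (by norm_num) hM₁ (hl.of_same h1 (by decide) (by decide)) (fun i Y => g Y ^ i) k (by omega)
    hsz (by decide) (fun M' h => he M' (s1.trans h)) (fun i hi Y hY => hgk _ hi Y hY)
    (fun Y hY => by rw [h2 Y hY, pow_zero]) ?_).mono le_rfl
    fun M' _ h => ⟨s1.trans h.1, h.2⟩
  intro i hi p hp M' h3 h7 h8 hc h4 _
  have hpD : X p ∈ D := (hl.mem _).2 ⟨p, hp, rfl⟩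
  simp only [Expr.val, get_val, hc, h4, h3.arr _ (c := 24) (by norm_num) (by decide),
    h1.arr _ (c := 24) (by norm_num) (by decide), h0 _ hpD, pow_succ]

/-! ### Recognition of the partitions into a given number of sets -/

/-- Nonzero entries of array `c` occur only at sets that are partitions into `k` members of `F`. -/
def Sound (F : Finset (Finset ℕ)) (n k c : ℕ) (M : Memory) : Prop :=
  ∀ Y ⊆ Finset.range n, M (32 * binCode Y + c) ≠ 0 → IsPartition F k Y

theorem Sound.of_same {F : Finset (Finset ℕ)} {k c : ℕ} {M M' : Memory} (h : Sound F n k c M)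
    {S : Finset ℕ} (hs : Same S M M') (hc : c < 32) (hS : c ∉ S) : Sound F n k c M' := by
  intro Y hY h'
  rw [hs.arr _ hc hS] at h'
  exact h Y hY h'

/-- Array `c` receives the numbers of partitions of the sets of the list into as many sets as `e`
tells. -/
def countPartitions (c : ℕ) (e : Expr) : Program :=
  .seq (powerList e) (.seq moebiusTransform
    (assignList c (rem (.quot (get 25 curSet) (get 21 (var 8))) (var 3))))

theorem Reach.countPartitions {F D : Finset (Finset ℕ)} {m : ℕ} {X : ℕ → Finset ℕ} {M : Memory}
    (hM : Bounded (wordLength n) M) (h : Env n s M) (hl : Listing D m X M)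
    (hw : ∀ p < m, M (32 * p + 21) = weightBase n ^ (X p).card)
    (hF : F ⊆ (Finset.range n).powerset)
    (hD : ∀ Y ∈ D, Y ⊆ Finset.range n) (hD' : ∀ Y ∈ D, ∀ Z ⊆ Y, Z ∈ D)
    (h24 : ∀ Y ∈ D, M (32 * binCode Y + 24) =
      partialZeta n (familyWeight F (weightBase n)) Y)
    {k c : ℕ} (hk : k ≤ n) {e : Expr} (hsz : e.sz ≤ 2000)
    (he : ∀ M', Same {7, 8, 25} M M' → e.val M' = k) (hc : c = 26 ∨ c = 27)
    (hsound : Sound F n k c M) :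
    Reach O T ω (wordLength n) (countPartitions c e) M
      (((m * 3 + 2) + (k * (m * 3 + 4) + 2)) + ((n * (m * 3 + 4) + 2) + (m * 3 + 2)))
      fun M' => Same {7, 8, 25, c} M M' ∧ Sound F n k c M' ∧
        ∀ Y ∈ D, IsPartition F k Y → M' (32 * binCode Y + c) ≠ 0 := by
  have hL := one_le_wordLength n
  have hc7 : c ≠ 7 := by omega
  have hc8 : c ≠ 8 := by omega
  have hc25 : c ≠ 25 := by omega
  -- There are at most 2^n sets and k ≤ n, so the base exceeds any possible number of tuples and no
  -- digit overflows.
  have hB : F.card ^ k < weightBase n := by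
    have h1 : F.card ≤ 2 ^ n := by simpa using Finset.card_le_card hF
    have h2 : F.card ^ k ≤ (2 ^ n) ^ n :=
      (Nat.pow_le_pow_left h1 k).trans (Nat.pow_le_pow_right (by positivity) hk)
    have h3 : 0 < (2 ^ n) ^ n := by positivity
    rw [weightBase]
    omega
  have hsub : ({7, 8, 25} : Finset ℕ) ⊆ {7, 8, 25, c} := by
    intro x hx; simp at hx ⊢; tauto
  refine Reach.seq (Reach.powerList hM hl _ (fun Y hY =>
    partialZeta_familyWeight_le (one_le_weightBase n) hF (hD Y hY)) hk hsz he h24) ?_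
  rintro M₁ hM₁ ⟨h1, h2⟩
  refine Reach.seq (Reach.moebiusTransform hM₁ (h.of_same h1 (by decide))
    (hl.of_same h1 (by decide) (by decide)) hD' (coverWeight F (weightBase n) k)
    (fun j Y hY => (partialZeta_coverWeight_le (one_le_weightBase n) hF hk (hD Y hY)).trans_lt
      (total_weight_lt n))
    (fun Y hY => by rw [h2 Y hY, partialZeta_coverWeight F _ k (hD Y hY)])) ?_
  rintro M₂ hM₂ ⟨h3, h4⟩
  have s2 := h1.trans h3
  refine (Reach.assignList hL (by omega) hc8 (by omega) (by omega) hM₂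
    (hl.of_same s2 (by decide) (by decide))
    (fun Y => coverWeight F (weightBase n) k Y / weightBase n ^ Y.card % weightBase n)
    (by decide) (fun Y _ => (Nat.mod_lt _ (one_le_weightBase n)).trans (weightBase_lt n))
    ?_).mono le_rfl ?_
  · intro p hp M' h5 h8 hcur _ _
    have hpD : X p ∈ D := (hl.mem _).2 ⟨p, hp, rfl⟩
    have n25 : 25 ∉ ({8, c} : Finset ℕ) := by simp; omega
    have n21 : 21 ∉ ({8, c} : Finset ℕ) := by simp; omega
    have n3 : 3 ∉ ({8, c} : Finset ℕ) := by simp; omega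
    simp only [rem_val, Expr.val, get_val, var_val, hcur, h8, h5.arr _ (c := 25) (by norm_num) n25,
      h5.arr _ (c := 21) (by norm_num) n21, h5.var (c := 3) (by norm_num) n3, h4 _ hpD,
      s2.arr p (c := 21) (by norm_num) (by decide), s2.var (c := 3) (by norm_num) (by decide),
      hw p hp, h.base]
  · rintro M' - ⟨h5, h6, h7⟩
    refine ⟨(s2.mono hsub).trans (h5.mono (by intro x hx; simp at hx ⊢; tauto)), ?_, ?_⟩
    · intro Y hY hne
      by_cases hYD : Y ∈ D
      · rw [h6 Y hYD] at hne
        exact (coverWeight_div_mod hB Y).1 hne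
      -- Off the list the array keeps an entry from before this round; clearing it would take time
      -- 2^n, so its correctness is carried along instead.
      · rw [h7 _ (fun Z hZ hYZ => hYD (by rwa [binCode_injective hYZ])),
          s2.arr _ (by omega) (by simp; omega)] at hne
        exact hsound Y hY hne
    · intro Y hY hp
      rw [h6 Y hY]
      exact (coverWeight_div_mod hB Y).2 hp

/-- Variable `12` is set to `1` if some set of the list and its complement are recognized. -/
def checkList : Program :=
  forTo 8 (var 9) (.store (.const 12) (sign (.plus (var 12) (.times (get 26 curSet)
    (get 27 (.monus (.monus (get 29 (var 0)) (.const 1)) curSet))))))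

theorem Reach.checkList {D : Finset (Finset ℕ)} {m : ℕ} {X : ℕ → Finset ℕ} {M : Memory}
    (hM : Bounded (wordLength n) M) (h : Env n s M) (hl : Listing D m X M)
    (hD : ∀ Y ∈ D, Y ⊆ Finset.range n) :
    Reach O T ω (wordLength n) checkList M (m * (1 + 2) + 2) fun M' => Same {8, 12} M M' ∧
      (M' 12 ≠ 0 ↔ M 12 ≠ 0 ∨ ∃ Y ∈ D, M (32 * binCode Y + 26) ≠ 0 ∧
        M (32 * binCode (Finset.range n \ Y) + 27) ≠ 0) := by
  have hL := one_le_wordLength n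
  obtain ⟨hsm, hsm'⟩ := linear_lt n
  refine (Reach.forTo (t := 1) hL (by norm_num) (by decide) (fun i M' => Same {8, 12} M M' ∧
    (M' 12 ≠ 0 ↔ M 12 ≠ 0 ∨ ∃ p < i, M (32 * binCode (X p) + 26) ≠ 0 ∧
        M (32 * binCode (Finset.range n \ X p) + 27) ≠ 0)) m ?_ ?_ ?_ hM ?_).mono le_rfl ?_
  · rw [← hl.len]; exact hM 9
  · rintro i M' - ⟨h1, -⟩ -
    rw [var_val, h1.var (by norm_num) (by decide), hl.len]
  · rintro i M' hi hM' ⟨h1, h2⟩ h8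
    have hiD : X i ∈ D := (hl.mem _).2 ⟨i, hi, rfl⟩
    have hc := curSet_val (hl.of_same h1 (by decide) (by decide)) hi h8
    have h29 : M' (32 * n + 29) = 2 ^ n := by
      rw [h1.arr _ (by norm_num) (by decide), h.pow n le_rfl]
    have hv : (sign (.plus (var 12) (.times (get 26 curSet)
        (get 27 (.monus (.monus (get 29 (var 0)) (.const 1)) curSet))))).val M' =
        if M' 12 + M (32 * binCode (X i) + 26) *
          M (32 * binCode (Finset.range n \ X i) + 27) = 0 then 0 else 1 := by
      simp only [sign_val, Expr.val, var_val, get_val, hc,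
        h1.var (c := 0) (by norm_num) (by decide), h.n_eq, h29, ← binCode_compl (hD _ hiD),
        h1.arr _ (c := 26) (by norm_num) (by decide), h1.arr _ (c := 27) (by norm_num) (by decide)]
    refine Reach.store (x := 12) hL hM' (by decide) rfl hv ?_ ⟨?_, ?_, ?_⟩
    · split_ifs <;> omega
    · rw [Function.update_of_ne (by omega), h8]
    · exact (h1.update (by simp) _).update (by simp) _
    · rw [Function.update_of_ne (by omega), Function.update_self]
      have e1 : (∃ p < i + 1, M (32 * binCode (X p) + 26) ≠ 0 ∧
          M (32 * binCode (Finset.range n \ X p) + 27) ≠ 0) ↔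
          (∃ p < i, M (32 * binCode (X p) + 26) ≠ 0 ∧
            M (32 * binCode (Finset.range n \ X p) + 27) ≠ 0) ∨
          (M (32 * binCode (X i) + 26) ≠ 0 ∧
            M (32 * binCode (Finset.range n \ X i) + 27) ≠ 0) := by
        constructor
        · rintro ⟨q, hq, e⟩
          rcases Nat.lt_succ_iff_lt_or_eq.1 hq with h' | rfl
          · exact Or.inl ⟨q, h', e⟩
          · exact Or.inr e
        · rintro (⟨q, hq, e⟩ | e)
          · exact ⟨q, by omega, e⟩
          · exact ⟨i, by omega, e⟩
      rw [e1, ← or_assoc, ← h2, ← mul_ne_zero_iff]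
      split_ifs with h' <;> omega
  · refine ⟨(Same.refl _ _).update (by simp) _, ?_⟩
    rw [Function.update_of_ne (by omega)]
    simp
  · rintro M' - ⟨⟨h1, h2⟩, -⟩
    refine ⟨h1, h2.trans (or_congr Iff.rfl ?_)⟩
    constructor
    · rintro ⟨p, hp, e⟩
      exact ⟨X p, (hl.mem _).2 ⟨p, hp, rfl⟩, e⟩
    · rintro ⟨Y, hY, e⟩
      obtain ⟨p, hp, rfl⟩ := (hl.mem Y).1 hY
      exact ⟨p, hp, e⟩

/-! ### The algorithm -/

/-- The search for a partition that is split by the current Walsh function. -/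
def searchRound : Program :=
  .seq countWalsh (.seq buildList (.seq queryList (.seq zetaTransform
    (.seq (countPartitions 26 (.quot (var 1) (.const 2)))
      (.seq (countPartitions 27 (.monus (var 1) (.quot (var 1) (.const 2)))) checkList)))))

/-- The results that are known so far are correct. -/
structure Correct (F : Finset (Finset ℕ)) (n s : ℕ) (M : Memory) : Prop where
  left : Sound F n (s / 2) 26 M
  right : Sound F n (s - s / 2) 27 M
  out : M 12 ≠ 0 → IsPartition F s (Finset.range n)

/-- There is a partition that is split by the `a`-th Walsh function. -/
def SplitBy (F : Finset (Finset ℕ)) (n s a : ℕ) : Prop :=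
  ∃ W ∈ unbalanced n s a, Finset.range n \ W ∈ unbalanced n s a ∧
    IsPartition F (s / 2) W ∧ IsPartition F (s - s / 2) (Finset.range n \ W)

theorem Reach.searchRound {F : Finset (Finset ℕ)} {M : Memory} (hM : Bounded (wordLength n) M)
    (h : Env n s M) (hs : s ≤ n) (hF : F ⊆ (Finset.range n).powerset)
    (hO : ∀ Y ⊆ Finset.range n, (O (binCode Y)).toNat = if Y ∈ F then 1 else 0) {a : ℕ}
    (ha : a < 2 ^ Nat.clog 2 n) (h6 : M 6 = a) (hc : Correct F n s M) :
    Reach O T ω (wordLength n) searchRound M (60 * (n + 1) * ((unbalanced n s a).card + 1))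
      fun M' => Same {7, 8, 9, 10, 11, 12, 20, 21, 22, 23, 24, 25, 26, 27} M M' ∧
        Correct F n s M' ∧ (M 12 ≠ 0 ∨ SplitBy F n s a → M' 12 ≠ 0) := by
  set D := unbalanced n s a with hDdef
  have hD : ∀ Y ∈ D, Y ⊆ Finset.range n := fun Y hY => (mem_unbalanced.1 hY).1
  have hD' : ∀ Y ∈ D, ∀ Z ⊆ Y, Z ∈ D := fun Y hY Z hZ => unbalanced_mono hY hZ
  have hk1 : s / 2 ≤ n := by omega
  have hk2 : s - s / 2 ≤ n := by omega
  have hk : s / 2 + (s - s / 2) = s := by omega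
  set d := D.card with hd
  refine Reach.mono (N := (1 + (n * (1 + 2) + 2)) + ((5 + (n * ((1 + (d * (5 + 2) + 2)) + 2) + 2)) +
    ((d * (2 + 2) + 2) + ((n * (d * 3 + 4) + 2) +
    ((((d * 3 + 2) + (s / 2 * (d * 3 + 4) + 2)) + ((n * (d * 3 + 4) + 2) + (d * 3 + 2))) +
    ((((d * 3 + 2) + ((s - s / 2) * (d * 3 + 4) + 2)) + ((n * (d * 3 + 4) + 2) + (d * 3 + 2))) +
      (d * (1 + 2) + 2))))))) ?_ ?_ fun _ _ h => h
  · refine Reach.seq (Reach.countWalsh hM h ha h6) fun M₁ hM₁ ⟨p1, q1⟩ => ?_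
    refine Reach.seq (Reach.buildList hM₁ (h.of_same p1 (by decide)) hs ha
      (by rw [p1.var (by norm_num) (by decide), h6]) q1) fun M₂ hM₂ ⟨p2, m, X, hr, hX⟩ => ?_
    have hl₂ : Listing D m X M₂ := ⟨hr.inj, hX, hr.len, hr.code⟩
    have hmd : m = d := hl₂.card_eq.symm
    rw [hmd] at hl₂ hr
    have t2 : Same {7, 8, 9, 10, 11, 20, 21, 22, 23} M M₂ :=
      (p1.mono (by decide)).trans (p2.mono (by decide))
    refine Reach.seq (Reach.queryList hM₂ hl₂ hr.weight hD hO) fun M₃ hM₃ ⟨p3, q3⟩ => ?_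
    have t3 : Same {7, 8, 9, 10, 11, 20, 21, 22, 23, 24} M M₃ :=
      (t2.mono (by decide)).trans (p3.mono (by decide))
    have hl₃ := hl₂.of_same p3 (by decide) (by decide)
    refine Reach.seq (Reach.zetaTransform hM₃ (h.of_same t3 (by decide)) hl₃ hD' _
      (fun j Y hY => (partialZeta_familyWeight_le (one_le_weightBase n) hF (hD Y hY)).trans_lt
        (weight_lt n)) q3) fun M₄ hM₄ ⟨p4, q4⟩ => ?_
    have t4 : Same {7, 8, 9, 10, 11, 20, 21, 22, 23, 24} M M₄ := t3.trans (p4.mono (by decide))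
    have hl₄ := hl₃.of_same p4 (by decide) (by decide)
    have h₄ := h.of_same t4 (by decide)
    have w4 : ∀ p < d, M₄ (32 * p + 21) = weightBase n ^ (X p).card := fun p hp => by
      rw [p4.arr p (by norm_num) (by decide), p3.arr p (by norm_num) (by decide), hr.weight p hp]
    refine Reach.seq (Reach.countPartitions hM₄ h₄ hl₄ w4 hF hD hD' q4 hk1 (by decide)
      (fun M' h' => by
        simp only [Expr.val, var_val, h'.var (c := 1) (by norm_num) (by decide), h₄.s_eq])
      (Or.inl rfl) (hc.left.of_same t4 (by norm_num) (by decide))) fun M₅ hM₅ ⟨p5, q5, r5⟩ => ?_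
    have t5 : Same {7, 8, 9, 10, 11, 20, 21, 22, 23, 24, 25, 26} M M₅ :=
      (t4.mono (by decide)).trans (p5.mono (by decide))
    have h₅ := h.of_same t5 (by decide)
    have hl₅ := hl₄.of_same p5 (by decide) (by decide)
    refine Reach.seq (Reach.countPartitions hM₅ h₅ hl₅
      (fun p hp => by rw [p5.arr p (by norm_num) (by decide), w4 p hp]) hF hD hD'
      (fun Y hY => by rw [p5.arr _ (by norm_num) (by decide), q4 Y hY]) hk2 (by decide)
      (fun M' h' => by
        simp only [Expr.val, var_val, h'.var (c := 1) (by norm_num) (by decide), h₅.s_eq])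
      (Or.inr rfl) (hc.right.of_same t5 (by norm_num) (by decide))) fun M₆ hM₆ ⟨p6, q6, r6⟩ => ?_
    have t6 : Same {7, 8, 9, 10, 11, 20, 21, 22, 23, 24, 25, 26, 27} M M₆ :=
      (t5.mono (by decide)).trans (p6.mono (by decide))
    have q5' := q5.of_same p6 (by norm_num) (by decide)
    refine (Reach.checkList hM₆ (h.of_same t6 (by decide))
      (hl₅.of_same p6 (by decide) (by decide)) hD).mono le_rfl ?_
    rintro M' - ⟨p7, q7⟩
    refine ⟨(t6.mono (by decide)).trans (p7.mono (by decide)),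
      ⟨q5'.of_same p7 (by norm_num) (by decide), q6.of_same p7 (by norm_num) (by decide), ?_⟩, ?_⟩
    · intro hne
      rcases q7.1 hne with h' | ⟨Y, hY, e1, e2⟩
      · rw [t6.var (by norm_num) (by decide)] at h'
        exact hc.out h'
      · have k1 := q5' Y (hD Y hY) e1
        -- The complement need not be on the current list. Its entry may stem from an earlier round,
        -- yet it still certifies a partition.
        have k2 := q6 _ Finset.sdiff_subset e2
        have := k1.union k2 Finset.disjoint_sdiff
        rwa [Finset.union_sdiff_of_subset (hD Y hY), hk] at this
    · rintro (h' | ⟨W, hW, hW', k1, k2⟩)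
      · refine q7.2 (Or.inl ?_)
        rwa [t6.var (by norm_num) (by decide)]
      · refine q7.2 (Or.inr ⟨W, hW, ?_, r6 _ hW' k2⟩)
        rw [p6.arr _ (by norm_num) (by decide)]
        exact r5 W hW k1
  · have e1 : s / 2 * (d * 3 + 4) + (s - s / 2) * (d * 3 + 4) ≤ n * (d * 3 + 4) := by
      rw [← Nat.add_mul]
      exact Nat.mul_le_mul_right _ (by omega)
    nlinarith

/-- The algorithm for the set partition problem. -/
def setPartitionProgram : Program :=
  .seq initAll (.seq (forTo 6 (var 4) searchRound) (.store (.const 0) (sign (var 12))))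

theorem Reach.setPartitionProgram {F : Finset (Finset ℕ)} (hs : s ≤ n)
    (hF : F ⊆ (Finset.range n).powerset)
    (hO : ∀ Y ⊆ Finset.range n, (O (binCode Y)).toNat = if Y ∈ F then 1 else 0) {d : ℕ}
    (hd : ∀ a, (unbalanced n s a).card ≤ d) :
    Reach O T ω (wordLength n) setPartitionProgram (start n s).mem
      (200 * (n + 1) ^ 2 * (d + 1)) fun M' =>
        (M' 0 = 1 → IsPartition F s (Finset.range n)) ∧
        ((∃ a < 2 ^ Nat.clog 2 n, SplitBy F n s a) → M' 0 = 1) := by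
  have hL := one_le_wordLength n
  obtain ⟨hsm, hsm'⟩ := linear_lt n
  have hN := two_pow_clog_le n
  have hM : Bounded (wordLength n) (start n s).mem := by
    intro a
    simp only [start]
    split_ifs <;> omega
  have hz : ∀ a, 2 ≤ a → (start n s).mem a = 0 := by
    intro a ha
    simp only [start]
    rw [if_neg (by omega), if_neg (by omega)]
  refine Reach.mono (N := 30 * (n + 1) ^ 2 +
    ((2 ^ Nat.clog 2 n * (60 * (n + 1) * (d + 1) + 2) + 2) + 1)) ?_ ?_ fun _ _ h => h
  · refine Reach.seq (Reach.initAll (s := s) hM rfl rfl (hz _ (by norm_num)))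
      fun M₁ hM₁ ⟨p1, h₁⟩ => ?_
    -- Both result arrays are still zero, so their soundness is vacuous.
    have hsound : ∀ k c, c < 32 → 2 ≤ c → c ∉ ({3, 4, 7, 28, 29} : Finset ℕ) →
        Sound F n k c M₁ := by
      intro k c hc hc2 hcS Y _ hne
      rw [p1.arr _ hc hcS, hz _ (by omega)] at hne
      exact absurd rfl hne
    have hcor : Correct F n s M₁ := by
      refine ⟨hsound _ _ (by norm_num) (by norm_num) (by decide),
        hsound _ _ (by norm_num) (by norm_num) (by decide), fun hne => ?_⟩
      rw [p1.var (by norm_num) (by decide), hz _ (by norm_num)] at hne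
      exact absurd rfl hne
    have hco : ∀ M M' : Memory, Correct F n s M → Same {6} M M' → Correct F n s M' := by
      intro M M' hc hsm
      refine ⟨hc.left.of_same hsm (by norm_num) (by decide),
        hc.right.of_same hsm (by norm_num) (by decide), fun hne => hc.out ?_⟩
      rwa [hsm.var (by norm_num) (by decide)] at hne
    refine Reach.seq (Reach.forTo (t := 60 * (n + 1) * (d + 1)) hL (by norm_num) (by decide)
      (fun i M' => Env n s M' ∧ Correct F n s M' ∧ ((∃ a < i, SplitBy F n s a) → M' 12 ≠ 0))
      (2 ^ Nat.clog 2 n) (by omega) ?_ ?_ hM₁ ?_) ?_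
    · rintro i M' - ⟨h', -⟩ -
      rw [var_val, h'.count]
    · rintro i M' hi hM' ⟨h', hc', hsp⟩ h6
      refine (Reach.searchRound hM' h' hs hF hO hi h6 hc').mono
        (Nat.mul_le_mul_left _ (Nat.succ_le_succ (hd i))) ?_
      rintro M'' - ⟨p2, hc'', hout⟩
      have s6 : Same {6} M'' (Function.update M'' 6 (i + 1)) := (Same.refl _ _).update (by simp) _
      refine ⟨by rw [p2.var (by norm_num) (by decide), h6],
        (h'.of_same p2 (by decide)).of_same s6 (by decide), hco _ _ hc'' s6, ?_⟩
      rintro ⟨b, hb, hsb⟩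
      rw [Function.update_of_ne (by omega)]
      refine hout ?_
      rcases Nat.lt_succ_iff_lt_or_eq.1 hb with hb' | rfl
      · exact Or.inl (hsp ⟨b, hb', hsb⟩)
      · exact Or.inr hsb
    · have s6 : Same {6} M₁ (Function.update M₁ 6 0) := (Same.refl _ _).update (by simp) _
      refine ⟨h₁.of_same s6 (by decide), hco _ _ hcor s6, ?_⟩
      rintro ⟨b, hb, -⟩
      omega
    · rintro M₂ hM₂ ⟨⟨-, hc, hsp⟩, -⟩
      refine Reach.store hL hM₂ (by decide) rfl (sign_val (var 12) M₂) ?_ ⟨?_, ?_⟩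
      · split_ifs <;> omega
      · intro h'
        refine hc.out fun h12 => ?_
        simp [Expr.val, h12] at h'
      · intro h'
        simp [Expr.val, hsp h']
  · have e1 : 2 ^ Nat.clog 2 n * (60 * (n + 1) * (d + 1) + 2) ≤
        (2 * (n + 1)) * (60 * (n + 1) * (d + 1) + 2) := Nat.mul_le_mul_right _ (by omega)
    have e2 : 0 ≤ n * d := Nat.zero_le _
    have e3 : 0 ≤ n ^ 2 * d := Nat.zero_le _
    nlinarith

end RAM

/-! ### Set partitions of a bipartite graph -/

namespace FamilyGraph

variable {m n : ℕ}

/-- The neighbourhood of `f`, as a set of numbers. -/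
def natNbr (G : FamilyGraph m n) (f : Fin m) : Finset ℕ := (G.nbr f).map Fin.valEmbedding

/-- The family of all neighbourhoods. -/
def family (G : FamilyGraph m n) : Finset (Finset ℕ) := Finset.univ.image G.natNbr

theorem natNbr_subset (G : FamilyGraph m n) (f : Fin m) : G.natNbr f ⊆ Finset.range n := by
  intro u hu
  obtain ⟨v, -, rfl⟩ := Finset.mem_map.1 hu
  exact Finset.mem_range.2 v.2

theorem card_natNbr (G : FamilyGraph m n) (f : Fin m) : (G.natNbr f).card = (G.nbr f).card :=
  Finset.card_map _

theorem natNbr_mem_family (G : FamilyGraph m n) (f : Fin m) : G.natNbr f ∈ G.family :=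
  Finset.mem_image_of_mem _ (Finset.mem_univ f)

theorem family_subset (G : FamilyGraph m n) : G.family ⊆ (Finset.range n).powerset := by
  intro X hX
  obtain ⟨f, -, rfl⟩ := Finset.mem_image.1 hX
  exact Finset.mem_powerset.2 (G.natNbr_subset f)

theorem binCode_natNbr (G : FamilyGraph m n) (f : Fin m) :
    binCode (G.natNbr f) = subsetCode (G.nbr f) := by
  rw [binCode, natNbr, Finset.sum_map]
  rfl

theorem oracle_binCode (G : FamilyGraph m n) (Y : Finset ℕ) :
    (G.oracle (binCode Y)).toNat = if Y ∈ G.family then 1 else 0 := by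
  have h : (∃ f, subsetCode (G.nbr f) = binCode Y) ↔ Y ∈ G.family := by
    simp only [← binCode_natNbr, binCode_injective.eq_iff, family, Finset.mem_image,
      Finset.mem_univ, true_and]
  rw [oracle]
  by_cases hY : Y ∈ G.family
  · simp [hY, h.2 hY]
  · rw [if_neg hY, decide_eq_false (mt h.1 hY)]
    rfl

/-- A tuple of sets may repeat only the empty set. Nonempty neighbourhoods therefore make the chosen
vertices distinct, so that exactly s of them are used. -/
theorem hasSetPartition_iff (G : FamilyGraph m n) (hne : ∀ f, 0 < (G.nbr f).card) (s : ℕ) :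
    G.HasSetPartition s ↔ IsPartition G.family s (Finset.range n) := by
  classical
  constructor
  · rintro ⟨S, h1, h2, h3⟩
    have h4 : S.biUnion G.natNbr = Finset.range n := by
      ext u
      simp only [Finset.mem_biUnion, natNbr, Finset.mem_map, Finset.mem_range]
      constructor
      · rintro ⟨f, -, v, -, rfl⟩
        exact v.2
      · intro hu
        have := Finset.mem_univ (⟨u, hu⟩ : Fin n)
        rw [← h1, Finset.mem_biUnion] at this
        obtain ⟨f, hf, hv⟩ := this
        exact ⟨f, hf, _, hv, rfl⟩
    rw [← h4, ← h2]
    refine IsPartition.of_finset S G.natNbr (fun f _ => G.natNbr_mem_family f)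
      fun f hf g hg hfg => ?_
    rw [natNbr, natNbr, Finset.disjoint_map, Finset.disjoint_iff_inter_eq_empty]
    exact h3 f hf g hg hfg
  · rintro ⟨t, h1, h2, h3⟩
    have h4 : ∀ i, ∃ f, G.natNbr f = t i := fun i => by
      obtain ⟨f, -, hf⟩ := Finset.mem_image.1 (h1 i)
      exact ⟨f, hf⟩
    choose f hf using h4
    have hd : ∀ i j, i ≠ j → G.nbr (f i) ∩ G.nbr (f j) = ∅ := by
      intro i j hij
      have := disjoint_of_sum_card (h3.trans (congrArg _ h2.symm)) (Finset.mem_univ i)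
        (Finset.mem_univ j) hij
      rw [← hf i, ← hf j, natNbr, natNbr, Finset.disjoint_map,
        Finset.disjoint_iff_inter_eq_empty] at this
      exact this
    have hinj : Function.Injective f := by
      intro i j hij
      by_contra hne'
      have h5 := hd i j hne'
      rw [hij, Finset.inter_self] at h5
      have := hne (f j)
      rw [h5] at this
      simp at this
    refine ⟨Finset.univ.image f, ?_, ?_, ?_⟩
    · ext u
      simp only [Finset.mem_biUnion, Finset.mem_image, Finset.mem_univ, true_and, iff_true]
      have hu : (u : ℕ) ∈ Finset.range n := Finset.mem_range.2 u.2
      rw [← h2, Finset.mem_biUnion] at hu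
      obtain ⟨i, -, hi⟩ := hu
      rw [← hf i, natNbr, Finset.mem_map] at hi
      obtain ⟨v, hv, hvu⟩ := hi
      rw [Fin.valEmbedding_apply, Fin.val_inj] at hvu
      exact ⟨f i, ⟨i, rfl⟩, hvu ▸ hv⟩
    · rw [Finset.card_image_of_injective _ hinj, Finset.card_univ, Fintype.card_fin]
    · intro a ha b hb hab
      obtain ⟨i, -, rfl⟩ := Finset.mem_image.1 ha
      obtain ⟨j, -, rfl⟩ := Finset.mem_image.1 hb
      exact hd i j fun h => hab (congrArg f h)

end FamilyGraph

/-! ### The main theorem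

The algorithm tosses no coins. For each of at most `2 n + 1` Walsh functions it computes, by ranked
zeta transforms over the unbalanced sets only, which of these sets are partitions into `s / 2` or
`s - s / 2` members of the family. Averaging over the Walsh functions shows that every set partition
with small members can be cut into two unbalanced halves, for a suitable Walsh function. -/

/-- The Chernoff exponent is σ²n/2048; replacing σ² by σ^4 and e by 2 only weakens the bound. For n
> 0 the sign of σ follows from s ≥ 0, whereas n = 0 leaves σ free and is treated separately. -/
theorem card_unbalanced_le_rpow {n s a : ℕ} {σ : ℝ} (hs : (s : ℝ) = σ * n) (hσ : σ ≤ 1) :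
    1 ≤ (2 : ℝ) ^ ((1 - 1 / 2048 * σ ^ 4) * (n : ℝ)) ∧
    ((unbalanced n s a).card : ℝ) ≤ 2 * (2 : ℝ) ^ ((1 - 1 / 2048 * σ ^ 4) * (n : ℝ)) := by
  rcases Nat.eq_zero_or_pos n with rfl | hn
  · have := RAM.card_unbalanced_le_two_pow 0 s a
    have h1 : ((unbalanced 0 s a).card : ℝ) ≤ 1 := by exact_mod_cast this
    simp
    linarith
  · have hn' : (0 : ℝ) < n := by exact_mod_cast hn
    have hσ0 : 0 ≤ σ := by
      by_contra h
      have h1 : σ * n < 0 := mul_neg_of_neg_of_pos (not_le.1 h) hn'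
      have h2 : (0 : ℝ) ≤ s := Nat.cast_nonneg s
      linarith
    have h2 : σ ^ 2 ≤ 1 := pow_le_one₀ hσ0 hσ
    have h4 : σ ^ 4 ≤ σ ^ 2 := pow_le_pow_of_le_one hσ0 hσ (by norm_num)
    refine ⟨Real.one_le_rpow one_le_two (mul_nonneg (by linarith) hn'.le), ?_⟩
    refine (card_unbalanced n s a hn).trans (mul_le_mul_of_nonneg_left ?_ zero_le_two)
    have e1 : (1 - 1 / 2048 * σ ^ 4) * (n : ℝ) = n + -(σ ^ 4 * n / 2048) := by ring
    rw [e1, Real.rpow_add two_pos, Real.rpow_natCast]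
    refine mul_le_mul_of_nonneg_left ?_ (by positivity)
    rw [Real.rpow_def_of_pos two_pos]
    refine Real.exp_le_exp.2 ?_
    have e2 : (s : ℝ) ^ 2 / (2048 * n) = σ ^ 2 * n / 2048 := by
      rw [hs]; field_simp
    rw [e2]
    have h5 : Real.log 2 ≤ 1 := by have := Real.log_two_lt_d9; linarith
    have h6 : 0 ≤ σ ^ 4 * n / 2048 := by positivity
    have h7 : Real.log 2 * (σ ^ 4 * n / 2048) ≤ 1 * (σ ^ 4 * n / 2048) :=
      mul_le_mul_of_nonneg_right h5 h6
    have h8 : σ ^ 4 * n / 2048 ≤ σ ^ 2 * n / 2048 := by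
      have := mul_le_mul_of_nonneg_right h4 hn'.le
      linarith
    linarith

theorem unitCost_wordLength_le {n T : ℕ} (hT : 1 ≤ T) :
    RAM.unitCost T (wordLength n) ≤ 36000001 * 256 * (n + 1) ^ 8 * T := by
  have h1 : (n + 2) ^ 8 ≤ (2 * (n + 1)) ^ 8 := Nat.pow_le_pow_left (by omega) 8
  have h2 : RAM.unitCost T (wordLength n) = T + 36000000 * (n + 2) ^ 8 := by
    rw [RAM.unitCost, wordLength]; ring
  have h3 : (2 * (n + 1)) ^ 8 = 256 * (n + 1) ^ 8 := by ring
  rw [h3] at h1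
  have h4 : 1 ≤ (n + 1) ^ 8 := Nat.one_le_pow _ _ (by omega)
  have h5 : (n + 1) ^ 8 ≤ (n + 1) ^ 8 * T := Nat.le_mul_of_pos_right _ hT
  have h6 : T ≤ (n + 1) ^ 8 * T := Nat.le_mul_of_pos_left _ h4
  rw [h2, mul_assoc (36000001 * 256)]
  omega

theorem exists_exec_setPartitionProgram {n m s : ℕ} {σ : ℝ} (G : FamilyGraph m n) {T : ℕ}
    (hs : (s : ℝ) = σ * n) (hσ : σ ≤ 1) (hT : 1 ≤ T)
    (hG : ∀ f : Fin m, 0 < (G.nbr f).card ∧ ((G.nbr f).card : ℝ) ≤ σ ^ 4 * n / 8)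
    (ω : ℕ → Bool) :
    ∃ k, RAM.Exec G.oracle T ω RAM.setPartitionProgram (RAM.start n s) k ∧
      (k.mem 0 = 1 ↔ G.HasSetPartition s) ∧
      (k.time : ℝ) ≤ (2 : ℝ) ^ ((1 - 1 / 2048 * σ ^ 4) * (n : ℝ)) *
        ((600 * 36000001 * 256 : ℕ) * ((n : ℝ) + 1) ^ 10) * T := by
  set E := (2 : ℝ) ^ ((1 - 1 / 2048 * σ ^ 4) * (n : ℝ)) with hE
  have hE1 : 1 ≤ E := (card_unbalanced_le_rpow (a := 0) hs hσ).1
  have hsn : s ≤ n := by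
    have : (s : ℝ) ≤ n := by
      rw [hs]; exact mul_le_of_le_one_left (Nat.cast_nonneg n) hσ
    exact_mod_cast this
  have hd : ∀ a, (unbalanced n s a).card ≤ ⌊2 * E⌋₊ := fun a =>
    Nat.le_floor (card_unbalanced_le_rpow hs hσ).2
  obtain ⟨M', -, ⟨h1, h2⟩, hr⟩ := RAM.Reach.setPartitionProgram (T := T) (ω := ω) hsn
    G.family_subset (fun Y _ => G.oracle_binCode Y) hd
  obtain ⟨τ, hτ, hex⟩ := hr 0 0
  rw [← G.hasSetPartition_iff fun f => (hG f).1] at h1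
  refine ⟨⟨M', 0, τ⟩, hex, ⟨h1, fun hp => h2 ?_⟩, ?_⟩
  · rw [G.hasSetPartition_iff fun f => (hG f).1] at hp
    -- For n = 0 the empty partition is split into two empty halves by the zeroth Walsh function.
    rcases Nat.eq_zero_or_pos n with rfl | hn
    · obtain rfl : s = 0 := by omega
      have h0 : IsPartition G.family 0 ∅ := ⟨fun _ => ∅, fun i => i.elim0, by simp, by simp⟩
      exact ⟨0, by simp, ∅, empty_mem_unbalanced le_rfl, empty_mem_unbalanced le_rfl, h0, h0⟩
    · refine exists_unbalanced_halves hn (fun X hX => ?_) hp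
      obtain ⟨f, -, rfl⟩ := Finset.mem_image.1 hX
      obtain ⟨h3, h4⟩ := hG f
      refine ⟨G.natNbr_subset f, by rwa [G.card_natNbr], ?_⟩
      rw [G.card_natNbr]
      have hn' : (0 : ℝ) < n := by exact_mod_cast hn
      have hσ0 : 0 ≤ σ := by
        by_contra h
        have h5 : σ * n < 0 := mul_neg_of_neg_of_pos (not_le.1 h) hn'
        have h6 : (0 : ℝ) ≤ s := Nat.cast_nonneg s
        linarith
      -- All that is needed of the size hypothesis is that blocks have size at most s/8.
      have h7 : σ ^ 4 ≤ σ ^ 1 := pow_le_pow_of_le_one hσ0 hσ (by norm_num)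
      have h8 := mul_le_mul_of_nonneg_right h7 hn'.le
      rw [pow_one, ← hs] at h8
      have h9 : 8 * ((G.nbr f).card : ℝ) ≤ s := by linarith
      exact_mod_cast h9
  -- This uses E ≥ 1 and turns the factor 200 into 600; the exponent 10 is 2 from the statement
  -- count plus 8 from the cost of a statement.
  · have hfl : ((⌊2 * E⌋₊ : ℕ) : ℝ) + 1 ≤ 3 * E := by
      have := Nat.floor_le (show 0 ≤ 2 * E by linarith)
      linarith
    have h3 : τ ≤ 200 * (n + 1) ^ 2 * (⌊2 * E⌋₊ + 1) * (36000001 * 256 * (n + 1) ^ 8 * T) := by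
      rw [zero_add] at hτ
      exact hτ.trans (Nat.mul_le_mul_left _ (unitCost_wordLength_le hT))
    have h4 : (τ : ℝ) ≤ 200 * ((n : ℝ) + 1) ^ 2 * ((⌊2 * E⌋₊ : ℕ) + 1) *
        (36000001 * 256 * ((n : ℝ) + 1) ^ 8 * T) := by exact_mod_cast h3
    refine h4.trans ?_
    have h5 : 200 * ((n : ℝ) + 1) ^ 2 * ((⌊2 * E⌋₊ : ℕ) + 1) *
        (36000001 * 256 * ((n : ℝ) + 1) ^ 8 * T) ≤ 200 * ((n : ℝ) + 1) ^ 2 * (3 * E) *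
        (36000001 * 256 * ((n : ℝ) + 1) ^ 8 * T) := by gcongr
    refine h5.trans (le_of_eq ?_)
    push_cast
    ring

theorem mainTheorem5 :
    ∃ (p : RAM.Program) (c : ℝ) (C d : ℕ), 0 < c ∧
      ∀ (n m s : ℕ) (σ : ℝ) (G : FamilyGraph m n) (T : ℕ),
        (s : ℝ) = σ * n → σ ≤ 1 → 1 ≤ T →
        (∀ f : Fin m, 0 < (G.nbr f).card ∧ ((G.nbr f).card : ℝ) ≤ σ ^ 4 * n / 8) →
          -- running time, whatever the random bits are
          (∀ ω : ℕ → Bool, ∃ t : ℕ, RAM.HaltsIn p G.oracle T n s ω t ∧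
            (t : ℝ) ≤ (2 : ℝ) ^ ((1 - c * σ ^ 4) * (n : ℝ)) * (C * ((n : ℝ) + 1) ^ d) * T) ∧
          -- no false positives
          (¬ G.HasSetPartition s → ∀ ω : ℕ → Bool, ¬ RAM.SaysYes p G.oracle T n s ω) ∧
          -- false negatives have probability at most 1/4
          (G.HasSetPartition s →
            RAM.fairCoins {ω | ¬ RAM.SaysYes p G.oracle T n s ω} ≤ 1 / 4) := by
  refine ⟨RAM.setPartitionProgram, 1 / 2048, 600 * 36000001 * 256, 10, by norm_num, ?_⟩
  intro n m s σ G T hs hσ hT hG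
  have key := exists_exec_setPartitionProgram G hs hσ hT hG
  refine ⟨fun ω => ?_, fun hno ω => ?_, fun hyes => ?_⟩
  · obtain ⟨k, h1, -, h2⟩ := key ω
    exact ⟨k.time, ⟨k, h1, rfl⟩, h2⟩
  · rintro ⟨k', h1, h2⟩
    obtain ⟨k, h3, h4, -⟩ := key ω
    obtain rfl := h1.det h3
    exact hno (h4.1 h2)
  -- Since every coin sequence leads to YES, the event of a false negative is empty.
  · have : {ω | ¬ RAM.SaysYes RAM.setPartitionProgram G.oracle T n s ω} = ∅ := by
      ext ω
      obtain ⟨k, h3, h4, -⟩ := key ω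
      simp only [Set.mem_ofPred_eq, Set.mem_empty_iff_false, iff_false, not_not]
      exact ⟨k, h3, h4.2 hyes⟩
    rw [this, MeasureTheory.measure_empty]
    exact zero_le
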